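/- **Theorem (Slow quantum Gibbs sampling).** *Codes.* Let $H\in\mathbb F_2^{m\times n}$ be the parity-check matrix of a $(\Delta_B,\Delta_C)$-LDPC code (the maximum Hamming weights of the columns and rows of $H$ are $\Delta_B$ and $\Delta_C$). Its Tanner graph (bits = columns, checks = rows) is a $(\gamma,\delta)$ expander if every bit has degree $\Delta_B$, every check has degree $\Delta_C$, every set $B'$ of bits with $|B'|\le\gamma n$ has at least $(1-\delta)\Delta_B|B'|$ neighbouring checks, and every set $C'$ of checks with $|C'|\le\gamma m$ has at least $(1-\delta)\Delta_C|C'|$ neighbouring bits. The hypergraph product of the code with itself is the CSS code on $N=n^2+m^2$ qubits with $$H_X=(H\otimes 1_n\mid 1_m\otimes H^{T}),\qquad H_Z=(1_n\otimes H\mid H^{T}\otimes 1_m),$$ and its Hamiltonian is $\mathcal H=-\sum_{S}\prod_{i\in S}X_i-\sum_{S}\prod_{i\in S}Z_i$, the sums running over the rows of $H_X$ and $H_Z$. *Gibbs sampling.* A Gibbs acceptance rule at inverse temperature $\beta$ is a function $a:\mathbb R\to[0,1]$ with $a(\Delta)=e^{-\beta\Delta}a(-\Delta)$ for all $\Delta$,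 for example the Metropolis rule $a(\Delta)=\min(1,e^{-\beta\Delta})$. (Q) One step of the quantum Gibbs sampler chooses a qubit $i$ and a Pauli operator $P\in\{X_i,Z_i\}$ uniformly at random, measures all stabilizers that anticommute with $P$, and then applies $P$ with probability $a(\Delta)$, where $\Delta$ is the change of energy that $P$ would cause given the outcomes; otherwise it does nothing more. Its mixing time is the least $t$ such that from every initial density matrix the state after $t$ steps is within trace distance $1/4$ of the Gibbs state $e^{-\beta\mathcal H}/\operatorname{tr}e^{-\beta\mathcal H}$. (X), (Z) The sampler of $X$ errors (of $Z$ errors) is the Markov chain on $\mathbb F_2^N$ with energy $\mathcal H(x)=2|Ax|-(\text{number of rows of }A)$, where $A=H_Z$ (respectively $A=H_X$): one step chooses a coordinate uniformly at random and flips it with probability $a(\Delta)$, where $\Delta$ is the resulting change of energy. Its mixing time is the least $t$ such that from every initial state the distribution after $t$ steps is within total variation distance $1/4$ of the distribution proportional to $e^{-\beta\mathcal H(x)}$. A mixing time is $\infty$ if there is no such $t$. *Statement.* Let $0<\Delta_B<\Delta_C$ be integers, $\gamma>0$, $\delta<1/6$, and $z=\Delta_C(\Delta_B+\Delta_C-1)$.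 There is $\beta_c$ with $0\le\beta_c\le 3\log(2z)$ such that for every $\beta>\beta_c$ there are a constant $\alpha>0$ and an $N_0$ (independent of the code and of $N$) with the following property. For every $(\Delta_B,\Delta_C)$-LDPC code with $n>m$ whose Tanner graph is a $(\gamma,\delta)$ expander and for which $N=n^2+m^2\ge N_0$, and for every Gibbs acceptance rule $a$ at inverse temperature $\beta$, each of the three mixing times (Q), (X), (Z) of Gibbs sampling on its hypergraph product with itself satisfies $$t_{\mathrm{mix}}\ \ge\ e^{\alpha\sqrt N}.$$ -/

import Mathlib

open scoped Matrix Kronecker ENNReal ComplexOrder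

noncomputable section

namespace GibbsHGP

/-! ## Classical LDPC codes and expansion -/

section Codes

variable {B C : Type*} [Fintype B] [Fintype C] [DecidableEq B] [DecidableEq C]

/-- A parity-check matrix `H` (rows are checks, columns are bits) is `(ΔB, ΔC)`-LDPC if the maximum
Hamming weights of its columns and rows are `ΔB` and `ΔC`, respectively. -/
def IsLDPC (H : Matrix C B (ZMod 2)) (ΔB ΔC : ℕ) : Prop :=
  (Finset.univ.sup fun b => hammingNorm (Hᵀ b)) = ΔB ∧
    (Finset.univ.sup fun c => hammingNorm (H c)) = ΔC

/-- The boundary of a set `S` of bits in the Tanner graph of `H`: all checks that are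
adjacent to some bit of `S`. Applied to `Hᵀ` it is the boundary of a set of checks. -/
def boundary (H : Matrix C B (ZMod 2)) (S : Finset B) : Finset C :=
  S.biUnion fun b => Finset.univ.filter fun c => H c b ≠ 0

/-- `(γ, δ)` left-expansion with left degree `Δ`. -/
def IsLeftExpanding (H : Matrix C B (ZMod 2)) (Δ : ℕ) (γ δ : ℝ) : Prop :=
  ∀ S : Finset B, (S.card : ℝ) ≤ γ * Fintype.card B →
    (1 - δ) * Δ * S.card ≤ ((boundary H S).card : ℝ)

/-- The Tanner graph of `H` is biregular with degrees `ΔB` (bits) and `ΔC` (checks) and is a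
`(γ, δ)` expander, that is, it is both left- and right-expanding. -/
structure IsExpander (H : Matrix C B (ZMod 2)) (ΔB ΔC : ℕ) (γ δ : ℝ) : Prop where
  bit_degree : ∀ b, hammingNorm (Hᵀ b) = ΔB
  check_degree : ∀ c, hammingNorm (H c) = ΔC
  left : IsLeftExpanding H ΔB γ δ
  right : IsLeftExpanding Hᵀ ΔC γ δ

end Codes

/-! ## The hypergraph product -/

section HGP

variable {B₁ C₁ B₂ C₂ : Type*} [DecidableEq B₁] [DecidableEq C₁] [DecidableEq B₂] [DecidableEq C₂]

/-- `H_X = (H₁ ⊗ 1 | 1 ⊗ H₂ᵀ)`. The qubits are indexed by `B₁ × B₂ ⊕ C₁ × C₂`. -/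
def hgpX (H₁ : Matrix C₁ B₁ (ZMod 2)) (H₂ : Matrix C₂ B₂ (ZMod 2)) :
    Matrix (C₁ × B₂) (B₁ × B₂ ⊕ C₁ × C₂) (ZMod 2) :=
  Matrix.fromCols (H₁ ⊗ₖ (1 : Matrix B₂ B₂ (ZMod 2))) ((1 : Matrix C₁ C₁ (ZMod 2)) ⊗ₖ H₂ᵀ)

/-- `H_Z = (1 ⊗ H₂ | H₁ᵀ ⊗ 1)`. -/
def hgpZ (H₁ : Matrix C₁ B₁ (ZMod 2)) (H₂ : Matrix C₂ B₂ (ZMod 2)) :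
    Matrix (B₁ × C₂) (B₁ × B₂ ⊕ C₁ × C₂) (ZMod 2) :=
  Matrix.fromCols ((1 : Matrix B₁ B₁ (ZMod 2)) ⊗ₖ H₂) (H₁ᵀ ⊗ₖ (1 : Matrix C₂ C₂ (ZMod 2)))

end HGP

/-! ## Local acceptance rules -/

/-- An acceptance rule at inverse temperature `β`: a proposed flip that changes the energy by `Δ` is
accepted with probability `a Δ`, and detailed balance with respect to the Gibbs distribution
holds. -/
structure IsGibbsRule (β : ℝ) (a : ℝ → ℝ) : Prop where
  nonneg : ∀ Δ, 0 ≤ a Δ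
  le_one : ∀ Δ, a Δ ≤ 1
  detailed_balance : ∀ Δ, a Δ = Real.exp (-β * Δ) * a (-Δ)

/-- The Metropolis rule. -/
def metropolis (β Δ : ℝ) : ℝ := min 1 (Real.exp (-β * Δ))

theorem isGibbsRule_metropolis (β : ℝ) : IsGibbsRule β (metropolis β) where
  nonneg Δ := le_min zero_le_one (Real.exp_pos _).le
  le_one Δ := min_le_left _ _
  detailed_balance Δ := by
    unfold metropolis
    rw [mul_min_of_nonneg _ _ (Real.exp_pos _).le, ← Real.exp_add, mul_one, min_comm]
    simp

/-! ## Gibbs sampling of errors of one type, as a Markov chain -/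

section Classical

variable {Q S : Type*} [Fintype Q] [Fintype S] [DecidableEq Q] [DecidableEq S]

/-- The energy `2 |A x| - #checks` of the error `x` under the parity checks `A`. -/
def energy (A : Matrix S Q (ZMod 2)) (x : Q → ZMod 2) : ℝ :=
  2 * (hammingNorm (A *ᵥ x) : ℝ) - Fintype.card S

/-- The Gibbs distribution on errors. -/
def gibbsDist (β : ℝ) (A : Matrix S Q (ZMod 2)) (x : Q → ZMod 2) : ℝ :=
  Real.exp (-β * energy A x) / ∑ y, Real.exp (-β * energy A y)

/-- Flip the coordinate `i`. -/
def flip (x : Q → ZMod 2) (i : Q) : Q → ZMod 2 := x + Pi.single i 1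

/-- One step of the sampler: choose a site uniformly, flip it with the probability given by the
acceptance rule, and do nothing otherwise. -/
def errorChain (a : ℝ → ℝ) (A : Matrix S Q (ZMod 2)) :
    Matrix (Q → ZMod 2) (Q → ZMod 2) ℝ :=
  Matrix.of fun x y => ∑ i, (Fintype.card Q : ℝ)⁻¹ *
    (a (energy A (flip x i) - energy A x) * (if y = flip x i then 1 else 0) +
      (1 - a (energy A (flip x i) - energy A x)) * (if y = x then 1 else 0))

/-- Total variation distance of two distributions on a finite set. -/
def tvDist {Ω : Type*} [Fintype Ω] (p q : Ω → ℝ) : ℝ := 2⁻¹ * ∑ x, |p x - q x|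

/-- The mixing time of the Markov chain with transition matrix `P` towards `π`: the least `t` such
that from every starting point the distribution after `t` steps is within total variation distance
`1/4` of `π` (and `∞` if there is none). -/
def mixingTime {Ω : Type*} [Fintype Ω] [DecidableEq Ω] (P : Matrix Ω Ω ℝ) (π : Ω → ℝ) : ℕ∞ :=
  ⨅ t ∈ {t : ℕ | ∀ x, tvDist ((P ^ t) x) π ≤ 1 / 4}, (t : ℕ∞)

/-- The mixing time of Gibbs sampling of errors that are detected by the checks `A`. -/
def errorMixingTime (β : ℝ) (a : ℝ → ℝ) (A : Matrix S Q (ZMod 2)) : ℕ∞ :=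
  mixingTime (errorChain a A) (gibbsDist β A)

end Classical

/-! ## Gibbs sampling of the quantum code, as a quantum channel -/

section Quantum

variable {Q SX SZ : Type*} [Fintype Q] [DecidableEq Q] [Fintype SX] [DecidableEq SX]
  [Fintype SZ] [DecidableEq SZ]

/-- Operators on the Hilbert space of the qubits `Q`, in the computational basis. -/
abbrev Op (Q : Type*) := Matrix (Q → ZMod 2) (Q → ZMod 2) ℂ

/-- The product of Pauli `X` over the support of `v`: `|y⟩ ↦ |y + v⟩`. -/
def pauliX (v : Q → ZMod 2) : Op Q := Matrix.of fun x y => if x = y + v then 1 else 0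

/-- The product of Pauli `Z` over the support of `v`: `|x⟩ ↦ (-1)^(v · x) |x⟩`. -/
def pauliZ (v : Q → ZMod 2) : Op Q := Matrix.diagonal fun x => if v ⬝ᵥ x = 0 then 1 else -1

theorem pauliX_mul (u v : Q → ZMod 2) : pauliX u * pauliX v = pauliX (u + v) := by
  ext x y
  simp only [pauliX, Matrix.mul_apply, Matrix.of_apply]
  rw [Finset.sum_eq_single (y + v)]
  · simp [add_assoc, add_comm v u]
  · intro w _ hw
    simp [hw]
  · simp

theorem pauliX_commute (u v : Q → ZMod 2) : Commute (pauliX u) (pauliX v) := by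
  rw [Commute, SemiconjBy, pauliX_mul, pauliX_mul, add_comm]

theorem pauliZ_commute (u v : Q → ZMod 2) : Commute (pauliZ u) (pauliZ v) :=
  Matrix.commute_diagonal _ _

theorem commute_half {M N : Op Q} (h : Commute M N) (r s : ℂ) :
    Commute ((2⁻¹ : ℂ) • (1 + r • M)) ((2⁻¹ : ℂ) • (1 + s • N)) := by
  refine Commute.smul_left (Commute.smul_right ?_ _) _
  refine Commute.add_left (Commute.one_left _) (Commute.add_right (Commute.one_right _) ?_)
  exact (h.smul_left r).smul_right s

/-- The outcome of measuring the commuting stabilizers `G s`, `s ∈ A`, when `T ⊆ A` is the set of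
stabilizers with outcome `-1`: the projector `∏ (1 ± G s) / 2`. -/
def outcomeProj {ι : Type*} [DecidableEq ι] (G : ι → Op Q) (hG : ∀ s t, Commute (G s) (G t))
    (A T : Finset ι) : Op Q :=
  A.noncommProd (fun s => (2⁻¹ : ℂ) • (1 + (if s ∈ T then (-1 : ℂ) else 1) • G s))
    (fun s _ t _ _ => commute_half (hG s t) _ _)

/-- The local update with the Pauli operator `P`, where `A` is the set of stabilizers that
anticommute with `P`: measure these stabilizers, and if `T ⊆ A` is the set of those with outcome
`-1`, apply `P` with probability `a Δ`, where `Δ = 2 (#(A \ T) - #T)` is the resulting change of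
energy, and do nothing otherwise. -/
def localUpdate {ι : Type*} [DecidableEq ι] (a : ℝ → ℝ) (G : ι → Op Q)
    (hG : ∀ s t, Commute (G s) (G t)) (A : Finset ι) (P ρ : Op Q) : Op Q :=
  ∑ T ∈ A.powerset,
    ((a (2 * ((A \ T).card - T.card)) : ℂ) •
        (P * (outcomeProj G hG A T * ρ * outcomeProj G hG A T) * Pᴴ) +
      ((1 - a (2 * ((A \ T).card - T.card)) : ℝ) : ℂ) •
        (outcomeProj G hG A T * ρ * outcomeProj G hG A T))

/-- One step of the quantum Gibbs sampler of the CSS code with parity-check matrices `HX`, `HZ`: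
choose a qubit `i` and one of `X i`, `Z i` uniformly at random, and do the local update. The
stabilizers that anticommute with `X i` are the `Z`-stabilizers that contain `i`, and vice versa. -/
def quantumSampler (a : ℝ → ℝ) (HX : Matrix SX Q (ZMod 2)) (HZ : Matrix SZ Q (ZMod 2))
    (ρ : Op Q) : Op Q :=
  ((2 * Fintype.card Q : ℂ)⁻¹) • ∑ i : Q,
    (localUpdate a (fun s => pauliZ (HZ s)) (fun _ _ => pauliZ_commute _ _)
        (Finset.univ.filter fun s => HZ s i ≠ 0) (pauliX (Pi.single i 1)) ρ +
      localUpdate a (fun s => pauliX (HX s)) (fun _ _ => pauliX_commute _ _)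
        (Finset.univ.filter fun s => HX s i ≠ 0) (pauliZ (Pi.single i 1)) ρ)

/-- The Hamiltonian of the CSS code: minus the sum of all stabilizers. -/
def hamiltonian (HX : Matrix SX Q (ZMod 2)) (HZ : Matrix SZ Q (ZMod 2)) : Op Q :=
  -(∑ s, pauliX (HX s)) - ∑ s, pauliZ (HZ s)

/-- The Gibbs state `exp (-β H) / tr exp (-β H)`. -/
def gibbsState (β : ℝ) (HX : Matrix SX Q (ZMod 2)) (HZ : Matrix SZ Q (ZMod 2)) : Op Q :=
  (NormedSpace.exp (-(β : ℂ) • hamiltonian HX HZ)).trace⁻¹ •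
    NormedSpace.exp (-(β : ℂ) • hamiltonian HX HZ)

/-- The trace norm: the sum of the singular values. -/
def traceNorm {Ω : Type*} [Fintype Ω] [DecidableEq Ω] (M : Matrix Ω Ω ℂ) : ℝ :=
  ∑ i, √((Matrix.posSemidef_conjTranspose_mul_self M).isHermitian.eigenvalues i)

/-- Density matrices. -/
def IsState {Ω : Type*} [Fintype Ω] (ρ : Matrix Ω Ω ℂ) : Prop :=
  ρ.PosSemidef ∧ ρ.trace = 1

/-- The mixing time of the quantum Gibbs sampler: the least `t` such that from every initial state
the state after `t` steps is within trace distance `1/4` of the Gibbs state (and `∞` if there is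
none). -/
def quantumMixingTime (β : ℝ) (a : ℝ → ℝ) (HX : Matrix SX Q (ZMod 2))
    (HZ : Matrix SZ Q (ZMod 2)) : ℕ∞ :=
  ⨅ t ∈ {t : ℕ | ∀ ρ : Op Q, IsState ρ →
      2⁻¹ * traceNorm ((quantumSampler a HX HZ)^[t] ρ - gibbsState β HX HZ) ≤ 1 / 4}, (t : ℕ∞)

end Quantum

end GibbsHGP

end

/-!
Slow mixing of Gibbs samplers on the hypergraph product of an expander code, by a Peierls argument.

*Confinement.* Modulo stabilizers, an error of small weight has at most twice the weight of its
syndrome (`hgp_confinement`). By expansion of the Tanner graph, every small error has a critical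
generator `(c₀, b₀)`: except for fewer than a third of the bits of `c₀` and of the checks of `b₀`,
its checks see no qubit of the error outside the generator (`exists_critical_generator`). If the
error is reduced, flipping either its qubits in this part of the generator or the other ones lowers
the syndrome weight by at least half the number of flipped qubits (`exists_good_flip`); iterate. The
structure `Confined` records what the rest of the argument needs: confinement, bounded degrees, and
a logical operator.

*The region.* A polymer is an error with connected support and at most twice the weight of its
syndrome. Let `R` be the set of errors that are, modulo stabilizers, a sum of polymers of weight at
most `r` with pairwise disjoint syndromes (`region`). Here `r` is a small multiple of `√N`. A flip
out of `R` merges at most `D` polymers into a still small error, which by confinement is again a sum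
of polymers, so the outer boundary of `R` consists of errors with a polymer of weight larger than
`r` (`Confined.exists_erase_of_flip`). Erasing the large polymers is a Peierls estimate: there are
of order `(3 z) ^ k` connected sets of size `k` (`sum_isLinked_tail_le`), and the gain in energy is
at least their size, so the boundary has exponentially small weight
(`Confined.sum_outerBoundary_le`). On the other hand `R` does not carry most of the Gibbs measure:
its translate by a logical operator `L` has the same weight, and if both `x` and `x + L` are in `R`,
the two families of polymers form a connected excitation of more than `M` sites, which can be erased
as well (`Confined.exists_erase_of_ambiguous`). Each such excitation may have `2 ^ k` forms and only
gains half its size in energy; this is why the threshold on `β` is three times `log (2 z)`.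

*Mixing.* Started from the Gibbs measure restricted to `R`, the sampler stays in `R` for a time of
the order of the inverse weight of the boundary (`leak_le`), while the Gibbs measure
of its complement is at least `1/3`. For the quantum sampler, observables that are diagonal and
invariant under the `X`-stabilizers are mapped in the Heisenberg picture to observables of the same kind; on
them the `Z` updates act trivially and the `X` updates act as the sampler of `X` errors
(`trace_quantumSampler`). The projector on `R` is such an observable, so the bound carries over.
-/

open scoped Matrix Kronecker ENNReal ComplexOrder

noncomputable section

set_option linter.unusedSectionVars false

namespace GibbsHGP

/-! ### Linked sets of a bounded-degree graph -/

section Linked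

variable {Q : Type*} [DecidableEq Q]

/-- A finite set is linked (connected) for the relation `r` if it is nonempty and no proper nonempty
subset is closed under `r`-steps inside the set. -/
def IsLinked (r : Q → Q → Prop) (U : Finset Q) : Prop :=
  U.Nonempty ∧ ∀ S ⊆ U, S.Nonempty → (∀ a ∈ S, ∀ b ∈ U, r a b → b ∈ S) → S = U

/-- The set `U` grows from `L` if it contains `L` and every point of `U` is reached from `L` by
`r`-steps inside `U`. -/
def GrowsFrom (r : Q → Q → Prop) (L U : Finset Q) : Prop :=
  L ⊆ U ∧ ∀ S, L ⊆ S → S ⊆ U → (∀ a ∈ S, ∀ b ∈ U, r a b → b ∈ S) → S = U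

theorem IsLinked.growsFrom {r : Q → Q → Prop} {U : Finset Q} (h : IsLinked r U) {v : Q}
    (hv : v ∈ U) : GrowsFrom r {v} U :=
  ⟨by simpa using hv, fun S hS hSU hc => h.2 S hSU ⟨v, hS (by simp)⟩ hc⟩

theorem GrowsFrom.eq_empty {r : Q → Q → Prop} {U : Finset Q} (h : GrowsFrom r ∅ U) : U = ∅ :=
  (h.2 ∅ le_rfl (Finset.empty_subset _) (by simp)).symm

/-- Removing a point `v` of `L` from a set that grows from `L`: what remains grows from the rest
of `L` and the neighbours of `v` in the set. -/
theorem GrowsFrom.erase {r : Q → Q → Prop} {L U N : Finset Q} (h : GrowsFrom r L U) {v : Q}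
    (hv : v ∈ L) (hN : ∀ u, u ∈ N ↔ u ∉ L ∧ r v u) :
    GrowsFrom r (L.erase v ∪ (U ∩ N)) (U.erase v) := by
  have hvU : v ∈ U := h.1 hv
  refine ⟨?_, ?_⟩
  · intro a ha
    rcases Finset.mem_union.1 ha with ha | ha
    · exact Finset.mem_erase.2 ⟨(Finset.mem_erase.1 ha).1, h.1 (Finset.mem_erase.1 ha).2⟩
    · refine Finset.mem_erase.2 ⟨?_, (Finset.mem_inter.1 ha).1⟩
      intro hav
      exact ((hN _).1 (Finset.mem_inter.1 ha).2).1 (hav ▸ hv)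
  · intro S hLS hSU hc
    have key : insert v S = U := by
      refine h.2 _ ?_ ?_ ?_
      · intro a ha
        by_cases hav : a = v
        · simp [hav]
        · exact Finset.mem_insert_of_mem (hLS (by simp [hav, ha]))
      · exact Finset.insert_subset hvU (hSU.trans (Finset.erase_subset _ _))
      · intro a ha b hb hab
        by_cases hbv : b = v
        · simp [hbv]
        refine Finset.mem_insert_of_mem ?_
        rcases Finset.mem_insert.1 ha with rfl | ha
        · by_cases hbL : b ∈ L
          · exact hLS (by simp [hbL, hbv])
          · exact hLS (Finset.mem_union_right _ (Finset.mem_inter.2 ⟨hb, (hN b).2 ⟨hbL, hab⟩⟩))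
        · exact hc a ha b (Finset.mem_erase.2 ⟨hbv, hb⟩) hab
    have hvS : v ∉ S := fun hvS => (Finset.mem_erase.1 (hSU hvS)).1 rfl
    rw [← key, Finset.erase_insert hvS]

variable [Fintype Q]

open Classical in
/-- The weighted number of sets that grow from `L` is at most `B ^ |L|`. The induction removes one
point `v` of `L` at a time and sums over the subset of neighbours of `v` that lies in the set, which
costs the factor `(1 + B) ^ z`. -/
theorem sum_growsFrom_le {r : Q → Q → Prop} {z : ℕ} {w B : ℝ} (hw : 0 ≤ w) (hB : 0 ≤ B)
    (hwB : w * (1 + B) ^ z ≤ B)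
    (hdeg : ∀ v, (Finset.univ.filter fun u => u ≠ v ∧ r v u).card ≤ z) (k : ℕ) (L : Finset Q) :
    ∑ U ∈ Finset.univ.filter (fun U : Finset Q => GrowsFrom r L U ∧ U.card ≤ k), w ^ U.card
      ≤ B ^ L.card := by
  induction k generalizing L with
  | zero =>
    rcases L.eq_empty_or_nonempty with rfl | hL
    · refine (Finset.sum_le_sum_of_subset_of_nonneg (t := {∅}) ?_ ?_).trans ?_
      · intro U hU
        simp only [Finset.mem_filter, Finset.mem_univ, true_and] at hU
        simp [hU.1.eq_empty]
      · intros; positivity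
      · simp
    · rw [Finset.sum_eq_zero]
      · positivity
      · intro U hU
        simp only [Finset.mem_filter, Finset.mem_univ, true_and] at hU
        have := (hL.mono hU.1.1).card_pos
        omega
  | succ k ih =>
    rcases L.eq_empty_or_nonempty with rfl | ⟨v, hv⟩
    · refine (Finset.sum_le_sum_of_subset_of_nonneg (t := {∅}) ?_ ?_).trans ?_
      · intro U hU
        simp only [Finset.mem_filter, Finset.mem_univ, true_and] at hU
        simp [hU.1.eq_empty]
      · intros; positivity
      · simp
    set N : Finset Q := Finset.univ.filter fun u => u ∉ L ∧ r v u with hNdef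
    have hN : ∀ u, u ∈ N ↔ u ∉ L ∧ r v u := by simp [hNdef]
    have hNcard : N.card ≤ z := by
      refine le_trans (Finset.card_le_card ?_) (hdeg v)
      intro u hu
      rw [hN] at hu
      simp only [Finset.mem_filter, Finset.mem_univ, true_and]
      exact ⟨fun h => hu.1 (h ▸ hv), hu.2⟩
    rw [← Finset.sum_fiberwise_of_maps_to (t := N.powerset) (g := fun U => U ∩ N)
      (fun U _ => Finset.mem_powerset.2 Finset.inter_subset_right)]
    have hfib : ∀ M ∈ N.powerset,
        ∑ U ∈ (Finset.univ.filter
          (fun U : Finset Q => GrowsFrom r L U ∧ U.card ≤ k + 1)).filter (fun U => U ∩ N = M),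
          w ^ U.card ≤ w * B ^ (L.card - 1) * B ^ M.card := by
      intro M hM
      have hM' := Finset.mem_powerset.1 hM
      have hcard : (L.erase v ∪ M).card = L.card - 1 + M.card := by
        rw [Finset.card_union_of_disjoint, Finset.card_erase_of_mem hv]
        rw [Finset.disjoint_left]
        intro a ha haM
        exact ((hN a).1 (hM' haM)).1 (Finset.mem_erase.1 ha).2
      have hsum : ∑ U ∈ (Finset.univ.filter
          (fun U : Finset Q => GrowsFrom r L U ∧ U.card ≤ k + 1)).filter (fun U => U ∩ N = M),
          w ^ U.card = w * ∑ U ∈ ((Finset.univ.filter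
          (fun U : Finset Q => GrowsFrom r L U ∧ U.card ≤ k + 1)).filter
            (fun U => U ∩ N = M)).image (fun U => U.erase v), w ^ U.card := by
        rw [Finset.sum_image, Finset.mul_sum]
        · refine Finset.sum_congr rfl fun U hU => ?_
          simp only [Finset.mem_filter, Finset.mem_univ, true_and] at hU
          have hvU : v ∈ U := hU.1.1.1 hv
          rw [← pow_succ', Finset.card_erase_add_one hvU]
        · intro U hU U' hU' h
          simp only [Finset.coe_filter, Finset.mem_filter, Finset.mem_univ, true_and,
            Set.mem_ofPred_eq] at hU hU'
          rw [← Finset.insert_erase (hU.1.1.1 hv), ← Finset.insert_erase (hU'.1.1.1 hv)]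
          exact congrArg _ h
      rw [hsum, mul_assoc, ← pow_add, ← hcard]
      refine mul_le_mul_of_nonneg_left (le_trans ?_ (ih (L.erase v ∪ M))) hw
      refine Finset.sum_le_sum_of_subset_of_nonneg ?_ (fun _ _ _ => by positivity)
      intro U' hU'
      obtain ⟨U, hU, rfl⟩ := Finset.mem_image.1 hU'
      simp only [Finset.mem_filter, Finset.mem_univ, true_and] at hU ⊢
      refine ⟨hU.2 ▸ hU.1.1.erase hv hN, ?_⟩
      rw [Finset.card_erase_of_mem (hU.1.1.1 hv)]
      omega
    refine (Finset.sum_le_sum hfib).trans ?_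
    have hpow : ∑ M ∈ N.powerset, B ^ M.card = (1 + B) ^ N.card := by
      have := Finset.sum_pow_mul_eq_add_pow B 1 N
      simp only [one_pow, mul_one] at this
      rw [this, add_comm]
    rw [← Finset.mul_sum, hpow]
    have hLc : L.card = L.card - 1 + 1 := by
      have := Finset.card_pos.2 ⟨v, hv⟩
      omega
    calc w * B ^ (L.card - 1) * (1 + B) ^ N.card
        ≤ w * B ^ (L.card - 1) * (1 + B) ^ z := by
          refine mul_le_mul_of_nonneg_left (pow_le_pow_right₀ (by linarith) hNcard) (by positivity)
      _ = B ^ (L.card - 1) * (w * (1 + B) ^ z) := by ring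
      _ ≤ B ^ (L.card - 1) * B := mul_le_mul_of_nonneg_left hwB (by positivity)
      _ = B ^ L.card := by rw [← pow_succ, ← hLc]

open Classical in
theorem sum_isLinked_le {r : Q → Q → Prop} {z : ℕ} {w B : ℝ} (hw : 0 ≤ w) (hB : 0 ≤ B)
    (hwB : w * (1 + B) ^ z ≤ B)
    (hdeg : ∀ v, (Finset.univ.filter fun u => u ≠ v ∧ r v u).card ≤ z) :
    ∑ U ∈ Finset.univ.filter (fun U : Finset Q => IsLinked r U), w ^ U.card
      ≤ Fintype.card Q * B := by
  calc ∑ U ∈ Finset.univ.filter (fun U : Finset Q => IsLinked r U), w ^ U.card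
      ≤ ∑ U : Finset Q, ∑ v : Q,
          if GrowsFrom r {v} U ∧ U.card ≤ Fintype.card Q then w ^ U.card else 0 := by
        rw [Finset.sum_filter]
        refine Finset.sum_le_sum fun U _ => ?_
        split_ifs with hU
        · obtain ⟨v, hv⟩ := hU.1
          refine le_trans (le_of_eq ?_) (Finset.single_le_sum (f := fun v : Q =>
            if GrowsFrom r {v} U ∧ U.card ≤ Fintype.card Q then w ^ U.card else 0)
            (fun v _ => ?_) (Finset.mem_univ v))
          · rw [if_pos ⟨hU.growsFrom hv, Finset.card_le_univ U⟩]
          · positivity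
        · positivity
    _ = ∑ v : Q, ∑ U ∈ Finset.univ.filter (fun U : Finset Q =>
          GrowsFrom r {v} U ∧ U.card ≤ Fintype.card Q), w ^ U.card := by
        rw [Finset.sum_comm]
        simp only [Finset.sum_filter]
    _ ≤ ∑ v : Q, B := by
        refine Finset.sum_le_sum fun v _ => ?_
        simpa using sum_growsFrom_le hw hB hwB hdeg (Fintype.card Q) {v}
    _ = Fintype.card Q * B := by simp

open Classical in
/-- The number of linked sets of size `k` is at most of order `(3 z) ^ k`, in the form of a tail
bound for weights that are smaller than `1 / (3 z)` by the factor `2 / 3`. -/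
theorem sum_isLinked_tail_le {r : Q → Q → Prop} {z : ℕ} {w : ℝ} (hz : 1 ≤ z) (hw : 0 ≤ w)
    (hwz : w ≤ 2 / 3 * (1 / (3 * z)))
    (hdeg : ∀ v, (Finset.univ.filter fun u => u ≠ v ∧ r v u).card ≤ z) (k : ℕ) :
    ∑ U ∈ Finset.univ.filter (fun U : Finset Q => IsLinked r U ∧ k ≤ U.card), w ^ U.card
      ≤ Fintype.card Q * (2 / 3 : ℝ) ^ k := by
  have hz' : (1 : ℝ) ≤ z := by exact_mod_cast hz
  have hexp : (1 + 1 / (z : ℝ)) ^ z ≤ 3 := by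
    have h1 : 1 + 1 / (z : ℝ) ≤ Real.exp (1 / z) := by
      rw [add_comm]; exact Real.add_one_le_exp _
    calc (1 + 1 / (z : ℝ)) ^ z ≤ Real.exp (1 / z) ^ z := pow_le_pow_left₀ (by positivity) h1 _
      _ = Real.exp 1 := by
        rw [← Real.exp_nat_mul]
        congr 1
        field_simp
      _ ≤ 3 := Real.exp_one_lt_three.le
  have hmain := sum_isLinked_le (r := r) (z := z) (w := 1 / (3 * z)) (B := 1 / z) (by positivity)
    (by positivity) (by
      calc 1 / (3 * (z : ℝ)) * (1 + 1 / (z : ℝ)) ^ z ≤ 1 / (3 * (z : ℝ)) * 3 :=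
            mul_le_mul_of_nonneg_left hexp (by positivity)
        _ = 1 / z := by field_simp) hdeg
  calc ∑ U ∈ Finset.univ.filter (fun U : Finset Q => IsLinked r U ∧ k ≤ U.card), w ^ U.card
      ≤ ∑ U ∈ Finset.univ.filter (fun U : Finset Q => IsLinked r U ∧ k ≤ U.card),
          (2 / 3 : ℝ) ^ k * (1 / (3 * (z : ℝ))) ^ U.card := by
        refine Finset.sum_le_sum fun U hU => ?_
        simp only [Finset.mem_filter, Finset.mem_univ, true_and] at hU
        calc w ^ U.card ≤ (2 / 3 * (1 / (3 * (z : ℝ)))) ^ U.card := pow_le_pow_left₀ hw hwz _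
          _ = (2 / 3 : ℝ) ^ U.card * (1 / (3 * (z : ℝ))) ^ U.card := mul_pow _ _ _
          _ ≤ _ := mul_le_mul_of_nonneg_right
            (pow_le_pow_of_le_one (by norm_num) (by norm_num) hU.2) (by positivity)
    _ ≤ ∑ U ∈ Finset.univ.filter (fun U : Finset Q => IsLinked r U),
          (2 / 3 : ℝ) ^ k * (1 / (3 * (z : ℝ))) ^ U.card := by
        refine Finset.sum_le_sum_of_subset_of_nonneg ?_ (fun _ _ _ => by positivity)
        intro U hU
        simp only [Finset.mem_filter, Finset.mem_univ, true_and] at hU ⊢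
        exact hU.1
    _ ≤ (2 / 3 : ℝ) ^ k * (Fintype.card Q * (1 / z)) := by
        rw [← Finset.mul_sum]
        exact mul_le_mul_of_nonneg_left hmain (by positivity)
    _ ≤ (2 / 3 : ℝ) ^ k * (Fintype.card Q * 1) := by
        gcongr
        exact (div_le_one (by positivity)).2 hz'
    _ = _ := by ring

/-- Every finite set is a union of linked pieces without `r`-steps between different pieces. -/
theorem exists_linked_pieces {r : Q → Q → Prop} (hr : ∀ a b, r a b → r b a) (U : Finset Q) :
    ∃ 𝓟 : Finset (Finset Q), (∀ P ∈ 𝓟, IsLinked r P) ∧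
      (∀ P ∈ 𝓟, ∀ P' ∈ 𝓟, P ≠ P' → Disjoint P P' ∧ ∀ a ∈ P, ∀ b ∈ P', ¬ r a b) ∧
      𝓟.biUnion id = U := by
  induction U using Finset.strongInduction with
  | H U ih =>
    rcases U.eq_empty_or_nonempty with rfl | hU
    · exact ⟨∅, by simp, by simp, by simp⟩
    classical
    set 𝓢 : Finset (Finset Q) := U.powerset.filter fun S =>
      S.Nonempty ∧ ∀ a ∈ S, ∀ b ∈ U, r a b → b ∈ S with h𝓢
    have hmem : ∀ S, S ∈ 𝓢 ↔ S ⊆ U ∧ S.Nonempty ∧ ∀ a ∈ S, ∀ b ∈ U, r a b → b ∈ S := by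
      simp [h𝓢]
    obtain ⟨K, hK, hmin⟩ := Finset.exists_min_image 𝓢 Finset.card
      ⟨U, (hmem U).2 ⟨le_rfl, hU, fun _ _ b hb _ => hb⟩⟩
    obtain ⟨hKU, hKne, hKc⟩ := (hmem K).1 hK
    have hKl : IsLinked r K := by
      refine ⟨hKne, fun S hS hSne hSc => ?_⟩
      refine Finset.eq_of_subset_of_card_le hS (hmin S ((hmem S).2 ⟨hS.trans hKU, hSne, ?_⟩))
      exact fun a ha b hb hab => hSc a ha b (hKc a (hS ha) b hb hab) hab
    obtain ⟨𝓟, h1, h2, h3⟩ := ih (U \ K) (Finset.sdiff_ssubset hKU hKne)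
    have hsub : ∀ P ∈ 𝓟, P ⊆ U \ K := fun P hP => by
      rw [← h3]
      exact Finset.subset_biUnion_of_mem id hP
    have hnew : ∀ P ∈ 𝓟, Disjoint K P ∧ ∀ a ∈ K, ∀ b ∈ P, ¬ r a b := by
      intro P hP
      refine ⟨Finset.disjoint_left.2 fun a ha haP =>
        (Finset.mem_sdiff.1 (hsub P hP haP)).2 ha, fun a ha b hb hab => ?_⟩
      have hb' := Finset.mem_sdiff.1 (hsub P hP hb)
      exact hb'.2 (hKc a ha b hb'.1 hab)
    refine ⟨insert K 𝓟, ?_, ?_, ?_⟩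
    · intro P hP
      rcases Finset.mem_insert.1 hP with rfl | hP
      exacts [hKl, h1 P hP]
    · intro P hP P' hP' hne
      rcases Finset.mem_insert.1 hP with hPK | hP1 <;>
        rcases Finset.mem_insert.1 hP' with hPK' | hP1'
      · exact absurd (hPK.trans hPK'.symm) hne
      · rw [hPK]
        exact hnew P' hP1'
      · rw [hPK']
        exact ⟨(hnew P hP1).1.symm, fun a ha b hb hab => (hnew P hP1).2 b hb a ha (hr _ _ hab)⟩
      · exact h2 P hP1 P' hP1' hne
    · rw [Finset.biUnion_insert, h3, id, Finset.union_sdiff_of_subset hKU]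

/-- A linked subset of a union of pieces without steps between them lies in one of the pieces. -/
theorem IsLinked.subset_piece {r : Q → Q → Prop} {K : Finset Q} (hK : IsLinked r K)
    {𝓟 : Finset (Finset Q)}
    (h𝓟 : ∀ P ∈ 𝓟, ∀ P' ∈ 𝓟, P ≠ P' → Disjoint P P' ∧ ∀ a ∈ P, ∀ b ∈ P', ¬ r a b)
    (hKU : K ⊆ 𝓟.biUnion id) {P : Finset Q} (hP : P ∈ 𝓟) (hne : (K ∩ P).Nonempty) : K ⊆ P := by
  have : K ∩ P = K := by
    refine hK.2 _ Finset.inter_subset_left hne fun a ha b hb hab => ?_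
    refine Finset.mem_inter.2 ⟨hb, ?_⟩
    obtain ⟨P', hP', hbP'⟩ := Finset.mem_biUnion.1 (hKU hb)
    by_cases h : P = P'
    · exact h ▸ hbP'
    · exact absurd hab ((h𝓟 P hP P' hP' h).2 a (Finset.mem_inter.1 ha).2 b hbP')
  exact Finset.inter_eq_left.1 this

end Linked

/-! ### Errors, syndromes and polymers -/

section Polymers

variable {Q S : Type*} [Fintype Q] [Fintype S] [DecidableEq Q] [DecidableEq S]

theorem add_self_zmod_two {ι : Type*} (v : ι → ZMod 2) : v + v = 0 := by
  ext i
  exact CharTwo.add_self_eq_zero (v i)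

theorem eq_of_add_eq_zero_zmod_two {ι : Type*} {u v : ι → ZMod 2} (h : u + v = 0) : u = v := by
  rw [← add_zero u, ← add_self_zmod_two v, ← add_assoc, h, zero_add]

/-- The support of an error. -/
def vsupp (v : Q → ZMod 2) : Finset Q := Finset.univ.filter fun i => v i ≠ 0

theorem mem_vsupp {v : Q → ZMod 2} {i : Q} : i ∈ vsupp v ↔ v i ≠ 0 := by simp [vsupp]

theorem hammingNorm_eq_card (v : Q → ZMod 2) : hammingNorm v = (vsupp v).card := rfl

theorem hammingNorm_add_le (u v : Q → ZMod 2) :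
    hammingNorm (u + v) ≤ hammingNorm u + hammingNorm v := by
  simp only [hammingNorm_eq_card]
  refine (Finset.card_le_card ?_).trans (Finset.card_union_le _ _)
  intro i hi
  simp only [Finset.mem_union, mem_vsupp, Pi.add_apply] at hi ⊢
  by_contra! h
  simp [h.1, h.2] at hi

theorem hammingNorm_add_of_disjoint {u v : Q → ZMod 2} (h : ∀ i, u i = 0 ∨ v i = 0) :
    hammingNorm (u + v) = hammingNorm u + hammingNorm v := by
  simp only [hammingNorm_eq_card]
  rw [← Finset.card_union_of_disjoint]
  · congr 1
    ext i
    simp only [Finset.mem_union, mem_vsupp, Pi.add_apply]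
    rcases h i with h | h <;> simp [h]
  · rw [Finset.disjoint_left]
    intro i hi hi'
    rw [mem_vsupp] at hi hi'
    rcases h i with h | h
    exacts [hi h, hi' h]

theorem hammingNorm_sum_le {ι : Type*} (T : Finset ι) (f : ι → Q → ZMod 2) :
    hammingNorm (∑ j ∈ T, f j) ≤ ∑ j ∈ T, hammingNorm (f j) := by
  classical
  induction T using Finset.induction_on with
  | empty => simp
  | insert a T ha ih =>
    rw [Finset.sum_insert ha, Finset.sum_insert ha]
    exact (hammingNorm_add_le _ _).trans (Nat.add_le_add_left ih _)

/-- The restriction of an error to a set of sites. -/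
def restr (P : Finset Q) (v : Q → ZMod 2) : Q → ZMod 2 := fun i => if i ∈ P then v i else 0

theorem restr_add (P : Finset Q) (u v : Q → ZMod 2) : restr P (u + v) = restr P u + restr P v := by
  ext i
  by_cases h : i ∈ P <;> simp [restr, h]

theorem restr_sum {ι : Type*} (P : Finset Q) (T : Finset ι) (f : ι → Q → ZMod 2) :
    restr P (∑ j ∈ T, f j) = ∑ j ∈ T, restr P (f j) := by
  ext i
  by_cases h : i ∈ P <;> simp [restr, h]

theorem restr_eq_self {P : Finset Q} {v : Q → ZMod 2} (h : vsupp v ⊆ P) : restr P v = v := by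
  ext i
  by_cases hi : i ∈ P
  · simp [restr, hi]
  · have : v i = 0 := by
      by_contra h0
      exact hi (h (mem_vsupp.2 h0))
    simp [restr, hi, this]

theorem vsupp_restr (P : Finset Q) (v : Q → ZMod 2) : vsupp (restr P v) = P ∩ vsupp v := by
  ext i
  by_cases hi : i ∈ P <;> simp [mem_vsupp, restr, hi]

theorem vsupp_restr_of_subset {P : Finset Q} {v : Q → ZMod 2} (h : P ⊆ vsupp v) :
    vsupp (restr P v) = P := by
  rw [vsupp_restr, Finset.inter_eq_left.2 h]

theorem vsupp_eq_empty {v : Q → ZMod 2} : vsupp v = ∅ ↔ v = 0 := by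
  rw [← Finset.card_eq_zero, ← hammingNorm_eq_card, hammingNorm_eq_zero]

theorem sum_restr_of_pieces {𝓟 : Finset (Finset Q)}
    (hdisj : ∀ P ∈ 𝓟, ∀ P' ∈ 𝓟, P ≠ P' → Disjoint P P') {v : Q → ZMod 2}
    (hv : vsupp v ⊆ 𝓟.biUnion id) : ∑ P ∈ 𝓟, restr P v = v := by
  ext i
  rw [Finset.sum_apply]
  by_cases hi : v i = 0
  · rw [hi]
    refine Finset.sum_eq_zero fun P _ => ?_
    simp [restr, hi]
  · obtain ⟨P, hP, hiP⟩ := Finset.mem_biUnion.1 (hv (mem_vsupp.2 hi))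
    rw [Finset.sum_eq_single_of_mem P hP]
    · simp only [id] at hiP
      simp [restr, hiP]
    · intro P' hP' hne
      have : i ∉ P' := fun h => Finset.disjoint_left.1 (hdisj P' hP' P hP hne) h hiP
      simp [restr, this]

/-- Two sites are neighbours if some check contains both of them. -/
def sharesCheck (A : Matrix S Q (ZMod 2)) (a b : Q) : Prop := ∃ s, A s a ≠ 0 ∧ A s b ≠ 0

theorem sharesCheck_symm (A : Matrix S Q (ZMod 2)) (a b : Q) (h : sharesCheck A a b) :
    sharesCheck A b a := by
  obtain ⟨s, h1, h2⟩ := h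
  exact ⟨s, h2, h1⟩

theorem exists_of_syndrome_ne_zero {A : Matrix S Q (ZMod 2)} {v : Q → ZMod 2} {s : S}
    (h : (A *ᵥ v) s ≠ 0) : ∃ i ∈ vsupp v, A s i ≠ 0 := by
  obtain ⟨i, _, hi⟩ := Finset.exists_ne_zero_of_sum_ne_zero (show ∑ i, A s i * v i ≠ 0 from h)
  exact ⟨i, mem_vsupp.2 (right_ne_zero_of_mul hi), left_ne_zero_of_mul hi⟩

/-- A check that meets one of several mutually non-adjacent pieces sees only that piece. -/
theorem syndrome_restr_of_meets {A : Matrix S Q (ZMod 2)} {𝓟 : Finset (Finset Q)}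
    (h𝓟 : ∀ P ∈ 𝓟, ∀ P' ∈ 𝓟, P ≠ P' → Disjoint P P' ∧ ∀ a ∈ P, ∀ b ∈ P', ¬ sharesCheck A a b)
    {v : Q → ZMod 2} (hv : vsupp v ⊆ 𝓟.biUnion id) {P : Finset Q} (hP : P ∈ 𝓟) {s : S} {i : Q}
    (hi : i ∈ P) (hs : A s i ≠ 0) : (A *ᵥ restr P v) s = (A *ᵥ v) s := by
  conv_rhs => rw [← sum_restr_of_pieces (fun P hP P' hP' hne => (h𝓟 P hP P' hP' hne).1) hv]
  rw [Matrix.mulVec_sum, Finset.sum_apply, Finset.sum_eq_single_of_mem P hP]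
  intro P' hP' hne
  by_contra h
  obtain ⟨j, hj, hsj⟩ := exists_of_syndrome_ne_zero h
  rw [vsupp_restr] at hj
  exact (h𝓟 P hP P' hP' hne.symm).2 i hi j (Finset.mem_inter.1 hj).1 ⟨s, hs, hsj⟩

theorem syndrome_restr_eq_zero {A : Matrix S Q (ZMod 2)} {𝓟 : Finset (Finset Q)}
    (h𝓟 : ∀ P ∈ 𝓟, ∀ P' ∈ 𝓟, P ≠ P' → Disjoint P P' ∧ ∀ a ∈ P, ∀ b ∈ P', ¬ sharesCheck A a b)
    {v : Q → ZMod 2} (hv : vsupp v ⊆ 𝓟.biUnion id) (h0 : A *ᵥ v = 0) {P : Finset Q}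
    (hP : P ∈ 𝓟) : A *ᵥ restr P v = 0 := by
  ext s
  by_contra h
  obtain ⟨i, hi, hs⟩ := exists_of_syndrome_ne_zero h
  rw [vsupp_restr] at hi
  apply h
  rw [syndrome_restr_of_meets h𝓟 hv hP (Finset.mem_inter.1 hi).1 hs, h0]

/-- A polymer: an error with connected support whose syndrome has at least half its weight. -/
def IsPolymer (A : Matrix S Q (ZMod 2)) (κ : Q → ZMod 2) : Prop :=
  IsLinked (sharesCheck A) (vsupp κ) ∧ hammingNorm κ ≤ 2 * hammingNorm (A *ᵥ κ)

theorem IsPolymer.exists_syndrome_ne_zero {A : Matrix S Q (ZMod 2)} {κ : Q → ZMod 2}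
    (h : IsPolymer A κ) : ∃ s, (A *ᵥ κ) s ≠ 0 := by
  have h1 := h.1.1.card_pos
  have h2 := h.2
  rw [hammingNorm_eq_card] at h2
  have h3 : (vsupp (A *ᵥ κ)).Nonempty := by
    rw [← Finset.card_pos, ← hammingNorm_eq_card]
    omega
  obtain ⟨s, hs⟩ := h3
  exact ⟨s, mem_vsupp.1 hs⟩

/-- A finite set of polymers with pairwise disjoint syndromes. The polymers themselves may overlap
or touch: only disjointness of the syndromes is needed for the energy to be additive. -/
structure IsPolymerFamily (A : Matrix S Q (ZMod 2)) (𝓕 : Finset (Q → ZMod 2)) : Prop where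
  polymer : ∀ κ ∈ 𝓕, IsPolymer A κ
  disjoint : ∀ κ ∈ 𝓕, ∀ κ' ∈ 𝓕, κ ≠ κ' → ∀ s, (A *ᵥ κ) s = 0 ∨ (A *ᵥ κ') s = 0

namespace IsPolymerFamily

variable {A : Matrix S Q (ZMod 2)} {𝓕 𝓖 : Finset (Q → ZMod 2)}

theorem mono (h : IsPolymerFamily A 𝓕) (h𝓖 : 𝓖 ⊆ 𝓕) : IsPolymerFamily A 𝓖 :=
  ⟨fun κ hκ => h.polymer κ (h𝓖 hκ), fun κ hκ κ' hκ' => h.disjoint κ (h𝓖 hκ) κ' (h𝓖 hκ')⟩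

theorem union (h𝓕 : IsPolymerFamily A 𝓕) (h𝓖 : IsPolymerFamily A 𝓖)
    (h : ∀ κ ∈ 𝓕, ∀ κ' ∈ 𝓖, ∀ s, (A *ᵥ κ) s = 0 ∨ (A *ᵥ κ') s = 0) :
    IsPolymerFamily A (𝓕 ∪ 𝓖) := by
  refine ⟨fun κ hκ => ?_, fun κ hκ κ' hκ' hne s => ?_⟩
  · rcases Finset.mem_union.1 hκ with hκ | hκ
    exacts [h𝓕.polymer κ hκ, h𝓖.polymer κ hκ]
  · rcases Finset.mem_union.1 hκ with hκ | hκ <;> rcases Finset.mem_union.1 hκ' with hκ' | hκ'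
    exacts [h𝓕.disjoint κ hκ κ' hκ' hne s, h κ hκ κ' hκ' s, (h κ' hκ' κ hκ s).symm,
      h𝓖.disjoint κ hκ κ' hκ' hne s]

theorem disjoint_of_syndromes (h𝓕 : IsPolymerFamily A 𝓕)
    (h : ∀ κ ∈ 𝓕, ∀ κ' ∈ 𝓖, ∀ s, (A *ᵥ κ) s = 0 ∨ (A *ᵥ κ') s = 0) : Disjoint 𝓕 𝓖 := by
  rw [Finset.disjoint_left]
  intro κ hκ hκ'
  obtain ⟨s, hs⟩ := (h𝓕.polymer κ hκ).exists_syndrome_ne_zero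
  rcases h κ hκ κ hκ' s with h | h <;> exact hs h

theorem hammingNorm_syndrome (h : IsPolymerFamily A 𝓕) :
    hammingNorm (A *ᵥ ∑ κ ∈ 𝓕, κ) = ∑ κ ∈ 𝓕, hammingNorm (A *ᵥ κ) := by
  induction 𝓕 using Finset.induction_on with
  | empty => simp
  | insert κ 𝓕 hκ ih =>
    rw [Finset.sum_insert hκ, Finset.sum_insert hκ, Matrix.mulVec_add,
      hammingNorm_add_of_disjoint, ih (h.mono (Finset.subset_insert _ _))]
    intro s
    by_cases h0 : (A *ᵥ κ) s = 0
    · exact Or.inl h0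
    right
    rw [Matrix.mulVec_sum, Finset.sum_apply]
    refine Finset.sum_eq_zero fun κ' hκ' => ?_
    refine (h.disjoint κ (Finset.mem_insert_self _ _) κ' (Finset.mem_insert_of_mem hκ') ?_
      s).resolve_left h0
    rintro rfl
    exact hκ hκ'

end IsPolymerFamily

/-- The checks `A` together with a group `G` of undetected errors (the stabilizers) confine errors:
at most `z` neighbours per site, at most `D` checks per site, errors of weight at most `M` are
equivalent modulo `G` to errors of weight at most twice the weight of their syndrome, and there is
an undetected error outside `G`. -/
structure Confined (A : Matrix S Q (ZMod 2)) (G : AddSubgroup (Q → ZMod 2)) (z D M : ℕ) : Prop where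
  ker : ∀ g ∈ G, A *ᵥ g = 0
  neighbours : ∀ a, ∀ U : Finset Q, (∀ b ∈ U, b ≠ a ∧ sharesCheck A a b) → U.card ≤ z
  column : ∀ i, hammingNorm (Aᵀ i) ≤ D
  confinement : ∀ E, hammingNorm E ≤ M → ∃ g ∈ G, hammingNorm (E + g) ≤ 2 * hammingNorm (A *ᵥ E)
  logical : ∃ L, A *ᵥ L = 0 ∧ L ∉ G

/-- The errors that are equivalent modulo `G` to a superposition of polymers of weight at most `r`
with disjoint syndromes. -/
def region (A : Matrix S Q (ZMod 2)) (G : AddSubgroup (Q → ZMod 2)) (r : ℕ) :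
    Set (Q → ZMod 2) :=
  {x | ∃ 𝓕, IsPolymerFamily A 𝓕 ∧ (∀ κ ∈ 𝓕, hammingNorm κ ≤ r) ∧ x + ∑ κ ∈ 𝓕, κ ∈ G}

variable {A : Matrix S Q (ZMod 2)} {G : AddSubgroup (Q → ZMod 2)} {z D M r : ℕ}

theorem zero_mem_region : (0 : Q → ZMod 2) ∈ region A G r :=
  ⟨∅, ⟨by simp, by simp⟩, by simp, by simp [G.zero_mem]⟩

theorem add_mem_region {x g : Q → ZMod 2} (hx : x ∈ region A G r) (hg : g ∈ G) :
    x + g ∈ region A G r := by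
  obtain ⟨𝓕, h1, h2, h3⟩ := hx
  refine ⟨𝓕, h1, h2, ?_⟩
  rw [add_right_comm]
  exact G.add_mem h3 hg

/-- Erasing some polymers lowers the syndrome weight by the sum of their syndrome weights. -/
theorem hammingNorm_syndrome_erase (hker : ∀ g ∈ G, A *ᵥ g = 0) {x : Q → ZMod 2}
    {𝓕 T : Finset (Q → ZMod 2)} (h : IsPolymerFamily A 𝓕) (hx : x + ∑ κ ∈ 𝓕, κ ∈ G) (hT : T ⊆ 𝓕) :
    hammingNorm (A *ᵥ x) = hammingNorm (A *ᵥ (x + ∑ κ ∈ T, κ)) +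
      ∑ κ ∈ T, hammingNorm (A *ᵥ κ) := by
  have h1 : A *ᵥ x = A *ᵥ ∑ κ ∈ 𝓕, κ := by
    have := hker _ hx
    rw [Matrix.mulVec_add] at this
    exact eq_of_add_eq_zero_zmod_two this
  have h2 : A *ᵥ (x + ∑ κ ∈ T, κ) = A *ᵥ ∑ κ ∈ 𝓕 \ T, κ := by
    rw [Matrix.mulVec_add, h1, ← Finset.sum_sdiff hT, Matrix.mulVec_add, add_assoc,
      add_self_zmod_two, add_zero]
  rw [h2, h1, h.hammingNorm_syndrome, (h.mono Finset.sdiff_subset).hammingNorm_syndrome,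
    Finset.sum_sdiff hT]

theorem add_sum_sdiff_mem {x : Q → ZMod 2} {𝓕 T : Finset (Q → ZMod 2)}
    (hx : x + ∑ κ ∈ 𝓕, κ ∈ G) (hT : T ⊆ 𝓕) : (x + ∑ κ ∈ T, κ) + ∑ κ ∈ 𝓕 \ T, κ ∈ G := by
  rwa [add_assoc, add_comm (∑ κ ∈ T, κ), Finset.sum_sdiff hT]

/-- An error of least weight in its class modulo `G`. -/
theorem exists_minimal_representative (G : AddSubgroup (Q → ZMod 2)) (v : Q → ZMod 2) :
    ∃ g ∈ G, ∀ g' ∈ G, hammingNorm (v + g) ≤ hammingNorm (v + g + g') := by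
  classical
  obtain ⟨g, hg, hmin⟩ := Finset.exists_min_image (Finset.univ.filter (· ∈ G))
    (fun g => hammingNorm (v + g)) ⟨0, by simp [G.zero_mem]⟩
  simp only [Finset.mem_filter, Finset.mem_univ, true_and] at hg hmin
  refine ⟨g, hg, fun g' hg' => ?_⟩
  rw [add_assoc]
  exact hmin _ (G.add_mem hg hg')

/-- An error of small weight is a superposition of polymers, modulo `G`: take the connected
components of a representative of least weight. -/
theorem Confined.exists_family (hC : Confined A G z D M) {v : Q → ZMod 2} (hv : hammingNorm v ≤ M) :
    ∃ 𝓚, IsPolymerFamily A 𝓚 ∧ v + ∑ κ ∈ 𝓚, κ ∈ G ∧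
      ∀ κ ∈ 𝓚, ∀ s, (A *ᵥ κ) s ≠ 0 → (A *ᵥ v) s ≠ 0 := by
  obtain ⟨g, hg, hmin⟩ := exists_minimal_representative G v
  set w := v + g with hw
  obtain ⟨𝓟, hP1, hP2, hP3⟩ := exists_linked_pieces (sharesCheck_symm A) (vsupp w)
  have hsub : ∀ P ∈ 𝓟, P ⊆ vsupp w := fun P hP => by
    rw [← hP3]; exact Finset.subset_biUnion_of_mem id hP
  have hsupp : ∀ P ∈ 𝓟, vsupp (restr P w) = P := fun P hP => vsupp_restr_of_subset (hsub P hP)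
  have hwv : A *ᵥ w = A *ᵥ v := by rw [hw, Matrix.mulVec_add, hC.ker g hg, add_zero]
  have hmeet : ∀ P ∈ 𝓟, ∀ s, (A *ᵥ restr P w) s ≠ 0 → ∃ i ∈ P, A s i ≠ 0 := by
    intro P hP s hs
    obtain ⟨i, hi, hsi⟩ := exists_of_syndrome_ne_zero hs
    rw [hsupp P hP] at hi
    exact ⟨i, hi, hsi⟩
  have hwM : hammingNorm w ≤ M := by
    have := hmin g hg
    rw [hw, add_assoc, add_self_zmod_two, add_zero] at this
    exact this.trans hv
  refine ⟨𝓟.image fun P => restr P w, ⟨?_, ?_⟩, ?_, ?_⟩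
  · intro κ hκ
    obtain ⟨P, hP, rfl⟩ := Finset.mem_image.1 hκ
    refine ⟨by rw [hsupp P hP]; exact hP1 P hP, ?_⟩
    have hle : hammingNorm (restr P w) ≤ hammingNorm w := by
      rw [hammingNorm_eq_card, hammingNorm_eq_card, hsupp P hP]
      exact Finset.card_le_card (hsub P hP)
    obtain ⟨g', hg', hg'w⟩ := hC.confinement (restr P w) (hle.trans hwM)
    -- A restriction of an error of least weight has least weight in its own class.
    have hsplit : w = restr P w + restr (vsupp w \ P) w := by
      ext i
      by_cases hi : w i = 0 <;> by_cases hiP : i ∈ P <;>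
        simp [restr, hi, hiP, mem_vsupp]
    have hnorm : hammingNorm w = hammingNorm (restr P w) + hammingNorm (restr (vsupp w \ P) w) := by
      conv_lhs => rw [hsplit]
      refine hammingNorm_add_of_disjoint fun i => ?_
      by_cases hiP : i ∈ P <;> simp [restr, hiP]
    have h1 := hmin g' hg'
    have h2 : w + g' = (restr P w + g') + restr (vsupp w \ P) w := by
      conv_lhs => rw [hsplit]
      exact add_right_comm _ _ _
    have h3 := hammingNorm_add_le (restr P w + g') (restr (vsupp w \ P) w)
    rw [← h2] at h3
    omega
  · intro κ hκ κ' hκ' hne s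
    obtain ⟨P, hP, rfl⟩ := Finset.mem_image.1 hκ
    obtain ⟨P', hP', rfl⟩ := Finset.mem_image.1 hκ'
    by_contra! h
    obtain ⟨i, hi, hsi⟩ := hmeet P hP s h.1
    obtain ⟨j, hj, hsj⟩ := hmeet P' hP' s h.2
    exact (hP2 P hP P' hP' (fun h => hne (by rw [h]))).2 i hi j hj ⟨s, hsi, hsj⟩
  · rw [Finset.sum_image, sum_restr_of_pieces (fun P hP P' hP' hne => (hP2 P hP P' hP' hne).1)
      hP3.ge, hw, ← add_assoc, add_self_zmod_two, zero_add]
    · exact hg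
    · intro P hP P' hP' h
      rw [← hsupp P hP, ← hsupp P' hP']
      exact congrArg vsupp h
  · intro κ hκ s hs
    obtain ⟨P, hP, rfl⟩ := Finset.mem_image.1 hκ
    obtain ⟨i, hi, hsi⟩ := hmeet P hP s hs
    rwa [syndrome_restr_of_meets hP2 hP3.ge hP hi hsi, hwv] at hs

/-- A single flip leads from `region A G r` to an error that is still a superposition of polymers:
the flipped site merges with the at most `D` polymers whose syndromes it touches, and the result has
weight at most `M`. -/
theorem Confined.exists_family_flip (hC : Confined A G z D M) (hr : D * r + 1 ≤ M)
    {x : Q → ZMod 2} (hx : x ∈ region A G r) (i : Q) :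
    ∃ 𝓕, IsPolymerFamily A 𝓕 ∧ flip x i + ∑ κ ∈ 𝓕, κ ∈ G := by
  classical
  obtain ⟨𝓕, h𝓕, h𝓕r, hxG⟩ := hx
  set 𝓕₀ := 𝓕.filter fun κ => ∃ s, (A *ᵥ κ) s ≠ 0 ∧ A s i ≠ 0 with h𝓕₀
  have hsub : 𝓕₀ ⊆ 𝓕 := Finset.filter_subset _ _
  have hcard : 𝓕₀.card ≤ D := by
    have hex : ∀ κ ∈ 𝓕₀, ∃ s, (A *ᵥ κ) s ≠ 0 ∧ A s i ≠ 0 := fun κ hκ => (Finset.mem_filter.1 hκ).2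
    rcases 𝓕₀.eq_empty_or_nonempty with h0 | ⟨κ₀, hκ₀⟩
    · simp [h0]
    have : Nonempty S := ⟨(hex κ₀ hκ₀).choose⟩
    choose! f hf using hex
    refine (Finset.card_le_card_of_injOn f (t := vsupp (Aᵀ i)) ?_ ?_).trans (hC.column i)
    · intro κ hκ
      exact mem_vsupp.2 (hf κ hκ).2
    · intro κ hκ κ' hκ' h
      by_contra hne
      rcases h𝓕.disjoint κ (hsub hκ) κ' (hsub hκ') hne (f κ) with h0 | h0
      · exact (hf κ hκ).1 h0
      · rw [h] at h0
        exact (hf κ' hκ').1 h0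
  set v := Pi.single i 1 + ∑ κ ∈ 𝓕₀, κ with hv
  have hsingle : hammingNorm (Pi.single i 1 : Q → ZMod 2) ≤ 1 := by
    rw [hammingNorm_eq_card]
    refine (Finset.card_le_card (t := {i}) fun j hj => ?_).trans (by simp)
    rw [mem_vsupp] at hj
    by_contra hji
    exact hj (Pi.single_eq_of_ne (by simpa using hji) _)
  have hvM : hammingNorm v ≤ M := by
    have h1 : ∑ κ ∈ 𝓕₀, hammingNorm κ ≤ D * r :=
      (Finset.sum_le_card_nsmul _ _ r fun κ hκ => h𝓕r κ (hsub hκ)).trans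
        (Nat.mul_le_mul_right r hcard)
    have h2 := hammingNorm_add_le (Pi.single i 1) (∑ κ ∈ 𝓕₀, κ)
    have h3 := hammingNorm_sum_le 𝓕₀ fun κ => κ
    rw [← hv] at h2
    omega
  obtain ⟨𝓚, h𝓚, hvK, hsyn⟩ := hC.exists_family hvM
  have hcross : ∀ κ ∈ 𝓕 \ 𝓕₀, ∀ κ' ∈ 𝓚, ∀ s, (A *ᵥ κ) s = 0 ∨ (A *ᵥ κ') s = 0 := by
    intro κ hκ κ' hκ' s
    obtain ⟨hκF, hκ0⟩ := Finset.mem_sdiff.1 hκ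
    by_contra! h
    have hvs := hsyn κ' hκ' s h.2
    rw [hv, Matrix.mulVec_add, Pi.add_apply, Matrix.mulVec_single_one] at hvs
    by_cases hsi : A s i = 0
    · have h1 : (A *ᵥ ∑ κ ∈ 𝓕₀, κ) s ≠ 0 := by
        intro h1
        exact hvs (by rw [h1]; simpa using hsi)
      rw [Matrix.mulVec_sum, Finset.sum_apply] at h1
      obtain ⟨κ₁, hκ₁, hne⟩ := Finset.exists_ne_zero_of_sum_ne_zero h1
      have hκκ₁ : κ ≠ κ₁ := fun h => hκ0 (h ▸ hκ₁)
      rcases h𝓕.disjoint κ hκF κ₁ (hsub hκ₁) hκκ₁ s with h0 | h0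
      exacts [h.1 h0, hne h0]
    · exact hκ0 (Finset.mem_filter.2 ⟨hκF, s, h.1, hsi⟩)
  have hfam := h𝓕.mono (Finset.sdiff_subset (s := 𝓕) (t := 𝓕₀))
  refine ⟨𝓕 \ 𝓕₀ ∪ 𝓚, hfam.union h𝓚 hcross, ?_⟩
  rw [Finset.sum_union (hfam.disjoint_of_syndromes hcross)]
  have h1 := G.add_mem hxG hvK
  rw [← Finset.sum_sdiff hsub] at h1
  have h2 : x + (∑ κ ∈ 𝓕 \ 𝓕₀, κ + ∑ κ ∈ 𝓕₀, κ) + (v + ∑ κ ∈ 𝓚, κ) =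
      flip x i + (∑ κ ∈ 𝓕 \ 𝓕₀, κ + ∑ κ ∈ 𝓚, κ) := by
    rw [hv, flip]
    calc _ = x + Pi.single i 1 + (∑ κ ∈ 𝓕 \ 𝓕₀, κ + ∑ κ ∈ 𝓚, κ) +
          (∑ κ ∈ 𝓕₀, κ + ∑ κ ∈ 𝓕₀, κ) := by abel
      _ = _ := by rw [add_self_zmod_two, add_zero]
  rwa [h2] at h1

/-- Outside `region A G r`, but one flip away from it: some polymers of weight larger than `r` can
be erased, which leads back to the region. -/
theorem Confined.exists_erase_of_flip (hC : Confined A G z D M) (hr : D * r + 1 ≤ M)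
    {x : Q → ZMod 2} (hx : x ∈ region A G r) {i : Q} (hflip : flip x i ∉ region A G r) :
    ∃ T : Finset (Q → ZMod 2), T.Nonempty ∧
      (∀ κ ∈ T, IsLinked (sharesCheck A) (vsupp κ) ∧ r + 1 ≤ (vsupp κ).card) ∧
      flip x i + ∑ κ ∈ T, κ ∈ region A G r ∧
      hammingNorm (A *ᵥ (flip x i + ∑ κ ∈ T, κ)) * 2 + ∑ κ ∈ T, (vsupp κ).card ≤
        hammingNorm (A *ᵥ flip x i) * 2 := by
  classical
  obtain ⟨𝓕, h𝓕, hG⟩ := hC.exists_family_flip hr hx i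
  set T := 𝓕.filter fun κ => r + 1 ≤ (vsupp κ).card with hT
  have hsub : T ⊆ 𝓕 := Finset.filter_subset _ _
  have hsmall : ∀ κ ∈ 𝓕 \ T, hammingNorm κ ≤ r := by
    intro κ hκ
    obtain ⟨h1, h2⟩ := Finset.mem_sdiff.1 hκ
    by_contra h3
    exact h2 (Finset.mem_filter.2 ⟨h1, by rw [← hammingNorm_eq_card]; omega⟩)
  refine ⟨T, ?_, ?_, ?_, ?_⟩
  · by_contra hne
    rw [Finset.not_nonempty_iff_eq_empty] at hne
    rw [hne, Finset.sdiff_empty] at hsmall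
    exact hflip ⟨𝓕, h𝓕, hsmall, hG⟩
  · exact fun κ hκ => ⟨(h𝓕.polymer κ (hsub hκ)).1, (Finset.mem_filter.1 hκ).2⟩
  · exact ⟨𝓕 \ T, h𝓕.mono Finset.sdiff_subset, hsmall, add_sum_sdiff_mem hG hsub⟩
  · rw [hammingNorm_syndrome_erase hC.ker h𝓕 hG hsub, add_mul, Finset.sum_mul]
    gcongr with κ hκ
    rw [mul_comm]
    exact (h𝓕.polymer κ (hsub hκ)).2

/-- If both `x` and its translate by an undetected error `L ∉ G` lie in the region, then `x`
contains a large connected excitation: the two superpositions of polymers have the same syndrome,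
but differ by an undetected error outside `G`. The connected component `P` of their union that
carries this difference has more than `M` sites. Its size is bounded by the total weight of the
polymers of both superpositions in `P`, whose syndromes in `P` agree; so erasing those of the first
superposition lowers the syndrome weight by at least `|P| / 4`. -/
theorem Confined.exists_erase_of_ambiguous (hC : Confined A G z D M) {L : Q → ZMod 2}
    (hL : A *ᵥ L = 0) (hLG : L ∉ G) {x : Q → ZMod 2} (hx : x ∈ region A G r)
    (hxL : x + L ∈ region A G r) :
    ∃ (P : Finset Q) (v : Q → ZMod 2), IsLinked (sharesCheck A) P ∧ M + 1 ≤ P.card ∧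
      vsupp v ⊆ P ∧ x + v ∈ region A G r ∧
      hammingNorm (A *ᵥ (x + v)) * 4 + P.card ≤ hammingNorm (A *ᵥ x) * 4 := by
  classical
  obtain ⟨𝓕, h𝓕, h𝓕r, hxG⟩ := hx
  obtain ⟨𝓖, h𝓖, h𝓖r, hxLG⟩ := hxL
  set U := (𝓕 ∪ 𝓖).biUnion vsupp with hU
  obtain ⟨𝓟, hP1, hP2, hP3⟩ := exists_linked_pieces (sharesCheck_symm A) U
  set y := ∑ κ ∈ 𝓕, κ with hy
  set y' := ∑ κ ∈ 𝓖, κ with hy'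
  have hsuppsum : ∀ 𝓗 ⊆ 𝓕 ∪ 𝓖, vsupp (∑ κ ∈ 𝓗, κ) ⊆ U := by
    intro 𝓗 h𝓗 i hi
    rw [mem_vsupp, Finset.sum_apply] at hi
    obtain ⟨κ, hκ, hne⟩ := Finset.exists_ne_zero_of_sum_ne_zero hi
    exact Finset.mem_biUnion.2 ⟨κ, h𝓗 hκ, mem_vsupp.2 hne⟩
  have hyU : vsupp y ⊆ U := hsuppsum 𝓕 Finset.subset_union_left
  have hyU' : vsupp y' ⊆ U := hsuppsum 𝓖 Finset.subset_union_right
  have hyyU : vsupp (y + y') ⊆ 𝓟.biUnion id := by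
    rw [hP3]
    intro i hi
    rw [mem_vsupp, Pi.add_apply] at hi
    by_cases h : y i = 0
    · exact hyU' (mem_vsupp.2 fun h' => hi (by rw [h, h', add_zero]))
    · exact hyU (mem_vsupp.2 h)
  have hsumG : y + y' + L ∈ G := by
    have h1 := G.add_mem hxG hxLG
    have h2 : x + y + (x + L + y') = (x + x) + (y + y' + L) := by abel
    rwa [h2, add_self_zmod_two, zero_add] at h1
  have hker : A *ᵥ (y + y') = 0 := by
    have := hC.ker _ hsumG
    rwa [Matrix.mulVec_add, hL, add_zero] at this
  have hnot : y + y' ∉ G := by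
    intro h
    have h1 := G.add_mem h hsumG
    rw [← add_assoc, add_self_zmod_two, zero_add] at h1
    exact hLG h1
  obtain ⟨P, hP, hPG⟩ : ∃ P ∈ 𝓟, restr P (y + y') ∉ G := by
    by_contra! h
    apply hnot
    rw [← sum_restr_of_pieces (fun P hP P' hP' hne => (hP2 P hP P' hP' hne).1) hyyU]
    exact G.sum_mem h
  have hPker : A *ᵥ restr P (y + y') = 0 := syndrome_restr_eq_zero hP2 hyyU hker hP
  have hPM : M + 1 ≤ P.card := by
    by_contra hlt
    have hle : hammingNorm (restr P (y + y')) ≤ M := by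
      rw [hammingNorm_eq_card, vsupp_restr]
      exact (Finset.card_le_card Finset.inter_subset_left).trans (by omega)
    obtain ⟨g, hg, hgle⟩ := hC.confinement _ hle
    rw [hPker, hammingNorm_zero, mul_zero, Nat.le_zero, hammingNorm_eq_zero] at hgle
    apply hPG
    rw [eq_neg_of_add_eq_zero_left hgle]
    exact G.neg_mem hg
  have hpiece : ∀ κ ∈ 𝓕 ∪ 𝓖, IsLinked (sharesCheck A) (vsupp κ) := by
    intro κ hκ
    rcases Finset.mem_union.1 hκ with hκ | hκ
    exacts [(h𝓕.polymer κ hκ).1, (h𝓖.polymer κ hκ).1]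
  have hin : ∀ κ ∈ 𝓕 ∪ 𝓖, (vsupp κ ∩ P).Nonempty → vsupp κ ⊆ P := by
    intro κ hκ hne
    refine (hpiece κ hκ).subset_piece hP2 ?_ hP hne
    rw [hP3]
    exact Finset.subset_biUnion_of_mem vsupp hκ
  -- The polymers inside `P` sum up to the restriction to `P`.
  have hrestr : ∀ 𝓗 ⊆ 𝓕 ∪ 𝓖,
      restr P (∑ κ ∈ 𝓗, κ) = ∑ κ ∈ 𝓗.filter (fun κ => vsupp κ ⊆ P), κ := by
    intro 𝓗 h𝓗
    rw [restr_sum, Finset.sum_filter]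
    refine Finset.sum_congr rfl fun κ hκ => ?_
    split_ifs with h
    · exact restr_eq_self h
    · rw [← vsupp_eq_empty, vsupp_restr, Finset.inter_comm]
      by_contra hne
      exact h (hin κ (h𝓗 hκ) (Finset.nonempty_iff_ne_empty.2 hne))
  set 𝓕P := 𝓕.filter fun κ => vsupp κ ⊆ P with h𝓕P
  set 𝓖P := 𝓖.filter fun κ => vsupp κ ⊆ P with h𝓖P
  have hsubF : 𝓕P ⊆ 𝓕 := Finset.filter_subset _ _
  have hsubG : 𝓖P ⊆ 𝓖 := Finset.filter_subset _ _
  have hFsum := hrestr 𝓕 Finset.subset_union_left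
  have hGsum := hrestr 𝓖 Finset.subset_union_right
  have hsyn : A *ᵥ ∑ κ ∈ 𝓕P, κ = A *ᵥ ∑ κ ∈ 𝓖P, κ := by
    rw [restr_add, hFsum, hGsum, Matrix.mulVec_add] at hPker
    exact eq_of_add_eq_zero_zmod_two hPker
  have hE : ∑ κ ∈ 𝓕P, hammingNorm (A *ᵥ κ) = ∑ κ ∈ 𝓖P, hammingNorm (A *ᵥ κ) := by
    rw [← (h𝓕.mono hsubF).hammingNorm_syndrome, hsyn, (h𝓖.mono hsubG).hammingNorm_syndrome]
  have hPle : P.card ≤ ∑ κ ∈ 𝓕P, hammingNorm κ + ∑ κ ∈ 𝓖P, hammingNorm κ := by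
    have hcov : P ⊆ 𝓕P.biUnion vsupp ∪ 𝓖P.biUnion vsupp := by
      intro i hi
      have hiU : i ∈ U := hP3 ▸ Finset.mem_biUnion.2 ⟨P, hP, hi⟩
      obtain ⟨κ, hκ, hiκ⟩ := Finset.mem_biUnion.1 hiU
      have hκP := hin κ hκ ⟨i, Finset.mem_inter.2 ⟨hiκ, hi⟩⟩
      rcases Finset.mem_union.1 hκ with h | h
      · exact Finset.mem_union_left _
          (Finset.mem_biUnion.2 ⟨κ, Finset.mem_filter.2 ⟨h, hκP⟩, hiκ⟩)
      · exact Finset.mem_union_right _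
          (Finset.mem_biUnion.2 ⟨κ, Finset.mem_filter.2 ⟨h, hκP⟩, hiκ⟩)
    exact (Finset.card_le_card hcov).trans ((Finset.card_union_le _ _).trans
      (Nat.add_le_add Finset.card_biUnion_le Finset.card_biUnion_le))
  have hF2 : ∑ κ ∈ 𝓕P, hammingNorm κ ≤ 2 * ∑ κ ∈ 𝓕P, hammingNorm (A *ᵥ κ) := by
    rw [Finset.mul_sum]
    exact Finset.sum_le_sum fun κ hκ => (h𝓕.polymer κ (hsubF hκ)).2
  have hG2 : ∑ κ ∈ 𝓖P, hammingNorm κ ≤ 2 * ∑ κ ∈ 𝓖P, hammingNorm (A *ᵥ κ) := by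
    rw [Finset.mul_sum]
    exact Finset.sum_le_sum fun κ hκ => (h𝓖.polymer κ (hsubG hκ)).2
  refine ⟨P, ∑ κ ∈ 𝓕P, κ, hP1 P hP, hPM, ?_, ?_, ?_⟩
  · rw [← hFsum, vsupp_restr]
    exact Finset.inter_subset_left
  · exact ⟨𝓕 \ 𝓕P, h𝓕.mono Finset.sdiff_subset,
      fun κ hκ => h𝓕r κ (Finset.mem_sdiff.1 hκ).1, add_sum_sdiff_mem hxG hsubF⟩
  · rw [hammingNorm_syndrome_erase hC.ker h𝓕 hxG hsubF]
    omega

end Polymers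

/-! ### Peierls estimates -/

section Peierls

variable {Q S : Type*} [Fintype Q] [Fintype S] [DecidableEq Q] [DecidableEq S]

/-- The basic Peierls estimate: if every `x ∈ Bad` can be shifted by one of the vectors `sh j` into
`R` with a gain `c j` in weight, then `Bad` has at most `∑ c j` times the weight of `R`. -/
theorem sum_le_of_shift {ι : Type*} (J : Finset ι) (c : ι → ℝ) (hc : ∀ j ∈ J, 0 ≤ c j)
    (sh : ι → Q → ZMod 2) (W : (Q → ZMod 2) → ℝ) (hW : ∀ x, 0 ≤ W x)
    (Bad R : Finset (Q → ZMod 2))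
    (h : ∀ x ∈ Bad, ∃ j ∈ J, x + sh j ∈ R ∧ W x ≤ c j * W (x + sh j)) :
    ∑ x ∈ Bad, W x ≤ (∑ j ∈ J, c j) * ∑ x ∈ R, W x := by
  have h1 : ∀ x ∈ Bad, W x ≤ ∑ j ∈ J, if x + sh j ∈ R then c j * W (x + sh j) else 0 := by
    intro x hx
    obtain ⟨j, hj, hR, hle⟩ := h x hx
    refine hle.trans ?_
    refine le_trans (le_of_eq ?_) (Finset.single_le_sum (f := fun j =>
      if x + sh j ∈ R then c j * W (x + sh j) else 0) (fun j hj => ?_) hj)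
    · rw [if_pos hR]
    · split_ifs
      · exact mul_nonneg (hc j hj) (hW _)
      · exact le_rfl
  refine (Finset.sum_le_sum h1).trans ?_
  rw [Finset.sum_comm, Finset.sum_mul]
  refine Finset.sum_le_sum fun j hj => ?_
  rw [Finset.mul_sum]
  calc ∑ x ∈ Bad, (if x + sh j ∈ R then c j * W (x + sh j) else 0)
      ≤ ∑ x : Q → ZMod 2, if x + sh j ∈ R then c j * W (x + sh j) else 0 := by
        refine Finset.sum_le_sum_of_subset_of_nonneg (Finset.subset_univ _) fun x _ _ => ?_
        split_ifs
        · exact mul_nonneg (hc j hj) (hW _)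
        · exact le_rfl
    _ = ∑ x : Q → ZMod 2, if x ∈ R then c j * W x else 0 :=
        Fintype.sum_equiv (Equiv.addRight (sh j)) _ _ fun x => rfl
    _ = ∑ x ∈ R, c j * W x := by
        rw [Finset.sum_ite_mem, Finset.univ_inter]

/-- The unnormalized Gibbs weight. -/
def boltzmann (β : ℝ) (A : Matrix S Q (ZMod 2)) (x : Q → ZMod 2) : ℝ :=
  Real.exp (-β * energy A x)

theorem boltzmann_pos (β : ℝ) (A : Matrix S Q (ZMod 2)) (x : Q → ZMod 2) : 0 < boltzmann β A x :=
  Real.exp_pos _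

theorem boltzmann_add_of_ker (β : ℝ) {A : Matrix S Q (ZMod 2)} {g : Q → ZMod 2}
    (hg : A *ᵥ g = 0) (x : Q → ZMod 2) : boltzmann β A (x + g) = boltzmann β A x := by
  simp only [boltzmann, energy, Matrix.mulVec_add, hg, add_zero]

theorem boltzmann_le_of_syndrome {β : ℝ} (hβ : 0 ≤ β) {A : Matrix S Q (ZMod 2)}
    {x y : Q → ZMod 2} {k : ℝ}
    (h : 2 * (hammingNorm (A *ᵥ y) : ℝ) + k ≤ 2 * (hammingNorm (A *ᵥ x) : ℝ)) :
    boltzmann β A x ≤ Real.exp (-β * k) * boltzmann β A y := by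
  rw [boltzmann, boltzmann, ← Real.exp_add]
  apply Real.exp_le_exp.2
  unfold energy
  nlinarith

variable {A : Matrix S Q (ZMod 2)} {G : AddSubgroup (Q → ZMod 2)} {z D M r : ℕ} {β : ℝ}

open Classical in
/-- The region as a finite set. -/
def regionFinset (A : Matrix S Q (ZMod 2)) (G : AddSubgroup (Q → ZMod 2)) (r : ℕ) :
    Finset (Q → ZMod 2) :=
  Finset.univ.filter (· ∈ region A G r)

theorem mem_regionFinset {x : Q → ZMod 2} : x ∈ regionFinset A G r ↔ x ∈ region A G r := by
  simp [regionFinset]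

open Classical in
/-- The outer boundary of the region under single flips. -/
def outerBoundary (A : Matrix S Q (ZMod 2)) (G : AddSubgroup (Q → ZMod 2)) (r : ℕ) :
    Finset (Q → ZMod 2) :=
  Finset.univ.filter fun x => x ∉ region A G r ∧ ∃ y ∈ region A G r, ∃ i, x = flip y i

open Classical in
theorem Confined.neighbours_filter (hC : Confined A G z D M) (v : Q) :
    (Finset.univ.filter fun u => u ≠ v ∧ sharesCheck A v u).card ≤ z :=
  hC.neighbours v _ (by simp)

theorem exp_neg_le_of_half {β : ℝ} (hz : 1 ≤ z) (hβ : Real.exp (-β / 2) ≤ 1 / (9 * z)) :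
    Real.exp (-β) ≤ 2 / 3 * (1 / (3 * (z : ℝ))) := by
  have hz' : (1 : ℝ) ≤ z := by exact_mod_cast hz
  have h1 : Real.exp (-β) = Real.exp (-β / 2) * Real.exp (-β / 2) := by
    rw [← Real.exp_add]; ring_nf
  have h2 : 1 / (9 * (z : ℝ)) ≤ 1 := by
    rw [div_le_one (by positivity)]; linarith
  calc Real.exp (-β) ≤ 1 / (9 * (z : ℝ)) * 1 := by
        rw [h1]
        exact mul_le_mul hβ (hβ.trans h2) (Real.exp_pos _).le (by positivity)
    _ ≤ 2 / 3 * (1 / (3 * (z : ℝ))) := by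
        have : 0 < (z : ℝ)⁻¹ := by positivity
        simp only [one_div, mul_inv, mul_one]
        nlinarith

/-- The outer boundary has exponentially small weight relative to the region. -/
theorem Confined.sum_outerBoundary_le (hC : Confined A G z D M) (hr : D * r + 1 ≤ M) (hz : 1 ≤ z)
    (hβ0 : 0 ≤ β) (hβ : Real.exp (-β / 2) ≤ 1 / (9 * z)) :
    ∑ x ∈ outerBoundary A G r, boltzmann β A x ≤
      (Real.exp (Fintype.card Q * (2 / 3 : ℝ) ^ (r + 1)) - 1) *
        ∑ x ∈ regionFinset A G r, boltzmann β A x := by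
  classical
  set Big : Finset (Q → ZMod 2) := Finset.univ.filter fun κ =>
    IsLinked (sharesCheck A) (vsupp κ) ∧ r + 1 ≤ (vsupp κ).card with hBig
  set w : (Q → ZMod 2) → ℝ := fun κ => Real.exp (-β) ^ (vsupp κ).card with hw
  have hw0 : ∀ κ, 0 ≤ w κ := fun κ => by simp only [hw]; positivity
  have h1 := sum_le_of_shift (Big.powerset.erase ∅) (fun T => ∏ κ ∈ T, w κ)
    (fun T _ => Finset.prod_nonneg fun κ _ => hw0 κ) (fun T => ∑ κ ∈ T, κ) (boltzmann β A)
    (fun x => (boltzmann_pos β A x).le) (outerBoundary A G r) (regionFinset A G r) (by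
      intro x hx
      simp only [outerBoundary, Finset.mem_filter, Finset.mem_univ, true_and] at hx
      obtain ⟨hxR, y, hy, i, rfl⟩ := hx
      obtain ⟨T, hT, hTbig, hTR, hTle⟩ := hC.exists_erase_of_flip hr hy hxR
      refine ⟨T, ?_, mem_regionFinset.2 hTR, ?_⟩
      · refine Finset.mem_erase.2 ⟨hT.ne_empty, Finset.mem_powerset.2 fun κ hκ => ?_⟩
        simpa [hBig] using hTbig κ hκ
      · refine (boltzmann_le_of_syndrome hβ0 (k := ((∑ κ ∈ T, (vsupp κ).card : ℕ) : ℝ))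
          (y := flip y i + ∑ κ ∈ T, κ) ?_).trans (le_of_eq ?_)
        · have : ((hammingNorm (A *ᵥ (flip y i + ∑ κ ∈ T, κ)) * 2 +
              ∑ κ ∈ T, (vsupp κ).card : ℕ) : ℝ) ≤ ((hammingNorm (A *ᵥ flip y i) * 2 : ℕ) : ℝ) :=
            Nat.cast_le.2 hTle
          push_cast at this ⊢
          linarith
        · congr 1
          simp only [hw]
          rw [Finset.prod_pow_eq_pow_sum, ← Real.exp_nat_mul, mul_comm])
  refine h1.trans (mul_le_mul_of_nonneg_right ?_
    (Finset.sum_nonneg fun x _ => (boltzmann_pos β A x).le))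
  -- The sum over nonempty sets of large polymers is an expanded product without its first term.
  have h2 : ∑ T ∈ Big.powerset.erase ∅, ∏ κ ∈ T, w κ = ∏ κ ∈ Big, (1 + w κ) - 1 := by
    rw [Finset.prod_one_add, ← Finset.add_sum_erase _ _ (Finset.empty_mem_powerset Big)]
    simp
  have h3 : ∏ κ ∈ Big, (1 + w κ) ≤ Real.exp (∑ κ ∈ Big, w κ) := by
    rw [Real.exp_sum]
    refine Finset.prod_le_prod (fun κ _ => by linarith [hw0 κ]) fun κ _ => ?_
    rw [add_comm]
    exact Real.add_one_le_exp _
  have h4 : ∑ κ ∈ Big, w κ ≤ Fintype.card Q * (2 / 3 : ℝ) ^ (r + 1) := by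
    refine le_trans ?_ (sum_isLinked_tail_le (r := sharesCheck A) hz (Real.exp_pos (-β)).le
      (exp_neg_le_of_half hz hβ) hC.neighbours_filter (r + 1))
    have hinj : Set.InjOn (vsupp : (Q → ZMod 2) → Finset Q) (Big : Set (Q → ZMod 2)) := by
      intro u _ v _ huv
      ext i
      have : u i ≠ 0 ↔ v i ≠ 0 := by rw [← mem_vsupp, ← mem_vsupp, huv]
      have h2 : ∀ a b : ZMod 2, (a ≠ 0 ↔ b ≠ 0) → a = b := by decide
      exact h2 _ _ this
    rw [← Finset.sum_image (f := fun U : Finset Q => Real.exp (-β) ^ U.card) hinj]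
    refine Finset.sum_le_sum_of_subset_of_nonneg ?_ (fun _ _ _ => by positivity)
    intro U hU
    obtain ⟨κ, hκ, rfl⟩ := Finset.mem_image.1 hU
    simpa [hBig] using hκ
  rw [h2]
  linarith [h3.trans (Real.exp_le_exp.2 h4)]

/-- The overlap of the region with its translate by a logical operator has exponentially small
weight relative to the region. -/
theorem Confined.sum_ambiguous_le (hC : Confined A G z D M) (hz : 1 ≤ z)
    (hβ0 : 0 ≤ β) (hβ : Real.exp (-β / 2) ≤ 1 / (9 * z)) {L : Q → ZMod 2} (hL : A *ᵥ L = 0)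
    (hLG : L ∉ G) :
    ∑ x ∈ (regionFinset A G r).filter (fun x => x + L ∈ regionFinset A G r), boltzmann β A x ≤
      Fintype.card Q * (2 / 3 : ℝ) ^ (M + 1) * ∑ x ∈ regionFinset A G r, boltzmann β A x := by
  classical
  set 𝓤 : Finset (Finset Q) := Finset.univ.filter fun P =>
    IsLinked (sharesCheck A) P ∧ M + 1 ≤ P.card with h𝓤
  -- The shift is an error supported in a connected set `P`, encoded by `P` and its support.
  have h1 := sum_le_of_shift (𝓤.sigma fun P => P.powerset)
    (fun p => Real.exp (-β / 2) ^ p.1.card) (fun p _ => by positivity)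
    (fun p i => if i ∈ p.2 then 1 else 0) (boltzmann β A)
    (fun x => (boltzmann_pos β A x).le)
    ((regionFinset A G r).filter (fun x => x + L ∈ regionFinset A G r)) (regionFinset A G r) (by
      intro x hx
      rw [Finset.mem_filter, mem_regionFinset, mem_regionFinset] at hx
      obtain ⟨P, v, hP, hPM, hvP, hR, hle⟩ := hC.exists_erase_of_ambiguous hL hLG hx.1 hx.2
      have hv : (fun i => if i ∈ vsupp v then (1 : ZMod 2) else 0) = v := by
        ext i
        have : ∀ a : ZMod 2, (if a ≠ 0 then (1 : ZMod 2) else 0) = a := by decide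
        simp only [mem_vsupp]
        exact this (v i)
      refine ⟨⟨P, vsupp v⟩, ?_, ?_, ?_⟩
      · rw [Finset.mem_sigma]
        exact ⟨Finset.mem_filter.2 ⟨Finset.mem_univ _, hP, hPM⟩, Finset.mem_powerset.2 hvP⟩
      · simp only [hv]
        exact mem_regionFinset.2 hR
      · simp only [hv]
        refine (boltzmann_le_of_syndrome hβ0 (k := (P.card : ℝ) / 2) (y := x + v) ?_).trans
          (le_of_eq ?_)
        · have : ((hammingNorm (A *ᵥ (x + v)) * 4 + P.card : ℕ) : ℝ) ≤
              ((hammingNorm (A *ᵥ x) * 4 : ℕ) : ℝ) := Nat.cast_le.2 hle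
          push_cast at this
          linarith
        · congr 1
          rw [← Real.exp_nat_mul]
          congr 1
          ring)
  refine h1.trans (mul_le_mul_of_nonneg_right ?_
    (Finset.sum_nonneg fun x _ => (boltzmann_pos β A x).le))
  rw [Finset.sum_sigma]
  have h2 : ∀ P ∈ 𝓤, ∑ _T ∈ P.powerset, Real.exp (-β / 2) ^ P.card =
      (2 * Real.exp (-β / 2)) ^ P.card := by
    intro P _
    rw [Finset.sum_const, Finset.card_powerset, nsmul_eq_mul, mul_pow]
    push_cast
    rfl
  rw [Finset.sum_congr rfl h2]
  refine sum_isLinked_tail_le (r := sharesCheck A) hz (by positivity) ?_ hC.neighbours_filter _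
  have hz' : (1 : ℝ) ≤ z := by exact_mod_cast hz
  calc 2 * Real.exp (-β / 2) ≤ 2 * (1 / (9 * (z : ℝ))) := by linarith
    _ = 2 / 3 * (1 / (3 * (z : ℝ))) := by field_simp; norm_num

/-- The region carries at most two thirds of the Gibbs measure: its translate by a logical operator
has the same weight and overlaps it only little. -/
theorem Confined.sum_region_le (hC : Confined A G z D M) (hz : 1 ≤ z)
    (hβ0 : 0 ≤ β) (hβ : Real.exp (-β / 2) ≤ 1 / (9 * z))
    (hM : Fintype.card Q * (2 / 3 : ℝ) ^ (M + 1) ≤ 1 / 2) :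
    ∑ x ∈ regionFinset A G r, boltzmann β A x ≤ 2 / 3 * ∑ x, boltzmann β A x := by
  classical
  obtain ⟨L, hL, hLG⟩ := hC.logical
  have h1 := hC.sum_ambiguous_le (r := r) hz hβ0 hβ hL hLG
  set R := regionFinset A G r with hR
  set w := ∑ x ∈ R, boltzmann β A x with hw
  have hw0 : 0 ≤ w := Finset.sum_nonneg fun x _ => (boltzmann_pos β A x).le
  have h2 : ∑ x ∈ R.filter (fun x => x + L ∈ R), boltzmann β A x ≤ 1 / 2 * w :=
    h1.trans (mul_le_mul_of_nonneg_right hM hw0)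
  have h3 : ∑ x, (if x + L ∈ R then boltzmann β A x else 0) = w := by
    rw [hw, ← Finset.univ_inter R, ← Finset.sum_ite_mem]
    refine Fintype.sum_equiv (Equiv.addRight L) _ _ fun x => ?_
    simp [boltzmann_add_of_ker β hL]
  have h4 : ∑ x, (if x ∈ R then boltzmann β A x else 0) = w := by
    rw [hw, Finset.sum_ite_mem, Finset.univ_inter]
  have h5 : ∑ x, (if x ∈ R ∧ x + L ∈ R then boltzmann β A x else 0) =
      ∑ x ∈ R.filter (fun x => x + L ∈ R), boltzmann β A x := by
    rw [← Finset.sum_filter]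
    congr 1
    ext x
    simp
  have h6 : w + w ≤ ∑ x, boltzmann β A x +
      ∑ x, (if x ∈ R ∧ x + L ∈ R then boltzmann β A x else 0) := by
    calc w + w = ∑ x, (if x ∈ R then boltzmann β A x else 0) +
          ∑ x, (if x + L ∈ R then boltzmann β A x else 0) := by rw [h3, h4]
      _ ≤ _ := ?_
    rw [← Finset.sum_add_distrib, ← Finset.sum_add_distrib]
    refine Finset.sum_le_sum fun x _ => ?_
    have := boltzmann_pos β A x
    by_cases ha : x ∈ R <;> by_cases hb : x + L ∈ R <;> simp [ha, hb]
    linarith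
  rw [h5] at h6
  linarith

end Peierls

/-! ### Bottlenecks of Markov chains -/

section Markov

variable {Ω : Type*} [Fintype Ω] [DecidableEq Ω]

/-- The indicator function of the complement of `R`. -/
def outside (R : Finset Ω) (x : Ω) : ℝ := if x ∈ R then 0 else 1

/-- A measure that is dominated by the stationary one stays dominated by it. -/
theorem stochastic_pow {P : Matrix Ω Ω ℝ} (hP : ∀ x y, 0 ≤ P x y) {μ π : Ω → ℝ}
    (hμ : ∀ x, 0 ≤ μ x) (hμπ : ∀ x, μ x ≤ π x) (hstat : ∀ y, ∑ x, π x * P x y = π y) (t : ℕ) :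
    ∀ x, 0 ≤ (μ ᵥ* P ^ t) x ∧ (μ ᵥ* P ^ t) x ≤ π x := by
  induction t with
  | zero => simpa using fun x => ⟨hμ x, hμπ x⟩
  | succ t ih =>
    intro y
    have h : (μ ᵥ* P ^ (t + 1)) y = ∑ x, (μ ᵥ* P ^ t) x * P x y := by
      rw [pow_succ, ← Matrix.vecMul_vecMul]
      rfl
    rw [h]
    refine ⟨Finset.sum_nonneg fun x _ => mul_nonneg (ih x).1 (hP x y), ?_⟩
    rw [← hstat y]
    exact Finset.sum_le_sum fun x _ => mul_le_mul_of_nonneg_right (ih x).2 (hP x y)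

/-- Starting from the stationary distribution restricted to `R`, the mass that has left `R` after
`t` steps is at most `t` times the stationary flow out of `R`. -/
theorem leak_le {P : Matrix Ω Ω ℝ} (hP : ∀ x y, 0 ≤ P x y) (hrow : ∀ x, ∑ y, P x y = 1)
    {π : Ω → ℝ} (hπ : ∀ x, 0 ≤ π x) (hstat : ∀ y, ∑ x, π x * P x y = π y) (R : Finset Ω) {ε : ℝ}
    (hflow : ∑ x ∈ R, π x * (P *ᵥ outside R) x ≤ ε) (t : ℕ) :
    ∑ x ∈ R, π x * (P ^ t *ᵥ outside R) x ≤ t * ε := by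
  set μ : Ω → ℝ := fun x => if x ∈ R then π x else 0 with hμ
  have hμ0 : ∀ x, 0 ≤ μ x := fun x => by
    simp only [hμ]; split_ifs; exacts [hπ x, le_rfl]
  have hμπ : ∀ x, μ x ≤ π x := fun x => by
    simp only [hμ]; split_ifs; exacts [le_rfl, hπ x]
  have hsum : ∀ f : Ω → ℝ, ∑ x ∈ R, π x * f x = μ ⬝ᵥ f := by
    intro f
    simp only [dotProduct, hμ, ite_mul, zero_mul]
    rw [Finset.sum_ite_mem, Finset.univ_inter]
  rw [hsum]
  induction t with
  | zero =>
    rw [pow_zero, Matrix.one_mulVec, ← hsum]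
    simp only [Nat.cast_zero, zero_mul]
    refine le_of_eq (Finset.sum_eq_zero fun x hx => ?_)
    simp [outside, hx]
  | succ t ih =>
    have hb := stochastic_pow hP hμ0 hμπ hstat t
    have hPo : ∀ x, 0 ≤ (P *ᵥ outside R) x ∧ (P *ᵥ outside R) x ≤ 1 := by
      intro x
      have h01 : ∀ y, 0 ≤ outside R y ∧ outside R y ≤ 1 := fun y => by
        unfold outside; split_ifs <;> norm_num
      refine ⟨Finset.sum_nonneg fun y _ => mul_nonneg (hP x y) (h01 y).1, ?_⟩
      rw [← hrow x]
      exact Finset.sum_le_sum fun y _ => mul_le_of_le_one_right (hP x y) (h01 y).2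
    rw [pow_succ, ← Matrix.mulVec_mulVec, Matrix.dotProduct_mulVec]
    rw [Matrix.dotProduct_mulVec] at ih
    have h1 : (μ ᵥ* P ^ t) ⬝ᵥ (P *ᵥ outside R) ≤
        ∑ x ∈ R, π x * (P *ᵥ outside R) x + (μ ᵥ* P ^ t) ⬝ᵥ outside R := by
      rw [hsum, dotProduct, dotProduct, dotProduct, ← Finset.sum_add_distrib]
      refine Finset.sum_le_sum fun x _ => ?_
      by_cases hx : x ∈ R
      · have h2 : outside R x = 0 := by simp [outside, hx]
        have h3 : μ x = π x := by simp [hμ, hx]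
        rw [h2, h3, mul_zero, add_zero]
        exact mul_le_mul_of_nonneg_right (hb x).2 (hPo x).1
      · have h2 : outside R x = 1 := by simp [outside, hx]
        have h3 : μ x = 0 := by simp [hμ, hx]
        rw [h2, h3, mul_one, zero_mul, zero_add]
        exact mul_le_of_le_one_right (hb x).1 (hPo x).2
    push_cast
    linarith

end Markov

/-! ### The sampler of errors and its escape time from the region -/

section Chain

variable {Q S : Type*} [Fintype Q] [Fintype S] [DecidableEq Q] [DecidableEq S]

theorem flip_flip (x : Q → ZMod 2) (i : Q) : flip (flip x i) i = x := by
  rw [flip, flip, add_assoc, add_self_zmod_two, add_zero]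

theorem eq_flip_comm {x y : Q → ZMod 2} {i : Q} : y = flip x i ↔ x = flip y i :=
  ⟨fun h => by rw [h, flip_flip], fun h => by rw [h, flip_flip]⟩

theorem errorChain_mulVec (a : ℝ → ℝ) (A : Matrix S Q (ZMod 2)) (f : (Q → ZMod 2) → ℝ)
    (x : Q → ZMod 2) :
    (errorChain a A *ᵥ f) x = ∑ i, (Fintype.card Q : ℝ)⁻¹ *
      (a (energy A (flip x i) - energy A x) * f (flip x i) +
        (1 - a (energy A (flip x i) - energy A x)) * f x) := by
  simp only [errorChain, Matrix.mulVec, dotProduct, Matrix.of_apply, Finset.sum_mul]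
  rw [Finset.sum_comm]
  refine Finset.sum_congr rfl fun i _ => ?_
  simp only [mul_assoc, add_mul, mul_add, ite_mul, mul_ite, mul_one, zero_mul, mul_zero,
    Finset.sum_add_distrib]
  simp

variable {A : Matrix S Q (ZMod 2)} {β : ℝ} {a : ℝ → ℝ}

theorem errorChain_nonneg (ha : IsGibbsRule β a) (x y : Q → ZMod 2) : 0 ≤ errorChain a A x y := by
  simp only [errorChain, Matrix.of_apply]
  refine Finset.sum_nonneg fun i _ => mul_nonneg (by positivity) (add_nonneg ?_ ?_)
  · exact mul_nonneg (ha.nonneg _) (by positivity)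
  · exact mul_nonneg (by linarith [ha.le_one (energy A (flip x i) - energy A x)]) (by positivity)

theorem errorChain_mulVec_one [Nonempty Q] : errorChain a A *ᵥ (fun _ => 1) = fun _ => 1 := by
  ext x
  rw [errorChain_mulVec]
  have : (Fintype.card Q : ℝ) ≠ 0 := by exact_mod_cast Fintype.card_ne_zero
  simp [this]

theorem boltzmann_mul_acceptance (ha : IsGibbsRule β a) (x y : Q → ZMod 2) :
    boltzmann β A x * a (energy A y - energy A x) =
      boltzmann β A y * a (energy A x - energy A y) := by
  rw [ha.detailed_balance (energy A y - energy A x), neg_sub, ← mul_assoc, boltzmann, boltzmann,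
    ← Real.exp_add]
  congr 2
  ring

theorem errorChain_reversible (ha : IsGibbsRule β a) (x y : Q → ZMod 2) :
    boltzmann β A x * errorChain a A x y = boltzmann β A y * errorChain a A y x := by
  simp only [errorChain, Matrix.of_apply, Finset.mul_sum]
  refine Finset.sum_congr rfl fun i _ => ?_
  by_cases hxy : y = x
  · rw [hxy]
  have hyx : ¬ x = y := fun h => hxy h.symm
  by_cases hf : y = flip x i
  · have hf' : x = flip y i := eq_flip_comm.1 hf
    rw [if_pos hf, if_pos hf', if_neg hxy, if_neg hyx, ← hf, ← hf']
    have := boltzmann_mul_acceptance (A := A) ha x y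
    linear_combination (Fintype.card Q : ℝ)⁻¹ * this
  · have hf' : ¬ x = flip y i := fun h => hf (eq_flip_comm.2 h)
    rw [if_neg hf, if_neg hf', if_neg hxy, if_neg hyx]
    simp

theorem errorChain_stationary [Nonempty Q] (ha : IsGibbsRule β a) (y : Q → ZMod 2) :
    ∑ x, boltzmann β A x * errorChain a A x y = boltzmann β A y := by
  simp only [errorChain_reversible ha _ y]
  rw [← Finset.mul_sum]
  have := congrFun (errorChain_mulVec_one (a := a) (A := A)) y
  simp only [Matrix.mulVec, dotProduct, mul_one] at this
  rw [this, mul_one]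

variable {G : AddSubgroup (Q → ZMod 2)} {z D M r : ℕ}

/-- The stationary flow out of the region is at most the weight of its outer boundary. -/
theorem flow_le [Nonempty Q] (ha : IsGibbsRule β a) :
    ∑ x ∈ regionFinset A G r, boltzmann β A x *
        (errorChain a A *ᵥ outside (regionFinset A G r)) x ≤
      ∑ x ∈ outerBoundary A G r, boltzmann β A x := by
  classical
  set R := regionFinset A G r with hR
  have hN : (0 : ℝ) < Fintype.card Q := by exact_mod_cast Fintype.card_pos
  have hterm : ∀ x ∈ R, boltzmann β A x * (errorChain a A *ᵥ outside R) x ≤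
      ∑ i, (Fintype.card Q : ℝ)⁻¹ *
        (if flip x i ∈ outerBoundary A G r then boltzmann β A (flip x i) else 0) := by
    intro x hx
    rw [errorChain_mulVec, Finset.mul_sum]
    refine Finset.sum_le_sum fun i _ => ?_
    have hox : outside R x = 0 := by simp [outside, hx]
    rw [hox, mul_zero, add_zero, mul_left_comm]
    refine mul_le_mul_of_nonneg_left ?_ (by positivity)
    rw [← mul_assoc, boltzmann_mul_acceptance ha]
    by_cases hf : flip x i ∈ R
    · have : outside R (flip x i) = 0 := by simp [outside, hf]
      rw [this, mul_zero]
      split_ifs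
      exacts [(boltzmann_pos _ _ _).le, le_rfl]
    · have h1 : outside R (flip x i) = 1 := by simp [outside, hf]
      have h2 : flip x i ∈ outerBoundary A G r := by
        simp only [outerBoundary, Finset.mem_filter, Finset.mem_univ, true_and]
        exact ⟨fun h => hf (mem_regionFinset.2 h), x, mem_regionFinset.1 hx, i, rfl⟩
      rw [h1, mul_one, if_pos h2]
      exact mul_le_of_le_one_right (boltzmann_pos _ _ _).le (ha.le_one _)
  refine (Finset.sum_le_sum hterm).trans ?_
  rw [Finset.sum_comm]
  calc ∑ i, ∑ x ∈ R, (Fintype.card Q : ℝ)⁻¹ *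
        (if flip x i ∈ outerBoundary A G r then boltzmann β A (flip x i) else 0)
      ≤ ∑ _i : Q, (Fintype.card Q : ℝ)⁻¹ * ∑ x ∈ outerBoundary A G r, boltzmann β A x := by
        refine Finset.sum_le_sum fun i _ => ?_
        rw [← Finset.mul_sum]
        refine mul_le_mul_of_nonneg_left ?_ (by positivity)
        calc ∑ x ∈ R, (if flip x i ∈ outerBoundary A G r then boltzmann β A (flip x i) else 0)
            ≤ ∑ x, (if flip x i ∈ outerBoundary A G r then boltzmann β A (flip x i) else 0) := by
              refine Finset.sum_le_sum_of_subset_of_nonneg (Finset.subset_univ _) fun x _ _ => ?_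
              split_ifs
              exacts [(boltzmann_pos _ _ _).le, le_rfl]
          _ = ∑ x, (if x ∈ outerBoundary A G r then boltzmann β A x else 0) :=
              Fintype.sum_equiv (Equiv.addRight (Pi.single i 1)) _ _ fun x => rfl
          _ = _ := by rw [Finset.sum_ite_mem, Finset.univ_inter]
    _ = ∑ x ∈ outerBoundary A G r, boltzmann β A x := by
        rw [Finset.sum_const, Finset.card_univ, nsmul_eq_mul, ← mul_assoc,
          mul_inv_cancel₀ hN.ne', one_mul]

/-- A lower bound on the mixing time of the chain that makes a step of the sampler with probability
`θ`: as long as `t` is small, the region is left with small probability, but the Gibbs measure of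
its complement is at least `1 / 3`. -/
theorem Confined.le_time [Nonempty Q] (hC : Confined A G z D M) (hr : D * r + 1 ≤ M) (hrM : r ≤ M)
    (hz : 1 ≤ z) (hβ0 : 0 ≤ β) (hβ : Real.exp (-β / 2) ≤ 1 / (9 * z)) (ha : IsGibbsRule β a)
    (hq : Fintype.card Q * (2 / 3 : ℝ) ^ (r + 1) ≤ 1 / 2) {θ : ℝ} (hθ0 : 0 ≤ θ) (hθ1 : θ ≤ 1)
    {t : ℕ} (hmix : ∀ x, gibbsDist β A ⬝ᵥ outside (regionFinset A G r) - 1 / 4 ≤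
      (((1 - θ) • (1 : Matrix (Q → ZMod 2) (Q → ZMod 2) ℝ) + θ • errorChain a A) ^ t *ᵥ
        outside (regionFinset A G r)) x) :
    1 / 12 ≤ t * (2 * (Fintype.card Q * (2 / 3 : ℝ) ^ (r + 1))) := by
  classical
  set R := regionFinset A G r with hR
  set q : ℝ := Fintype.card Q * (2 / 3 : ℝ) ^ (r + 1) with hqdef
  have hq0 : 0 ≤ q := by positivity
  set W := boltzmann β A with hW
  have hWpos : ∀ x, 0 < W x := boltzmann_pos β A
  set w := ∑ x ∈ R, W x with hw
  have hw0 : 0 < w := by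
    refine Finset.sum_pos (fun x _ => hWpos x) ⟨0, ?_⟩
    exact mem_regionFinset.2 zero_mem_region
  set Z := ∑ x, W x with hZ
  have hZ0 : 0 < Z := Finset.sum_pos (fun x _ => hWpos x) Finset.univ_nonempty
  have hM : Fintype.card Q * (2 / 3 : ℝ) ^ (M + 1) ≤ 1 / 2 :=
    (mul_le_mul_of_nonneg_left (pow_le_pow_of_le_one (by norm_num) (by norm_num)
      (Nat.add_le_add_right hrM 1)) (by positivity)).trans hq
  have hwZ : w ≤ 2 / 3 * Z := hC.sum_region_le hz hβ0 hβ hM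
  have hout : gibbsDist β A ⬝ᵥ outside R = 1 - w / Z := by
    have h1 : ∀ x, gibbsDist β A x * outside R x = W x / Z - (if x ∈ R then W x / Z else 0) := by
      intro x
      have : gibbsDist β A x = W x / Z := rfl
      rw [this, outside]
      split_ifs <;> ring
    rw [dotProduct, Finset.sum_congr rfl fun x _ => h1 x, Finset.sum_sub_distrib,
      Finset.sum_ite_mem, Finset.univ_inter, ← Finset.sum_div, ← Finset.sum_div,
      div_self hZ0.ne']
  have hout' : 1 / 3 ≤ gibbsDist β A ⬝ᵥ outside R := by
    rw [hout]
    have : w / Z ≤ 2 / 3 := by rwa [div_le_iff₀ hZ0]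
    linarith
  set P := (1 - θ) • (1 : Matrix (Q → ZMod 2) (Q → ZMod 2) ℝ) + θ • errorChain a A with hP
  have hPf : ∀ f x, (P *ᵥ f) x = (1 - θ) * f x + θ * (errorChain a A *ᵥ f) x := by
    intro f x
    simp [hP, Matrix.add_mulVec, Matrix.smul_mulVec]
  have hP0 : ∀ x y, 0 ≤ P x y := by
    intro x y
    simp only [hP, Matrix.add_apply, Matrix.smul_apply, smul_eq_mul, Matrix.one_apply]
    refine add_nonneg (mul_nonneg (by linarith) (by positivity))
      (mul_nonneg hθ0 (errorChain_nonneg ha x y))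
  have hrow : ∀ x, ∑ y, P x y = 1 := by
    intro x
    have h1 := hPf (fun _ => 1) x
    rw [errorChain_mulVec_one] at h1
    simp only [Matrix.mulVec, dotProduct, mul_one] at h1
    rw [h1]
    ring
  have hstat : ∀ y, ∑ x, W x * P x y = W y := by
    intro y
    have h1 : ∀ x, W x * P x y = (1 - θ) * (if x = y then W x else 0) +
        θ * (W x * errorChain a A x y) := by
      intro x
      simp only [hP, Matrix.add_apply, Matrix.smul_apply, smul_eq_mul, Matrix.one_apply]
      split_ifs <;> ring
    rw [Finset.sum_congr rfl fun x _ => h1 x, Finset.sum_add_distrib, ← Finset.mul_sum,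
      ← Finset.mul_sum, errorChain_stationary ha]
    simp
    ring
  have hflow : ∑ x ∈ R, W x * (P *ᵥ outside R) x ≤ 2 * q * w := by
    have h1 : ∑ x ∈ R, W x * (P *ᵥ outside R) x =
        θ * ∑ x ∈ R, W x * (errorChain a A *ᵥ outside R) x := by
      rw [Finset.mul_sum]
      refine Finset.sum_congr rfl fun x hx => ?_
      rw [hPf]
      simp only [outside, hx, if_true]
      ring
    have h2 : ∑ x ∈ R, W x * (errorChain a A *ᵥ outside R) x ≤ (Real.exp q - 1) * w :=
      (flow_le ha).trans (hC.sum_outerBoundary_le hr hz hβ0 hβ)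
    have h3 : Real.exp q ≤ 1 + 2 * q := by
      have h4 : 1 - q ≤ Real.exp (-q) := by linarith [Real.add_one_le_exp (-q)]
      have h5 : Real.exp q * Real.exp (-q) = 1 := by rw [← Real.exp_add]; simp
      have h6 := Real.exp_pos q
      nlinarith
    have h4 : (Real.exp q - 1) * w ≤ 2 * q * w := by nlinarith
    rw [h1]
    have h5 : 0 ≤ 2 * q * w := by positivity
    calc θ * ∑ x ∈ R, W x * (errorChain a A *ᵥ outside R) x ≤ θ * (2 * q * w) :=
          mul_le_mul_of_nonneg_left (h2.trans h4) hθ0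
      _ ≤ 2 * q * w := mul_le_of_le_one_left h5 hθ1
  have hleak := leak_le hP0 hrow (fun x => (hWpos x).le) hstat R hflow t
  -- `1 / 12 = 1 / 3 - 1 / 4`
  have hlow : w * (1 / 12) ≤ ∑ x ∈ R, W x * (P ^ t *ᵥ outside R) x := by
    rw [hw, Finset.sum_mul]
    refine Finset.sum_le_sum fun x _ => mul_le_mul_of_nonneg_left ?_ (hWpos x).le
    linarith [hmix x]
  have : w * (1 / 12) ≤ w * (t * (2 * q)) := by linarith
  exact le_of_mul_le_mul_left this hw0

/-- Total variation distance bounds the difference of probabilities of an event. -/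
theorem dotProduct_outside_le {Ω : Type*} [Fintype Ω] [DecidableEq Ω] {p q : Ω → ℝ}
    (hpq : ∑ x, p x = ∑ x, q x) (R : Finset Ω) :
    q ⬝ᵥ outside R - p ⬝ᵥ outside R ≤ tvDist p q := by
  have h1 : q ⬝ᵥ outside R - p ⬝ᵥ outside R =
      2⁻¹ * ∑ x, (p x - q x) * (1 - 2 * outside R x) := by
    have h2 : ∑ x, (p x - q x) * (1 - 2 * outside R x) =
        ∑ x, p x - ∑ x, q x - 2 * ∑ x, p x * outside R x + 2 * ∑ x, q x * outside R x := by
      rw [Finset.mul_sum, Finset.mul_sum, ← Finset.sum_sub_distrib, ← Finset.sum_sub_distrib,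
        ← Finset.sum_add_distrib]
      exact Finset.sum_congr rfl fun x _ => by ring
    rw [h2, hpq, dotProduct, dotProduct]
    ring
  rw [h1, tvDist]
  refine mul_le_mul_of_nonneg_left (Finset.sum_le_sum fun x _ => ?_) (by norm_num)
  refine (le_abs_self _).trans ?_
  rw [abs_mul]
  refine mul_le_of_le_one_right (abs_nonneg _) ?_
  unfold outside
  split_ifs <;> norm_num

theorem sum_gibbsDist (β : ℝ) (A : Matrix S Q (ZMod 2)) : ∑ x, gibbsDist β A x = 1 := by
  unfold gibbsDist
  rw [← Finset.sum_div, div_self]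
  exact (Finset.sum_pos (fun x _ => Real.exp_pos _) Finset.univ_nonempty).ne'

theorem sum_errorChain_pow [Nonempty Q] (t : ℕ) (x : Q → ZMod 2) :
    ∑ y, (errorChain a A ^ t) x y = 1 := by
  have h : errorChain a A ^ t *ᵥ (fun _ => 1) = fun _ => 1 := by
    induction t with
    | zero => simp
    | succ t ih => rw [pow_succ, ← Matrix.mulVec_mulVec, errorChain_mulVec_one, ih]
  have := congrFun h x
  simpa only [Matrix.mulVec, dotProduct, mul_one] using this

theorem ofReal_le_iInf_natCast {p : ℕ → Prop} {τ : ℝ} (h : ∀ t, p t → τ ≤ t) :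
    ENNReal.ofReal τ ≤ ((⨅ t ∈ {t : ℕ | p t}, (t : ℕ∞) : ℕ∞) : ℝ≥0∞) := by
  have h1 : ((⌈τ⌉₊ : ℕ) : ℕ∞) ≤ ⨅ t ∈ {t : ℕ | p t}, (t : ℕ∞) :=
    le_iInf₂ fun t ht => Nat.cast_le.2 (Nat.ceil_le.2 (h t ht))
  calc ENNReal.ofReal τ ≤ ENNReal.ofReal (⌈τ⌉₊ : ℝ) := ENNReal.ofReal_le_ofReal (Nat.le_ceil τ)
    _ = (((⌈τ⌉₊ : ℕ) : ℕ∞) : ℝ≥0∞) := by simp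
    _ ≤ _ := ENat.toENNReal_le.2 h1

theorem le_of_one_le_mul {τ t q : ℝ} (h1 : 1 ≤ t * q) (h2 : τ * q ≤ 1) (hq : 0 < q) :
    τ ≤ t :=
  le_of_mul_le_mul_right (h2.trans h1) hq

/-- The mixing time of the sampler of errors is exponentially large in `r`. -/
theorem Confined.le_errorMixingTime [Nonempty Q] (hC : Confined A G z D M) (hr : D * r + 1 ≤ M)
    (hrM : r ≤ M) (hz : 1 ≤ z) (hβ0 : 0 ≤ β) (hβ : Real.exp (-β / 2) ≤ 1 / (9 * z))
    (ha : IsGibbsRule β a) (hq : Fintype.card Q * (2 / 3 : ℝ) ^ (r + 1) ≤ 1 / 2) {τ : ℝ}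
    (hτ : τ * (24 * (Fintype.card Q * (2 / 3 : ℝ) ^ (r + 1))) ≤ 1) :
    ENNReal.ofReal τ ≤ (errorMixingTime β a A : ℝ≥0∞) := by
  refine ofReal_le_iInf_natCast fun t ht => ?_
  have hN : (0 : ℝ) < Fintype.card Q := by exact_mod_cast Fintype.card_pos
  refine le_of_one_le_mul ?_ hτ (by positivity)
  have h := hC.le_time hr hrM hz hβ0 hβ ha hq (θ := 1) zero_le_one le_rfl (t := t) fun x => ?_
  · linarith
  rw [sub_self, zero_smul, zero_add, one_smul]
  have h1 : ∑ y, (errorChain a A ^ t) x y = ∑ y, gibbsDist β A y := by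
    rw [sum_errorChain_pow, sum_gibbsDist]
  have h2 := dotProduct_outside_le h1 (regionFinset A G r)
  have h3 := ht x
  have h4 : (errorChain a A ^ t *ᵥ outside (regionFinset A G r)) x =
      (errorChain a A ^ t) x ⬝ᵥ outside (regionFinset A G r) := rfl
  rw [h4]
  linarith

end Chain

/-! ### Trace norm and measurement -/

section TraceNorm

/-- Trace-norm duality, for the operators that are needed: diagonal contractions. Take the trace in
an orthonormal eigenbasis of `Mᴴ * M` and apply the Cauchy–Schwarz inequality to each term. -/
theorem norm_trace_diagonal_mul_le {Ω : Type*} [Fintype Ω] [DecidableEq Ω] {d : Ω → ℂ}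
    (hd : ∀ i, ‖d i‖ ≤ 1) (M : Matrix Ω Ω ℂ) :
    ‖(Matrix.diagonal d * M).trace‖ ≤ traceNorm M := by
  set hM := (Matrix.posSemidef_conjTranspose_mul_self M).isHermitian with hMdef
  set U : Matrix Ω Ω ℂ := (hM.eigenvectorUnitary : Matrix Ω Ω ℂ) with hU
  have hUU : U * Uᴴ = 1 := Matrix.mem_unitaryGroup_iff.1 hM.eigenvectorUnitary.2
  have hUU' : Uᴴ * U = 1 := Matrix.mem_unitaryGroup_iff'.1 hM.eigenvectorUnitary.2
  have hspec : Uᴴ * (Mᴴ * M) * U = Matrix.diagonal (fun i => ((hM.eigenvalues i : ℝ) : ℂ)) := by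
    have h := hM.spectral_theorem
    rw [Unitary.conjStarAlgAut_apply] at h
    have h2 : Mᴴ * M = U * Matrix.diagonal (fun i => ((hM.eigenvalues i : ℝ) : ℂ)) * Uᴴ := h
    calc Uᴴ * (Mᴴ * M) * U
        = Uᴴ * (U * Matrix.diagonal (fun i => ((hM.eigenvalues i : ℝ) : ℂ)) * Uᴴ) * U :=
          congrArg (fun X => Uᴴ * X * U) h2
      _ = (Uᴴ * U) * Matrix.diagonal (fun i => ((hM.eigenvalues i : ℝ) : ℂ)) * (Uᴴ * U) := by
          simp only [Matrix.mul_assoc]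
      _ = _ := by rw [hUU', Matrix.one_mul, Matrix.mul_one]
  have hcol : ∀ j, ∑ i, ‖(M * U) i j‖ ^ 2 = hM.eigenvalues j := by
    intro j
    have h := congrFun (congrFun hspec j) j
    rw [Matrix.diagonal_apply_eq] at h
    have h2 : (Uᴴ * (Mᴴ * M) * U) j j = ∑ i, ((‖(M * U) i j‖ ^ 2 : ℝ) : ℂ) := by
      have : Uᴴ * (Mᴴ * M) * U = (M * U)ᴴ * (M * U) := by
        rw [Matrix.conjTranspose_mul]
        simp only [Matrix.mul_assoc]
      rw [this, Matrix.mul_apply]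
      refine Finset.sum_congr rfl fun i _ => ?_
      rw [Matrix.conjTranspose_apply, Complex.star_def, Complex.conj_mul']
      push_cast
      rfl
    rw [h2] at h
    exact_mod_cast h
  have hcolU : ∀ j, ∑ i, ‖U i j‖ ^ 2 = 1 := by
    intro j
    have h := congrFun (congrFun hUU' j) j
    rw [Matrix.one_apply_eq, Matrix.mul_apply] at h
    have h2 : ∑ i, Uᴴ j i * U i j = ∑ i, ((‖U i j‖ ^ 2 : ℝ) : ℂ) := by
      refine Finset.sum_congr rfl fun i _ => ?_
      rw [Matrix.conjTranspose_apply, Complex.star_def, Complex.conj_mul']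
      push_cast
      rfl
    rw [h2] at h
    exact_mod_cast h
  have htr : (Matrix.diagonal d * M).trace = ∑ j, ∑ i, star (U i j) * (d i * (M * U) i j) := by
    calc (Matrix.diagonal d * M).trace = (Matrix.diagonal d * M * (U * Uᴴ)).trace := by
          rw [hUU, Matrix.mul_one]
      _ = (Uᴴ * (Matrix.diagonal d * (M * U))).trace := by
          rw [← Matrix.mul_assoc, Matrix.trace_mul_comm]
          simp only [Matrix.mul_assoc]
      _ = _ := by
          simp only [Matrix.trace, Matrix.diag_apply, Matrix.mul_apply (M := Uᴴ),
            Matrix.diagonal_mul, Matrix.conjTranspose_apply]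
  rw [htr, traceNorm]
  refine (norm_sum_le _ _).trans (Finset.sum_le_sum fun j _ => ?_)
  calc ‖∑ i, star (U i j) * (d i * (M * U) i j)‖ ≤ ∑ i, ‖U i j‖ * ‖(M * U) i j‖ := by
        refine (norm_sum_le _ _).trans (Finset.sum_le_sum fun i _ => ?_)
        rw [norm_mul, norm_star, norm_mul]
        exact mul_le_mul_of_nonneg_left (mul_le_of_le_one_left (norm_nonneg _) (hd i))
          (norm_nonneg _)
    _ ≤ √(∑ i, ‖U i j‖ ^ 2) * √(∑ i, ‖(M * U) i j‖ ^ 2) :=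
        Real.sum_mul_le_sqrt_mul_sqrt _ _ _
    _ = √(hM.eigenvalues j) := by rw [hcolU, hcol, Real.sqrt_one, one_mul]

end TraceNorm

section Measurement

variable {Q : Type*} [Fintype Q] [DecidableEq Q] {ι : Type*} [DecidableEq ι]
  {G : ι → Op Q} {hG : ∀ s t, Commute (G s) (G t)}

theorem outcomeProj_empty (T : Finset ι) : outcomeProj G hG ∅ T = 1 := by
  simp [outcomeProj]

theorem outcomeProj_insert {s : ι} {A : Finset ι} (hs : s ∉ A) (T : Finset ι) :
    outcomeProj G hG (insert s A) T =
      ((2⁻¹ : ℂ) • (1 + (if s ∈ T then (-1 : ℂ) else 1) • G s)) * outcomeProj G hG A T :=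
  Finset.noncommProd_insert_of_notMem A s
    (fun s => (2⁻¹ : ℂ) • (1 + (if s ∈ T then (-1 : ℂ) else 1) • G s)) _ hs

theorem outcomeProj_insert_right {s : ι} {A : Finset ι} (hs : s ∉ A) (T : Finset ι) :
    outcomeProj G hG A (insert s T) = outcomeProj G hG A T := by
  refine Finset.noncommProd_congr rfl (fun t ht => ?_) _
  have : t ≠ s := fun h => hs (h ▸ ht)
  simp [this]

theorem commute_outcomeProj {D : Op Q} (hD : ∀ s, Commute D (G s)) (A T : Finset ι) :
    Commute D (outcomeProj G hG A T) := by
  refine Finset.noncommProd_commute _ _ _ _ fun s _ => ?_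
  exact Commute.smul_right ((Commute.one_right D).add_right ((hD s).smul_right _)) _

theorem sum_outcomeProj (A : Finset ι) : ∑ T ∈ A.powerset, outcomeProj G hG A T = 1 := by
  induction A using Finset.induction_on with
  | empty => simp [outcomeProj_empty]
  | insert s A hs ih =>
    rw [Finset.sum_powerset_insert hs, ← Finset.sum_add_distrib, ← ih]
    refine Finset.sum_congr rfl fun T hT => ?_
    have hsT : s ∉ T := fun h => hs (Finset.mem_powerset.1 hT h)
    rw [outcomeProj_insert hs, outcomeProj_insert hs, outcomeProj_insert_right hs, ← add_mul]
    simp only [hsT, if_false, Finset.mem_insert_self, if_true]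
    have : (2⁻¹ : ℂ) • (1 + (1 : ℂ) • G s) + (2⁻¹ : ℂ) • (1 + (-1 : ℂ) • G s) = 1 := by
      rw [← smul_add]
      have h2 : 1 + (1 : ℂ) • G s + (1 + (-1 : ℂ) • G s) = (2 : ℂ) • 1 := by
        rw [one_smul, neg_smul, one_smul, two_smul]
        abel
      rw [h2, smul_smul, inv_mul_cancel₀ two_ne_zero, one_smul]
    rw [this, one_mul]

theorem outcomeProj_mul_self (hG2 : ∀ s, G s * G s = 1) (A T : Finset ι) :
    outcomeProj G hG A T * outcomeProj G hG A T = outcomeProj G hG A T := by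
  induction A using Finset.induction_on with
  | empty => simp [outcomeProj_empty]
  | insert s A hs ih =>
    rw [outcomeProj_insert hs]
    set c : ℂ := if s ∈ T then (-1 : ℂ) else 1 with hc
    have hcc : c * c = 1 := by rw [hc]; split_ifs <;> norm_num
    set h := (2⁻¹ : ℂ) • (1 + c • G s) with hh
    have hcomm : Commute h (outcomeProj G hG A T) := by
      refine commute_outcomeProj (fun t => ?_) A T
      exact Commute.smul_left ((Commute.one_left _).add_left ((hG s t).smul_left _)) _
    have hidem : h * h = h := by
      rw [hh, smul_mul_smul_comm, add_mul, one_mul, mul_add, mul_one, smul_mul_smul_comm, hG2, hcc,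
        one_smul]
      have : 1 + c • G s + (c • G s + 1) = (2 : ℂ) • (1 + c • G s) := by
        rw [two_smul]; abel
      rw [this, smul_smul]
      norm_num
    calc h * outcomeProj G hG A T * (h * outcomeProj G hG A T)
        = (h * h) * (outcomeProj G hG A T * outcomeProj G hG A T) := by
          rw [mul_assoc, ← mul_assoc _ h, ← hcomm.eq]
          simp only [mul_assoc]
      _ = _ := by rw [hidem, ih]

/-- A local update does not change the expectation of an observable that commutes with the measured
stabilizers and with the Pauli operator. -/
theorem trace_localUpdate_of_commute (a : ℝ → ℝ) (hG2 : ∀ s, G s * G s = 1) {D P : Op Q}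
    (hD : ∀ s, Commute D (G s)) (hP : Pᴴ * D * P = D) (A : Finset ι) (ρ : Op Q) :
    (D * localUpdate a G hG A P ρ).trace = (D * ρ).trace := by
  have h1 : ∀ T, (D * (outcomeProj G hG A T * ρ * outcomeProj G hG A T)).trace =
      (outcomeProj G hG A T * (D * ρ)).trace := by
    intro T
    have hc := (commute_outcomeProj (hG := hG) hD A T).eq
    calc (D * (outcomeProj G hG A T * ρ * outcomeProj G hG A T)).trace
        = ((D * outcomeProj G hG A T * ρ) * outcomeProj G hG A T).trace := by
          simp only [mul_assoc]
      _ = (outcomeProj G hG A T * outcomeProj G hG A T * (D * ρ)).trace := by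
          rw [Matrix.trace_mul_comm, hc]
          simp only [mul_assoc]
      _ = _ := by rw [outcomeProj_mul_self hG2]
  have h2 : ∀ X : Op Q, (D * (P * X * Pᴴ)).trace = (D * X).trace := by
    intro X
    calc (D * (P * X * Pᴴ)).trace = ((D * P * X) * Pᴴ).trace := by simp only [mul_assoc]
      _ = ((Pᴴ * D * P) * X).trace := by
          rw [Matrix.trace_mul_comm]
          simp only [mul_assoc]
      _ = _ := by rw [hP]
  rw [localUpdate, Finset.mul_sum, Matrix.trace_sum]
  calc ∑ T ∈ A.powerset, (D *
        ((a (2 * ((A \ T).card - T.card)) : ℂ) •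
            (P * (outcomeProj G hG A T * ρ * outcomeProj G hG A T) * Pᴴ) +
          ((1 - a (2 * ((A \ T).card - T.card)) : ℝ) : ℂ) •
            (outcomeProj G hG A T * ρ * outcomeProj G hG A T))).trace
      = ∑ T ∈ A.powerset, (outcomeProj G hG A T * (D * ρ)).trace := by
        refine Finset.sum_congr rfl fun T _ => ?_
        rw [mul_add, Matrix.trace_add, mul_smul_comm, mul_smul_comm, Matrix.trace_smul,
          Matrix.trace_smul, h2, h1, ← add_smul]
        push_cast
        rw [add_sub_cancel, one_smul]
    _ = (D * ρ).trace := by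
        rw [← Matrix.trace_sum, ← Finset.sum_mul, sum_outcomeProj, one_mul]

end Measurement

/-! ### The quantum sampler in the Heisenberg picture -/

section Heisenberg

variable {Q SX SZ : Type*} [Fintype Q] [DecidableEq Q] [Fintype SX] [DecidableEq SX]
  [Fintype SZ] [DecidableEq SZ]

/-- The diagonal observable with values `f`. -/
def diagObs (f : (Q → ZMod 2) → ℝ) : Op Q := Matrix.diagonal fun x => (f x : ℂ)

theorem pauliX_zero : pauliX (0 : Q → ZMod 2) = 1 := by
  ext x y
  simp [pauliX, Matrix.one_apply]

theorem pauliX_mul_self (v : Q → ZMod 2) : pauliX v * pauliX v = 1 := by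
  rw [pauliX_mul, add_self_zmod_two, pauliX_zero]

theorem pauliX_conjTranspose (v : Q → ZMod 2) : (pauliX v)ᴴ = pauliX v := by
  ext x y
  have h : y = x + v ↔ x = y + v := by
    constructor <;> rintro rfl <;> rw [add_assoc, add_self_zmod_two, add_zero]
  simp only [Matrix.conjTranspose_apply, pauliX, Matrix.of_apply, h]
  split_ifs <;> simp

theorem pauliX_mul_diagonal_mul (v : Q → ZMod 2) (d : (Q → ZMod 2) → ℂ) :
    pauliX v * Matrix.diagonal d * pauliX v = Matrix.diagonal fun x => d (x + v) := by
  have h1 : pauliX v * Matrix.diagonal d = Matrix.diagonal (fun x => d (x + v)) * pauliX v := by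
    ext x y
    rw [Matrix.mul_diagonal, Matrix.diagonal_mul, pauliX, Matrix.of_apply]
    split_ifs with h
    · rw [h, add_assoc, add_self_zmod_two, add_zero, mul_comm]
    · simp
  rw [h1, mul_assoc, pauliX_mul_self, mul_one]

theorem commute_diagObs_pauliX {f : (Q → ZMod 2) → ℝ} {v : Q → ZMod 2}
    (hf : ∀ x, f (x + v) = f x) : Commute (diagObs f) (pauliX v) := by
  have h := pauliX_mul_diagonal_mul v fun x => (f x : ℂ)
  simp only [hf] at h
  have h2 := congrArg (pauliX v * ·) h
  simp only [← mul_assoc, pauliX_mul_self, one_mul] at h2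
  exact h2

theorem pauliZ_mul_self (v : Q → ZMod 2) : pauliZ v * pauliZ v = 1 := by
  rw [pauliZ, Matrix.diagonal_mul_diagonal, ← Matrix.diagonal_one]
  congr 1
  ext x
  split_ifs <;> norm_num

theorem pauliZ_conjTranspose (v : Q → ZMod 2) : (pauliZ v)ᴴ = pauliZ v := by
  rw [pauliZ, Matrix.diagonal_conjTranspose]
  congr 1
  ext x
  simp only [Pi.star_apply]
  split_ifs <;> simp

theorem pauliZ_conj_diagObs (v : Q → ZMod 2) (f : (Q → ZMod 2) → ℝ) :
    (pauliZ v)ᴴ * diagObs f * pauliZ v = diagObs f := by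
  have h : Commute (pauliZ v) (diagObs f) := Matrix.commute_diagonal _ _
  rw [pauliZ_conjTranspose, h.eq, mul_assoc, pauliZ_mul_self, mul_one]

open Classical in
/-- Measuring `Z`-stabilizers projects on the basis states with the given syndrome. -/
theorem outcomeProj_pauliZ (HZ : Matrix SZ Q (ZMod 2)) (A T : Finset SZ) :
    outcomeProj (fun s => pauliZ (HZ s)) (fun _ _ => pauliZ_commute _ _) A T =
      Matrix.diagonal fun x => if ∀ s ∈ A, (s ∈ T ↔ (HZ *ᵥ x) s ≠ 0) then 1 else 0 := by
  induction A using Finset.induction_on with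
  | empty => simp [outcomeProj_empty]
  | insert s A hs ih =>
    rw [outcomeProj_insert hs, ih]
    have h1 : (2⁻¹ : ℂ) • (1 + (if s ∈ T then (-1 : ℂ) else 1) • pauliZ (HZ s)) =
        Matrix.diagonal fun x => if (s ∈ T ↔ (HZ *ᵥ x) s ≠ 0) then 1 else 0 := by
      rw [pauliZ, ← Matrix.diagonal_one, ← Matrix.diagonal_smul, Matrix.diagonal_add,
        ← Matrix.diagonal_smul]
      congr 1
      ext x
      have : (HZ *ᵥ x) s = HZ s ⬝ᵥ x := rfl
      rw [this]
      by_cases hT : s ∈ T <;> by_cases h0 : HZ s ⬝ᵥ x = 0 <;> simp [hT, h0] <;> norm_num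
    rw [h1, Matrix.diagonal_mul_diagonal]
    congr 1
    ext x
    simp only [Finset.forall_mem_insert]
    by_cases h2 : (s ∈ T ↔ (HZ *ᵥ x) s ≠ 0) <;>
      by_cases h3 : (∀ s ∈ A, (s ∈ T ↔ (HZ *ᵥ x) s ≠ 0)) <;> simp [h2, h3]

theorem energy_flip_sub (HZ : Matrix SZ Q (ZMod 2)) (x : Q → ZMod 2) (i : Q)
    {A T : Finset SZ} (hA : A = Finset.univ.filter fun s => HZ s i ≠ 0)
    (hT : T = A.filter fun s => (HZ *ᵥ x) s ≠ 0) :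
    energy HZ (flip x i) - energy HZ x = 2 * (((A \ T).card : ℝ) - T.card) := by
  have hA' : ∀ s, s ∈ A ↔ HZ s i ≠ 0 := by simp [hA]
  have hσ : ∀ s, (HZ *ᵥ flip x i) s = (HZ *ᵥ x) s + HZ s i := by
    intro s
    rw [flip, Matrix.mulVec_add, Pi.add_apply, Matrix.mulVec_single_one]
    rfl
  have h01 : ∀ u v : ZMod 2, v ≠ 0 → (u + v ≠ 0 ↔ u = 0) := by decide
  have h1 : hammingNorm (HZ *ᵥ x) =
      T.card + ((vsupp (HZ *ᵥ x)).filter fun s => s ∉ A).card := by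
    rw [hammingNorm_eq_card, ← Finset.card_filter_add_card_filter_not (fun s => s ∈ A)]
    congr 2
    rw [hT]
    ext s
    simp only [Finset.mem_filter, mem_vsupp]
    tauto
  have h2 : hammingNorm (HZ *ᵥ flip x i) =
      (A \ T).card + ((vsupp (HZ *ᵥ x)).filter fun s => s ∉ A).card := by
    rw [hammingNorm_eq_card, ← Finset.card_filter_add_card_filter_not (fun s => s ∈ A)]
    congr 2
    · rw [hT]
      ext s
      simp only [Finset.mem_filter, mem_vsupp, Finset.mem_sdiff, hσ]
      by_cases hs : s ∈ A
      · have := h01 ((HZ *ᵥ x) s) _ ((hA' s).1 hs)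
        simp only [hs, this]
        tauto
      · tauto
    · ext s
      simp only [Finset.mem_filter, mem_vsupp, hσ]
      by_cases hs : s ∈ A
      · tauto
      · have : HZ s i = 0 := by
          by_contra h
          exact hs ((hA' s).2 h)
        rw [this, add_zero]
  unfold energy
  rw [h1, h2]
  push_cast
  ring

/-- The local update with `X i`, in the Heisenberg picture and on diagonal observables, is the
classical update of the site `i`. -/
theorem trace_localUpdate_pauliX (a : ℝ → ℝ) (HZ : Matrix SZ Q (ZMod 2)) (i : Q)
    (f : (Q → ZMod 2) → ℝ) (ρ : Op Q) :
    (diagObs f * localUpdate a (fun s => pauliZ (HZ s)) (fun _ _ => pauliZ_commute _ _)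
        (Finset.univ.filter fun s => HZ s i ≠ 0) (pauliX (Pi.single i 1)) ρ).trace =
      (diagObs (fun x => a (energy HZ (flip x i) - energy HZ x) * f (flip x i) +
        (1 - a (energy HZ (flip x i) - energy HZ x)) * f x) * ρ).trace := by
  classical
  set A := Finset.univ.filter fun s => HZ s i ≠ 0 with hA
  rw [localUpdate, Finset.mul_sum, Matrix.trace_sum]
  set c : Finset SZ → (Q → ZMod 2) → ℂ := fun T x =>
    if ∀ s ∈ A, (s ∈ T ↔ (HZ *ᵥ x) s ≠ 0) then 1 else 0 with hc
  set b : Finset SZ → ℝ := fun T => a (2 * ((A \ T).card - T.card)) with hb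
  have hterm : ∀ T ∈ A.powerset, (diagObs f *
      ((b T : ℂ) • (pauliX (Pi.single i 1) * (Matrix.diagonal (c T) * ρ * Matrix.diagonal (c T)) *
          (pauliX (Pi.single i 1))ᴴ) +
        ((1 - b T : ℝ) : ℂ) • (Matrix.diagonal (c T) * ρ * Matrix.diagonal (c T)))).trace =
      ∑ x, c T x * (b T * f (flip x i) + (1 - b T) * f x) * ρ x x := by
    intro T _
    have hcc : ∀ x, c T x * c T x = c T x := by
      intro x
      simp only [hc]
      split_ifs <;> simp
    have hdiag : ∀ g : (Q → ZMod 2) → ℂ, (Matrix.diagonal g *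
        (Matrix.diagonal (c T) * ρ * Matrix.diagonal (c T))).trace =
        ∑ x, c T x * g x * ρ x x := by
      intro g
      rw [← mul_assoc, Matrix.trace_mul_comm, ← mul_assoc, ← mul_assoc,
        Matrix.diagonal_mul_diagonal, Matrix.diagonal_mul_diagonal, Matrix.trace]
      refine Finset.sum_congr rfl fun x _ => ?_
      rw [Matrix.diag_apply, Matrix.diagonal_mul]
      linear_combination g x * ρ x x * hcc x
    have hX : ∀ Y : Op Q, (diagObs f * (pauliX (Pi.single i 1) * Y *
        (pauliX (Pi.single i 1))ᴴ)).trace =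
        (Matrix.diagonal (fun x => (f (flip x i) : ℂ)) * Y).trace := by
      intro Y
      have h := pauliX_mul_diagonal_mul (Pi.single i 1) fun x => (f x : ℂ)
      rw [pauliX_conjTranspose]
      calc _ = ((diagObs f * pauliX (Pi.single i 1) * Y) * pauliX (Pi.single i 1)).trace := by
            simp only [mul_assoc]
        _ = ((pauliX (Pi.single i 1) * diagObs f * pauliX (Pi.single i 1)) * Y).trace := by
            rw [Matrix.trace_mul_comm]
            simp only [mul_assoc]
        _ = _ := by
            rw [diagObs, h]
            rfl
    rw [mul_add, Matrix.trace_add, mul_smul_comm, mul_smul_comm, Matrix.trace_smul,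
      Matrix.trace_smul, hX, hdiag, diagObs, hdiag, smul_eq_mul, smul_eq_mul, Finset.mul_sum,
      Finset.mul_sum, ← Finset.sum_add_distrib]
    refine Finset.sum_congr rfl fun x _ => ?_
    push_cast
    ring
  simp only [outcomeProj_pauliZ]
  rw [Finset.sum_congr rfl hterm, Finset.sum_comm]
  rw [Matrix.trace]
  refine Finset.sum_congr rfl fun x _ => ?_
  set T := A.filter fun s => (HZ *ᵥ x) s ≠ 0 with hT
  rw [Finset.sum_eq_single_of_mem T (Finset.mem_powerset.2 (Finset.filter_subset _ _))]
  · have h1 : c T x = 1 := by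
      simp only [hc]
      rw [if_pos]
      intro s hs
      simp [hT, hs]
    rw [Matrix.diag_apply, diagObs, Matrix.diagonal_mul, h1, energy_flip_sub HZ x i hA hT]
    push_cast
    ring
  · intro T' hT' hne
    have h0 : c T' x = 0 := by
      simp only [hc]
      rw [if_neg]
      intro h
      apply hne
      ext s
      rw [hT, Finset.mem_filter]
      constructor
      · intro hs
        have hsA := Finset.mem_powerset.1 hT' hs
        exact ⟨hsA, (h s hsA).1 hs⟩
      · intro hs
        exact (h s hs.1).2 hs.2
    rw [h0]
    ring

/-- One step of the quantum sampler, in the Heisenberg picture and on diagonal observables that are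
invariant under the `X`-stabilizers, is one step of the sampler of `X` errors with probability one
half. -/
theorem trace_quantumSampler [Nonempty Q] (a : ℝ → ℝ) (HX : Matrix SX Q (ZMod 2))
    (HZ : Matrix SZ Q (ZMod 2)) {f : (Q → ZMod 2) → ℝ} (hf : ∀ s x, f (x + HX s) = f x)
    (ρ : Op Q) :
    (diagObs f * quantumSampler a HX HZ ρ).trace =
      (diagObs (((1 - 1 / 2 : ℝ) • (1 : Matrix (Q → ZMod 2) (Q → ZMod 2) ℝ) +
        (1 / 2 : ℝ) • errorChain a HZ) *ᵥ f) * ρ).trace := by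
  have hN : (Fintype.card Q : ℂ) ≠ 0 := by exact_mod_cast Fintype.card_ne_zero
  rw [quantumSampler, mul_smul_comm, Matrix.trace_smul, Finset.mul_sum, Matrix.trace_sum]
  have h1 : ∀ i : Q, (diagObs f *
      (localUpdate a (fun s => pauliZ (HZ s)) (fun _ _ => pauliZ_commute _ _)
        (Finset.univ.filter fun s => HZ s i ≠ 0) (pauliX (Pi.single i 1)) ρ +
      localUpdate a (fun s => pauliX (HX s)) (fun _ _ => pauliX_commute _ _)
        (Finset.univ.filter fun s => HX s i ≠ 0) (pauliZ (Pi.single i 1)) ρ)).trace =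
      ∑ x, ((a (energy HZ (flip x i) - energy HZ x) * f (flip x i) +
        (1 - a (energy HZ (flip x i) - energy HZ x)) * f x + f x : ℝ) : ℂ) * ρ x x := by
    intro i
    rw [mul_add, Matrix.trace_add, trace_localUpdate_pauliX,
      trace_localUpdate_of_commute a (fun s => pauliX_mul_self _)
        (fun s => commute_diagObs_pauliX (hf s)) (pauliZ_conj_diagObs _ _)]
    rw [Matrix.trace, Matrix.trace, ← Finset.sum_add_distrib]
    refine Finset.sum_congr rfl fun x _ => ?_
    simp only [Matrix.diag_apply, diagObs, Matrix.diagonal_mul]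
    push_cast
    ring
  rw [Finset.sum_congr rfl fun i _ => h1 i, Finset.sum_comm, Matrix.trace, smul_eq_mul,
    Finset.mul_sum]
  refine Finset.sum_congr rfl fun x _ => ?_
  simp only [Matrix.diag_apply, diagObs, Matrix.diagonal_mul, Matrix.add_mulVec,
    Matrix.smul_mulVec, Matrix.one_mulVec, Pi.add_apply, Pi.smul_apply, smul_eq_mul,
    errorChain_mulVec]
  rw [← Finset.sum_mul, ← mul_assoc]
  congr 1
  rw [← Finset.mul_sum]
  push_cast
  rw [Finset.sum_add_distrib (g := fun _ => (f x : ℂ)), Finset.sum_const, Finset.card_univ,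
    nsmul_eq_mul]
  linear_combination (2⁻¹ * (f x : ℂ)) * mul_inv_cancel₀ hN

end Heisenberg

/-! ### The Gibbs state and the quantum mixing time -/

section QuantumMixing

variable {Q SX SZ : Type*} [Fintype Q] [DecidableEq Q] [Fintype SX] [DecidableEq SX]
  [Fintype SZ] [DecidableEq SZ]

theorem commute_pauliX_pauliZ {u v : Q → ZMod 2} (h : v ⬝ᵥ u = 0) :
    Commute (pauliX u) (pauliZ v) := by
  have h1 := pauliX_mul_diagonal_mul u fun x => if v ⬝ᵥ x = 0 then (1 : ℂ) else -1
  simp only [dotProduct_add, h, add_zero] at h1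
  have h2 := congrArg (pauliX u * ·) h1
  simp only [← mul_assoc, pauliX_mul_self, one_mul] at h2
  exact h2.symm

theorem sum_pauliZ (HZ : Matrix SZ Q (ZMod 2)) :
    ∑ s, pauliZ (HZ s) = Matrix.diagonal fun x => ((-energy HZ x : ℝ) : ℂ) := by
  have h1 : ∀ x, ∑ s, (if HZ s ⬝ᵥ x = 0 then (1 : ℂ) else -1) = ((-energy HZ x : ℝ) : ℂ) := by
    intro x
    have h2 : ∀ s, (if HZ s ⬝ᵥ x = 0 then (1 : ℂ) else -1) =
        1 - 2 * (if (HZ *ᵥ x) s ≠ 0 then 1 else 0) := by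
      intro s
      have : (HZ *ᵥ x) s = HZ s ⬝ᵥ x := rfl
      rw [this]
      by_cases h : HZ s ⬝ᵥ x = 0 <;> simp [h]
      norm_num
    rw [Finset.sum_congr rfl fun s _ => h2 s, Finset.sum_sub_distrib, ← Finset.mul_sum,
      Finset.sum_boole, energy, hammingNorm]
    simp
  ext x y
  rw [Matrix.sum_apply]
  by_cases hxy : x = y
  · subst hxy
    simp only [pauliZ, Matrix.diagonal_apply_eq]
    exact h1 x
  · simp [pauliZ, Matrix.diagonal_apply_ne _ hxy]

/-- The diagonal entries of `exp (β ∑ X-stabilizers)` are equal, by translation invariance, and do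
not vanish. -/
theorem exp_sum_pauliX_diag (β : ℝ) (HX : Matrix SX Q (ZMod 2)) :
    ∃ K : ℂ, K ≠ 0 ∧ ∀ x, NormedSpace.exp ((β : ℂ) • ∑ s, pauliX (HX s)) x x = K := by
  set h := (β : ℂ) • ∑ s, pauliX (HX s) with hh
  set M := NormedSpace.exp h with hM
  have hcomm : ∀ v, Commute (pauliX v) M := by
    intro v
    refine Commute.exp_right ?_
    exact Commute.smul_right (Commute.sum_right _ _ _ fun s _ => pauliX_commute _ _) _
  have hconst : ∀ x, M x x = M 0 0 := by
    intro x
    have h1 := congrFun (congrFun (hcomm x).eq x) 0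
    simp only [pauliX, Matrix.mul_apply, Matrix.of_apply, ite_mul, one_mul, zero_mul, mul_ite,
      mul_one, mul_zero] at h1
    rw [Finset.sum_eq_single 0, Finset.sum_eq_single x] at h1
    · simpa using h1.symm
    · intro y _ hy
      rw [if_neg]
      simpa using hy
    · simp
    · intro y _ hy
      rw [if_neg]
      intro hxy
      apply hy
      have : y + x + x = x + x := by rw [← hxy]
      rwa [add_assoc, add_self_zmod_two, add_zero] at this
    · simp
  refine ⟨M 0 0, fun h0 => ?_, hconst⟩
  have hherm : hᴴ = h := by
    rw [hh, Matrix.conjTranspose_smul, Matrix.conjTranspose_sum]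
    simp [pauliX_conjTranspose]
  set N := NormedSpace.exp ((2⁻¹ : ℂ) • h) with hN
  have hNN : Nᴴ * N = M := by
    have h1 : Nᴴ = N := by
      rw [hN, ← Matrix.exp_conjTranspose, Matrix.conjTranspose_smul, hherm]
      simp
    rw [h1, hN, ← Matrix.exp_add_of_commute _ _ (Commute.refl _), ← add_smul, hM]
    norm_num
  have htr : (Nᴴ * N).trace = 0 := by
    rw [hNN, Matrix.trace]
    exact Finset.sum_eq_zero fun x _ => by rw [Matrix.diag_apply, hconst, h0]
  have hN0 : N = 0 := Matrix.trace_conjTranspose_mul_self_eq_zero_iff.1 htr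
  have := Matrix.isUnit_exp ((2⁻¹ : ℂ) • h)
  rw [← hN, hN0] at this
  exact not_isUnit_zero this

/-- The diagonal of the Gibbs state is proportional to the Gibbs weight of `X` errors: the `X` and
`Z` parts of the Hamiltonian commute, and the diagonal of the exponential of the `X` part is
constant. -/
theorem exp_hamiltonian_diag (β : ℝ) {HX : Matrix SX Q (ZMod 2)} {HZ : Matrix SZ Q (ZMod 2)}
    (hcss : ∀ s, HZ *ᵥ HX s = 0) :
    ∃ K : ℂ, K ≠ 0 ∧ ∀ x, NormedSpace.exp (-(β : ℂ) • hamiltonian HX HZ) x x =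
      K * (boltzmann β HZ x : ℂ) := by
  obtain ⟨K, hK, hKx⟩ := exp_sum_pauliX_diag β HX
  refine ⟨K, hK, fun x => ?_⟩
  have h1 : -(β : ℂ) • hamiltonian HX HZ =
      (β : ℂ) • ∑ s, pauliX (HX s) + (β : ℂ) • ∑ s, pauliZ (HZ s) := by
    rw [hamiltonian, neg_smul, smul_sub, smul_neg]
    abel
  have hcomm : Commute ((β : ℂ) • ∑ s, pauliX (HX s)) ((β : ℂ) • ∑ s, pauliZ (HZ s)) := by
    refine Commute.smul_left (Commute.smul_right ?_ _) _
    refine Commute.sum_left _ _ _ fun s _ => Commute.sum_right _ _ _ fun t _ => ?_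
    exact commute_pauliX_pauliZ (congrFun (hcss s) t)
  rw [h1, Matrix.exp_add_of_commute _ _ hcomm, sum_pauliZ, ← Matrix.diagonal_smul,
    Matrix.exp_diagonal, Matrix.mul_diagonal, hKx]
  congr 1
  rw [Pi.coe_exp, ← Complex.exp_eq_exp_ℂ, boltzmann]
  simp

theorem trace_diagObs_gibbsState (β : ℝ) {HX : Matrix SX Q (ZMod 2)} {HZ : Matrix SZ Q (ZMod 2)}
    (hcss : ∀ s, HZ *ᵥ HX s = 0) (f : (Q → ZMod 2) → ℝ) :
    (diagObs f * gibbsState β HX HZ).trace = ((gibbsDist β HZ ⬝ᵥ f : ℝ) : ℂ) := by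
  obtain ⟨K, hK, hKx⟩ := exp_hamiltonian_diag β hcss
  set E := NormedSpace.exp (-(β : ℂ) • hamiltonian HX HZ) with hE
  have hZ0 : 0 < ∑ x, boltzmann β HZ x :=
    Finset.sum_pos (fun x _ => boltzmann_pos _ _ _) Finset.univ_nonempty
  have htr : E.trace = K * ((∑ x, boltzmann β HZ x : ℝ) : ℂ) := by
    rw [Matrix.trace]
    simp only [Matrix.diag_apply, hKx]
    push_cast
    rw [Finset.mul_sum]
  rw [gibbsState, mul_smul_comm, Matrix.trace_smul, ← hE, htr, smul_eq_mul, Matrix.trace,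
    dotProduct]
  push_cast
  rw [Finset.mul_sum]
  refine Finset.sum_congr rfl fun x _ => ?_
  have h1 : gibbsDist β HZ x = boltzmann β HZ x / ∑ y, boltzmann β HZ y := rfl
  have h2 : ((∑ x, boltzmann β HZ x : ℝ) : ℂ) ≠ 0 := by exact_mod_cast hZ0.ne'
  rw [Matrix.diag_apply, diagObs, Matrix.diagonal_mul, hKx, h1]
  push_cast at h2 ⊢
  field_simp

/-- The observables of the Heisenberg evolution stay invariant under the `X`-stabilizers. -/
theorem lazyChain_pow_mulVec_add {HX : Matrix SX Q (ZMod 2)} {HZ : Matrix SZ Q (ZMod 2)}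
    (hcss : ∀ s, HZ *ᵥ HX s = 0) (a : ℝ → ℝ) {f : (Q → ZMod 2) → ℝ}
    (hf : ∀ s x, f (x + HX s) = f x) (t : ℕ) (s : SX) (x : Q → ZMod 2) :
    (((1 - 1 / 2 : ℝ) • (1 : Matrix (Q → ZMod 2) (Q → ZMod 2) ℝ) +
        (1 / 2 : ℝ) • errorChain a HZ) ^ t *ᵥ f) (x + HX s) =
      (((1 - 1 / 2 : ℝ) • (1 : Matrix (Q → ZMod 2) (Q → ZMod 2) ℝ) +
        (1 / 2 : ℝ) • errorChain a HZ) ^ t *ᵥ f) x := by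
  induction t generalizing x with
  | zero => simpa using hf s x
  | succ t ih =>
    rw [pow_succ', ← Matrix.mulVec_mulVec]
    set g := ((1 - 1 / 2 : ℝ) • (1 : Matrix (Q → ZMod 2) (Q → ZMod 2) ℝ) +
        (1 / 2 : ℝ) • errorChain a HZ) ^ t *ᵥ f with hg
    simp only [Matrix.add_mulVec, Matrix.smul_mulVec, Matrix.one_mulVec, Pi.add_apply,
      Pi.smul_apply, smul_eq_mul, errorChain_mulVec]
    have hflip : ∀ i, flip (x + HX s) i = flip x i + HX s := fun i => by
      rw [flip, flip, add_right_comm]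
    have hen : ∀ y, energy HZ (y + HX s) = energy HZ y := fun y => by
      simp only [energy, Matrix.mulVec_add, hcss, add_zero]
    simp only [hflip, hen, ih]

theorem lazyChain_pow_mulVec_one [Nonempty Q] (a : ℝ → ℝ) (HZ : Matrix SZ Q (ZMod 2)) (t : ℕ) :
    ((1 - 1 / 2 : ℝ) • (1 : Matrix (Q → ZMod 2) (Q → ZMod 2) ℝ) +
        (1 / 2 : ℝ) • errorChain a HZ) ^ t *ᵥ (fun _ => 1) = fun _ => 1 := by
  induction t with
  | zero => simp
  | succ t ih =>
    rw [pow_succ, ← Matrix.mulVec_mulVec, Matrix.add_mulVec, Matrix.smul_mulVec,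
      Matrix.smul_mulVec, errorChain_mulVec_one, Matrix.one_mulVec, ← add_smul, sub_add_cancel,
      one_smul, ih]

theorem trace_quantumSampler_iterate [Nonempty Q] (a : ℝ → ℝ) {HX : Matrix SX Q (ZMod 2)}
    {HZ : Matrix SZ Q (ZMod 2)} (hcss : ∀ s, HZ *ᵥ HX s = 0) {f : (Q → ZMod 2) → ℝ}
    (hf : ∀ s x, f (x + HX s) = f x) (t : ℕ) (ρ : Op Q) :
    (diagObs f * (quantumSampler a HX HZ)^[t] ρ).trace =
      (diagObs (((1 - 1 / 2 : ℝ) • (1 : Matrix (Q → ZMod 2) (Q → ZMod 2) ℝ) +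
        (1 / 2 : ℝ) • errorChain a HZ) ^ t *ᵥ f) * ρ).trace := by
  induction t generalizing ρ with
  | zero => simp
  | succ t ih =>
    rw [Function.iterate_succ_apply, ih,
      trace_quantumSampler a HX HZ (lazyChain_pow_mulVec_add hcss a hf t), Matrix.mulVec_mulVec,
      ← pow_succ']

variable {G : AddSubgroup (Q → ZMod 2)} {z D M r : ℕ} {β : ℝ} {a : ℝ → ℝ}

/-- The mixing time of the quantum sampler is exponentially large in `r`: the region is invariant
under the stabilizers, so that the projector on it evolves like the indicator function of the
region under the sampler of errors. -/
theorem Confined.le_quantumMixingTime [Nonempty Q] {HX : Matrix SX Q (ZMod 2)}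
    {HZ : Matrix SZ Q (ZMod 2)} (hC : Confined HZ G z D M) (hHX : ∀ s, HX s ∈ G)
    (hr : D * r + 1 ≤ M) (hrM : r ≤ M) (hz : 1 ≤ z) (hβ0 : 0 ≤ β)
    (hβ : Real.exp (-β / 2) ≤ 1 / (9 * z))
    (ha : IsGibbsRule β a) (hq : Fintype.card Q * (2 / 3 : ℝ) ^ (r + 1) ≤ 1 / 2) {τ : ℝ}
    (hτ : τ * (24 * (Fintype.card Q * (2 / 3 : ℝ) ^ (r + 1))) ≤ 1) :
    ENNReal.ofReal τ ≤ (quantumMixingTime β a HX HZ : ℝ≥0∞) := by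
  have hcss : ∀ s, HZ *ᵥ HX s = 0 := fun s => hC.ker _ (hHX s)
  have hN : (0 : ℝ) < Fintype.card Q := by exact_mod_cast Fintype.card_pos
  refine ofReal_le_iInf_natCast fun t ht => ?_
  refine le_of_one_le_mul ?_ hτ (by positivity)
  have h := hC.le_time hr hrM hz hβ0 hβ ha hq (θ := 1 / 2) (by norm_num) (by norm_num) (t := t)
    fun x => ?_
  · linarith
  set R := regionFinset HZ G r with hR
  have hRinv : ∀ s y, outside R (y + HX s) = outside R y := by
    intro s y
    have : y + HX s ∈ R ↔ y ∈ R := by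
      rw [hR, mem_regionFinset, mem_regionFinset]
      refine ⟨fun h => ?_, fun h => add_mem_region h (hHX s)⟩
      have h2 := add_mem_region h (hHX s)
      rwa [add_assoc, add_self_zmod_two, add_zero] at h2
    simp only [outside, this]
  set K := (1 - 1 / 2 : ℝ) • (1 : Matrix (Q → ZMod 2) (Q → ZMod 2) ℝ) +
    (1 / 2 : ℝ) • errorChain a HZ with hK
  set ρ : Op Q := Matrix.diagonal (Pi.single x 1) with hρ
  have hρs : IsState ρ := by
    refine ⟨Matrix.PosSemidef.diagonal fun y => ?_, ?_⟩
    · show (0 : ℂ) ≤ (Pi.single x (1 : ℂ) : (Q → ZMod 2) → ℂ) y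
      by_cases hy : y = x
      · subst hy; simp
      · simp [hy]
    · rw [hρ, Matrix.trace_diagonal]
      simp
  have hobs : ∀ f : (Q → ZMod 2) → ℝ, (diagObs f * ρ).trace = (f x : ℂ) := by
    intro f
    rw [hρ, diagObs, Matrix.diagonal_mul_diagonal, Matrix.trace_diagonal,
      Finset.sum_eq_single x]
    · simp
    · intro y _ hy
      simp [hy]
    · simp
  have hK1 : K ^ t *ᵥ (fun _ => 1) = fun _ => 1 := lazyChain_pow_mulVec_one a HZ t
  set Δ := (quantumSampler a HX HZ)^[t] ρ - gibbsState β HX HZ with hΔ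
  have hev : ∀ f : (Q → ZMod 2) → ℝ, (∀ s y, f (y + HX s) = f y) →
      (diagObs f * Δ).trace = (((K ^ t *ᵥ f) x - gibbsDist β HZ ⬝ᵥ f : ℝ) : ℂ) := by
    intro f hf
    rw [hΔ, mul_sub, Matrix.trace_sub, trace_quantumSampler_iterate a hcss hf, hobs,
      trace_diagObs_gibbsState β hcss]
    push_cast
    rfl
  -- The observable with values `1` on the region and `-1` outside.
  have hsign : (diagObs (fun y => 1 - 2 * outside R y) * Δ).trace =
      ((2 * (gibbsDist β HZ ⬝ᵥ outside R - (K ^ t *ᵥ outside R) x) : ℝ) : ℂ) := by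
    have h1 : diagObs (fun y => 1 - 2 * outside R y) =
        diagObs (fun _ => 1) - (2 : ℂ) • diagObs (outside R) := by
      ext y y'
      by_cases hy : y = y'
      · subst hy; simp [diagObs]
      · simp [diagObs, hy]
    have h2 : gibbsDist β HZ ⬝ᵥ (fun _ => (1 : ℝ)) = 1 := by
      simpa [dotProduct] using sum_gibbsDist β HZ
    rw [h1, sub_mul, Matrix.trace_sub, smul_mul_assoc, Matrix.trace_smul, hev _ hRinv,
      hev _ (fun _ _ => rfl), hK1, h2]
    push_cast
    rw [smul_eq_mul]
    ring
  have hnorm := norm_trace_diagonal_mul_le (d := fun y => ((1 - 2 * outside R y : ℝ) : ℂ))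
    (fun y => by
      rw [Complex.norm_real, Real.norm_eq_abs]
      unfold outside
      split_ifs <;> norm_num) Δ
  have h3 : (Matrix.diagonal (fun y => ((1 - 2 * outside R y : ℝ) : ℂ)) * Δ).trace =
      ((2 * (gibbsDist β HZ ⬝ᵥ outside R - (K ^ t *ᵥ outside R) x) : ℝ) : ℂ) := hsign
  rw [h3, Complex.norm_real, Real.norm_eq_abs] at hnorm
  have h4 := le_abs_self (2 * (gibbsDist β HZ ⬝ᵥ outside R - (K ^ t *ᵥ outside R) x))
  have h5 := ht ρ hρs
  linarith

end QuantumMixing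

/-! ### Expansion and critical generators of the hypergraph product -/

section Expansion

variable {B C : Type*} [Fintype B] [Fintype C] [DecidableEq B] [DecidableEq C]

open Classical in
/-- A small set of bits contains a bit that shares fewer than a third of its checks with other bits
of the set: among the `Δ |S|` edges out of `S` the shared checks are counted at least twice, and
there are more than `(5 / 6) Δ |S|` checks in the boundary. -/
theorem exists_few_shared {H : Matrix C B (ZMod 2)} {Δ : ℕ} {γ δ : ℝ} (hΔ : 0 < Δ)
    (hdeg : ∀ b, hammingNorm (Hᵀ b) = Δ) (hexp : IsLeftExpanding H Δ γ δ) (hδ : δ < 1 / 6)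
    {S : Finset B} (hS : S.Nonempty) (hcard : (S.card : ℝ) ≤ γ * Fintype.card B) :
    ∃ b ∈ S, 3 * (Finset.univ.filter fun c =>
      H c b ≠ 0 ∧ ∃ b' ∈ S, b' ≠ b ∧ H c b' ≠ 0).card < Δ := by
  by_contra! hcon
  set sh : B → Finset C := fun b => Finset.univ.filter fun c =>
      H c b ≠ 0 ∧ ∃ b' ∈ S, b' ≠ b ∧ H c b' ≠ 0 with hsh
  have hpoint : ∀ c,
      (∑ b ∈ S, if c ∈ sh b then 1 else 0) + 2 * (if c ∈ boundary H S then 1 else 0) ≤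
      2 * ∑ b ∈ S, if H c b ≠ 0 then 1 else 0 := by
    intro c
    simp only [Finset.sum_boole, Nat.cast_id]
    set T := S.filter fun b => H c b ≠ 0 with hT
    have hsub : S.filter (fun b => c ∈ sh b) ⊆ T := by
      intro b hb
      simp only [hsh, Finset.mem_filter, Finset.mem_univ, true_and] at hb
      exact Finset.mem_filter.2 ⟨hb.1, hb.2.1⟩
    have hbd : c ∈ boundary H S ↔ T.Nonempty := by
      simp [boundary, hT, Finset.Nonempty, Finset.mem_filter]
    have hle := Finset.card_le_card hsub
    by_cases hc : c ∈ boundary H S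
    · rw [if_pos hc]
      have hpos := (hbd.1 hc).card_pos
      by_cases h1 : T.card = 1
      · have : S.filter (fun b => c ∈ sh b) = ∅ := by
          rw [Finset.eq_empty_iff_forall_notMem]
          intro b hb
          have hbT := hsub hb
          simp only [hsh, Finset.mem_filter, Finset.mem_univ, true_and] at hb
          obtain ⟨b', hb'S, hne, hb'⟩ := hb.2.2
          have hb'T : b' ∈ T := Finset.mem_filter.2 ⟨hb'S, hb'⟩
          exact hne (Finset.card_le_one.1 h1.le b' hb'T b hbT)
        rw [this, h1]
        simp
      · omega
    · rw [if_neg hc]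
      omega
  have hsum := Finset.sum_le_sum fun c (_ : c ∈ Finset.univ) => hpoint c
  rw [Finset.sum_add_distrib, ← Finset.mul_sum, ← Finset.mul_sum, Finset.sum_comm,
    Finset.sum_comm (s := Finset.univ) (t := S)] at hsum
  have h1 : ∀ b, (∑ c, if c ∈ sh b then 1 else 0) = (sh b).card := fun b => by simp
  have h2 : ∀ b, (∑ c, if H c b ≠ 0 then 1 else 0) = Δ := fun b => by
    rw [← hdeg b, hammingNorm, Finset.card_filter]
    refine Finset.sum_congr rfl fun c _ => ?_
    by_cases h : H c b = 0 <;> simp [h]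
  have h3 : (∑ c, if c ∈ boundary H S then 1 else 0) = (boundary H S).card := by simp
  simp only [h1, h2, h3, Finset.sum_const, smul_eq_mul] at hsum
  have h4 : S.card * Δ ≤ 3 * ∑ b ∈ S, (sh b).card := by
    rw [Finset.mul_sum, ← smul_eq_mul]
    exact Finset.card_nsmul_le_sum _ _ _ hcon
  have h5 := hexp S hcard
  have h6 : (3 * (2 * (boundary H S).card) + S.card * Δ : ℝ) ≤ 3 * (2 * (S.card * Δ)) := by
    have : 3 * (2 * (boundary H S).card) + S.card * Δ ≤ 3 * (2 * (S.card * Δ)) := by omega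
    exact_mod_cast this
  have h7 : (0 : ℝ) < S.card * Δ := by
    have := hS.card_pos
    positivity
  nlinarith

/-- The checks of a bit, and by transposition the bits of a check. -/
def nbrs (H : Matrix C B (ZMod 2)) (b : B) : Finset C := Finset.univ.filter fun c => H c b ≠ 0

theorem mem_nbrs {H : Matrix C B (ZMod 2)} {b : B} {c : C} : c ∈ nbrs H b ↔ H c b ≠ 0 := by
  simp [nbrs]

theorem card_nbrs (H : Matrix C B (ZMod 2)) (b : B) : (nbrs H b).card = hammingNorm (Hᵀ b) := rfl

theorem eq_one_of_ne_zero_zmod_two : ∀ {u : ZMod 2}, u ≠ 0 → u = 1 := by decide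

theorem syndrome_hgpZ (H : Matrix C B (ZMod 2)) (E : B × B ⊕ C × C → ZMod 2) (b : B) (c : C) :
    (hgpZ H H *ᵥ E) (b, c) =
      ∑ b', H c b' * E (Sum.inl (b, b')) + ∑ c', H c' b * E (Sum.inr (c', c)) := by
  simp only [hgpZ, Matrix.mulVec, dotProduct, Fintype.sum_sum_type, Matrix.fromCols_apply_inl,
    Matrix.fromCols_apply_inr, Matrix.kroneckerMap_apply, Fintype.sum_prod_type,
    Matrix.transpose_apply, Matrix.one_apply]
  congr 1
  · rw [Finset.sum_eq_single b]
    · simp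
    · intro b' _ hb'
      simp [hb'.symm]
    · simp
  · refine Finset.sum_congr rfl fun c' _ => ?_
    rw [Finset.sum_eq_single c]
    · simp
    · intro c'' _ hc'
      simp [hc'.symm]
    · simp

/-- The error supported on the qubits `(b, b₀)` with `b ∈ f` and `(c₀, c)` with `c ∈ g`, which is a
part of the generator of the stabilizer group with index `(c₀, b₀)` if `f` and `g` consist of
neighbours of `c₀` and `b₀`. -/
def crossVec (c₀ : C) (b₀ : B) (f : Finset B) (g : Finset C) : B × B ⊕ C × C → ZMod 2
  | Sum.inl (b, b') => if b ∈ f ∧ b' = b₀ then 1 else 0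
  | Sum.inr (c, c') => if c = c₀ ∧ c' ∈ g then 1 else 0

theorem vsupp_crossVec (c₀ : C) (b₀ : B) (f : Finset B) (g : Finset C) :
    vsupp (crossVec c₀ b₀ f g) = f.image (fun b => Sum.inl (b, b₀)) ∪
      g.image (fun c => Sum.inr (c₀, c)) := by
  ext q
  rw [mem_vsupp, Finset.mem_union, Finset.mem_image, Finset.mem_image]
  rcases q with ⟨b, b'⟩ | ⟨c, c'⟩
  · simp only [crossVec]
    constructor
    · intro h
      left
      by_cases h1 : b ∈ f ∧ b' = b₀
      · exact ⟨b, h1.1, by rw [h1.2]⟩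
      · simp [h1] at h
    · rintro (⟨b1, hb1, h⟩ | ⟨c1, hc1, h⟩)
      · simp only [Sum.inl.injEq, Prod.mk.injEq] at h
        rw [if_pos ⟨h.1 ▸ hb1, h.2.symm⟩]
        exact one_ne_zero
      · cases h
  · simp only [crossVec]
    constructor
    · intro h
      right
      by_cases h1 : c = c₀ ∧ c' ∈ g
      · exact ⟨c', h1.2, by rw [h1.1]⟩
      · simp [h1] at h
    · rintro (⟨b1, hb1, h⟩ | ⟨c1, hc1, h⟩)
      · cases h
      · simp only [Sum.inr.injEq, Prod.mk.injEq] at h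
        rw [if_pos ⟨h.1.symm, h.2 ▸ hc1⟩]
        exact one_ne_zero

theorem hammingNorm_crossVec (c₀ : C) (b₀ : B) (f : Finset B) (g : Finset C) :
    hammingNorm (crossVec c₀ b₀ f g) = f.card + g.card := by
  rw [hammingNorm_eq_card, vsupp_crossVec, Finset.card_union_of_disjoint,
    Finset.card_image_of_injective, Finset.card_image_of_injective]
  · intro c c' h
    simpa using h
  · intro b b' h
    simpa using h
  · rw [Finset.disjoint_left]
    intro q hq hq'
    obtain ⟨b, _, rfl⟩ := Finset.mem_image.1 hq
    obtain ⟨c, _, h⟩ := Finset.mem_image.1 hq'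
    cases h

theorem syndrome_crossVec (H : Matrix C B (ZMod 2)) (c₀ : C) (b₀ : B) (f : Finset B) (g : Finset C)
    (b : B) (c : C) : (hgpZ H H *ᵥ crossVec c₀ b₀ f g) (b, c) =
      (if b ∈ f then H c b₀ else 0) + (if c ∈ g then H c₀ b else 0) := by
  rw [syndrome_hgpZ]
  congr 1
  · rw [Finset.sum_eq_single b₀]
    · simp [crossVec]
    · intro b' _ hb'
      simp [crossVec, hb']
    · simp
  · rw [Finset.sum_eq_single c₀]
    · simp [crossVec]
    · intro c' _ hc'
      simp [crossVec, hc']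
    · simp

theorem hgpX_row (H : Matrix C B (ZMod 2)) (c₀ : C) (b₀ : B) :
    hgpX H H (c₀, b₀) = crossVec c₀ b₀ (nbrs Hᵀ c₀) (nbrs H b₀) := by
  have h01 : ∀ u : ZMod 2, (if u ≠ 0 then (1 : ZMod 2) else 0) = u := by decide
  ext q
  rcases q with ⟨b, b'⟩ | ⟨c, c'⟩
  · simp only [hgpX, Matrix.fromCols_apply_inl, Matrix.kroneckerMap_apply, Matrix.one_apply,
      crossVec, mem_nbrs, Matrix.transpose_apply]
    by_cases h : b' = b₀
    · simpa [h] using (h01 (H c₀ b)).symm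
    · have h' : ¬ b₀ = b' := fun h2 => h h2.symm
      simp [h, h']
  · simp only [hgpX, Matrix.fromCols_apply_inr, Matrix.kroneckerMap_apply, Matrix.one_apply,
      crossVec, mem_nbrs, Matrix.transpose_apply]
    by_cases h : c = c₀
    · simpa [h] using (h01 (H c' b₀)).symm
    · have h' : ¬ c₀ = c := fun h2 => h h2.symm
      simp [h, h']

theorem syndrome_hgpX_row (H : Matrix C B (ZMod 2)) (s : C × B) :
    hgpZ H H *ᵥ hgpX H H s = 0 := by
  obtain ⟨c₀, b₀⟩ := s
  ext ⟨b, c⟩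
  rw [hgpX_row, syndrome_crossVec]
  simp only [mem_nbrs, Matrix.transpose_apply, Pi.zero_apply]
  have : ∀ u v : ZMod 2, (if u ≠ 0 then v else 0) + (if v ≠ 0 then u else 0) = 0 := by decide
  exact this _ _

/-- The effect of a part of a generator on the syndrome. The neighbours of `c₀` are split into `f`,
`f'` and `χ`, those of `b₀` into `g`, `g'` and `χ'`; the flip of `f` and `g` removes the violated
checks in `f × g'` and `f' × g`, and creates at most those in `f × χ'` and `χ × g`. -/
theorem hammingNorm_syndrome_add_crossVec_le {H : Matrix C B (ZMod 2)} {c₀ : C} {b₀ : B}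
    {f f' χ : Finset B} {g g' χ' : Finset C} (hf : f ⊆ nbrs Hᵀ c₀) (hf' : f' ⊆ nbrs Hᵀ c₀)
    (hfχ : nbrs Hᵀ c₀ ⊆ f ∪ f' ∪ χ) (hff' : Disjoint f f')
    (hg : g ⊆ nbrs H b₀) (hg' : g' ⊆ nbrs H b₀) (hgχ : nbrs H b₀ ⊆ g ∪ g' ∪ χ')
    (hgg' : Disjoint g g') {E : B × B ⊕ C × C → ZMod 2}
    (h1 : ∀ b ∈ f, ∀ c ∈ g', (hgpZ H H *ᵥ E) (b, c) ≠ 0)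
    (h2 : ∀ b ∈ f', ∀ c ∈ g, (hgpZ H H *ᵥ E) (b, c) ≠ 0) :
    hammingNorm (hgpZ H H *ᵥ (E + crossVec c₀ b₀ f g)) + f.card * g'.card + f'.card * g.card ≤
      hammingNorm (hgpZ H H *ᵥ E) + f.card * χ'.card + χ.card * g.card := by
  have hsub : vsupp (hgpZ H H *ᵥ (E + crossVec c₀ b₀ f g)) ⊆
      (vsupp (hgpZ H H *ᵥ E) \ (f ×ˢ g' ∪ f' ×ˢ g)) ∪ (f ×ˢ χ' ∪ χ ×ˢ g) := by
    rintro ⟨b, c⟩ hbc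
    rw [mem_vsupp, Matrix.mulVec_add, Pi.add_apply, syndrome_crossVec] at hbc
    simp only [Finset.mem_union, Finset.mem_sdiff, mem_vsupp, Finset.mem_product]
    have hfH : b ∈ f → H c₀ b = 1 := fun h =>
      eq_one_of_ne_zero_zmod_two ((mem_nbrs (H := Hᵀ)).1 (hf h))
    have hf'H : b ∈ f' → H c₀ b = 1 := fun h =>
      eq_one_of_ne_zero_zmod_two ((mem_nbrs (H := Hᵀ)).1 (hf' h))
    have hgH : c ∈ g → H c b₀ = 1 := fun h => eq_one_of_ne_zero_zmod_two (mem_nbrs.1 (hg h))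
    have hg'H : c ∈ g' → H c b₀ = 1 := fun h => eq_one_of_ne_zero_zmod_two (mem_nbrs.1 (hg' h))
    have h11 : (1 : ZMod 2) + 1 = 0 := by decide
    by_cases hbf : b ∈ f <;> by_cases hcg : c ∈ g
    · have hbf' : b ∉ f' := Finset.disjoint_left.1 hff' hbf
      have hcg' : c ∉ g' := Finset.disjoint_left.1 hgg' hcg
      simp only [hbf, hcg, if_true, hfH hbf, hgH hcg, h11, add_zero] at hbc
      exact Or.inl ⟨hbc, by tauto⟩
    · by_cases hcJ : c ∈ nbrs H b₀
      · have := hgχ hcJ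
        simp only [Finset.mem_union] at this
        rcases this with (h | h) | h
        · exact absurd h hcg
        · have hs := eq_one_of_ne_zero_zmod_two (h1 b hbf c h)
          simp [hbf, hcg, hs, hg'H h, h11] at hbc
        · exact Or.inr (Or.inl ⟨hbf, h⟩)
      · have hcg' : c ∉ g' := fun h => hcJ (hg' h)
        have h0 : H c b₀ = 0 := by
          by_contra h
          exact hcJ (mem_nbrs.2 h)
        simp only [hbf, hcg, if_true, if_false, h0, add_zero] at hbc
        exact Or.inl ⟨hbc, by tauto⟩
    · by_cases hbI : b ∈ nbrs Hᵀ c₀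
      · have := hfχ hbI
        simp only [Finset.mem_union] at this
        rcases this with (h | h) | h
        · exact absurd h hbf
        · have hs := eq_one_of_ne_zero_zmod_two (h2 b h c hcg)
          simp [hbf, hcg, hs, hf'H h, h11] at hbc
        · exact Or.inr (Or.inr ⟨h, hcg⟩)
      · have hbf' : b ∉ f' := fun h => hbI (hf' h)
        have h0 : H c₀ b = 0 := by
          by_contra h
          exact hbI ((mem_nbrs (H := Hᵀ)).2 h)
        simp only [hbf, hcg, if_true, if_false, h0, add_zero] at hbc
        exact Or.inl ⟨hbc, by tauto⟩
    · simp only [hbf, hcg, if_false, add_zero] at hbc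
      exact Or.inl ⟨hbc, by tauto⟩
  have hviol : f ×ˢ g' ∪ f' ×ˢ g ⊆ vsupp (hgpZ H H *ᵥ E) := by
    rintro ⟨b, c⟩ hbc
    simp only [Finset.mem_union, Finset.mem_product] at hbc
    rw [mem_vsupp]
    rcases hbc with ⟨hb, hc⟩ | ⟨hb, hc⟩
    exacts [h1 b hb c hc, h2 b hb c hc]
  have hdisj : Disjoint (f ×ˢ g') (f' ×ˢ g) := by
    rw [Finset.disjoint_left]
    rintro ⟨b, c⟩ hbc hbc'
    exact Finset.disjoint_left.1 hff' (Finset.mem_product.1 hbc).1 (Finset.mem_product.1 hbc').1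
  have hc1 := (Finset.card_le_card hsub).trans (Finset.card_union_le _ _)
  have hc2 := Finset.card_union_le (f ×ˢ χ') (χ ×ˢ g)
  have hc3 := Finset.card_sdiff_add_card_eq_card hviol
  rw [Finset.card_union_of_disjoint hdisj] at hc3
  simp only [Finset.card_product] at hc2 hc3
  rw [hammingNorm_eq_card, hammingNorm_eq_card]
  omega

/-- If `a ≤ P` and `B ≤ Q`, the two inequalities of `gain_arith` cannot both fail, because their sum
holds. -/
theorem gain_arith_mixed {A a P B b Q : ℤ} (hP : 0 ≤ P) (hQ : 0 ≤ Q) (haP : a ≤ P) (hBQ : B ≤ Q)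
    (h1 : 2 * P + 1 ≤ A + a) (h2 : 2 * Q + 1 ≤ B + b) :
    A + B + 2 * (A * Q + P * B) ≤ 2 * (A * b + a * B) ∨
      a + b + 2 * (a * Q + P * b) ≤ 2 * (a * B + A * b) := by
  obtain ⟨U, rfl⟩ : ∃ U, a = P - U := ⟨P - a, by ring⟩
  obtain ⟨V, rfl⟩ : ∃ V, B = Q - V := ⟨Q - B, by ring⟩
  obtain ⟨x, rfl⟩ : ∃ x, A = P + 1 + U + x := ⟨A - P - 1 - U, by ring⟩
  obtain ⟨y, rfl⟩ : ∃ y, b = Q + 1 + V + y := ⟨b - Q - 1 - V, by ring⟩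
  have hU : 0 ≤ U := by linarith
  have hV : 0 ≤ V := by linarith
  have hx : 0 ≤ x := by linarith
  have hy : 0 ≤ y := by linarith
  by_contra! h
  have hsum : 0 ≤ (1 + 2 * U + x) * (2 * V + 1) + 2 * y * (P + 1 + U + x) +
      (1 + 2 * V + y) * (2 * U + 1) + 2 * x * (Q + 1 + V + y) := by positivity
  linarith [h.1, h.2]

/-- The arithmetic behind the choice of the flip in a critical generator. Here `A + a + P` and `B +
b + Q` are the numbers of neighbours, with `A` and `B` counting qubits in error, `a` and `b` qubits
without error, and `P` and `Q` the fewer than a third that are not under control. One of the two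
flips (of the qubits in error, or of those without) gains at least half its weight. -/
theorem gain_arith {A a P B b Q : ℤ} (hA : 0 ≤ A) (ha : 0 ≤ a) (hP : 0 ≤ P) (hB : 0 ≤ B)
    (hb : 0 ≤ b) (hQ : 0 ≤ Q) (h1 : 2 * P + 1 ≤ A + a) (h2 : 2 * Q + 1 ≤ B + b) :
    A + B + 2 * (A * Q + P * B) ≤ 2 * (A * b + a * B) ∨
      a + b + 2 * (a * Q + P * b) ≤ 2 * (a * B + A * b) := by
  by_cases haP : a ≤ P <;> by_cases hbQ : b ≤ Q
  · right
    nlinarith [mul_le_mul_of_nonneg_left (show Q + 1 ≤ B by omega) ha,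
      mul_le_mul_of_nonneg_left (show P + 1 ≤ A by omega) hb]
  · by_cases hBQ : B ≤ Q
    · exact gain_arith_mixed hP hQ haP hBQ h1 h2
    · right
      nlinarith [mul_le_mul_of_nonneg_left (show Q + 1 ≤ B by omega) ha,
        mul_le_mul_of_nonneg_left (show P + 1 ≤ A by omega) hb]
  · by_cases hAP : A ≤ P
    · rcases gain_arith_mixed hQ hP hbQ hAP h2 h1 with h | h
      · left; linarith
      · right; linarith
    · right
      nlinarith [mul_le_mul_of_nonneg_left (show Q + 1 ≤ B by omega) ha,
        mul_le_mul_of_nonneg_left (show P + 1 ≤ A by omega) hb]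
  · left
    nlinarith [mul_le_mul_of_nonneg_left (show P + 1 ≤ a by omega) hB,
      mul_le_mul_of_nonneg_left (show Q + 1 ≤ b by omega) hA]

end Expansion

section CriticalGenerator

variable {B C : Type*} [Fintype B] [Fintype C] [DecidableEq B] [DecidableEq C]
  {H : Matrix C B (ZMod 2)} {ΔB ΔC : ℕ} {γ δ : ℝ}

/-- The choice of the column `b₀` of a critical generator: outside a set `χ'` of fewer than a third
of the checks of `b₀`, these checks meet the bit part of the error only in the column `b₀`. -/
theorem exists_critical_column (hB : 0 < ΔB) (hC : 0 < ΔC) (hexp : IsExpander H ΔB ΔC γ δ)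
    (hδ : δ < 1 / 6) {E : B × B ⊕ C × C → ZMod 2} (hE : E ≠ 0)
    (hEB : (hammingNorm E : ℝ) ≤ γ * Fintype.card B) :
    ∃ (b₀ : B) (χ' : Finset C), 3 * χ'.card < ΔB ∧
      (∀ c ∈ nbrs H b₀ \ χ', ∀ b b', H c b' ≠ 0 → E (Sum.inl (b, b')) ≠ 0 → b' = b₀) ∧
      ((∃ b, E (Sum.inl (b, b₀)) ≠ 0) ∨ ∃ c ∈ nbrs H b₀ \ χ', ∃ c₁, E (Sum.inr (c₁, c)) ≠ 0) := by
  classical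
  set U : Finset B := Finset.univ.filter fun b' => ∃ b, E (Sum.inl (b, b')) ≠ 0 with hU
  have hmem : ∀ b', b' ∈ U ↔ ∃ b, E (Sum.inl (b, b')) ≠ 0 := by simp [hU]
  rcases U.eq_empty_or_nonempty with h0 | hne
  · have hEB0 : ∀ b b', E (Sum.inl (b, b')) = 0 := by
      intro b b'
      by_contra h
      have := (hmem b').2 ⟨b, h⟩
      simp [h0] at this
    obtain ⟨q, hq⟩ := Function.ne_iff.1 hE
    rcases q with ⟨b, b'⟩ | ⟨c₁, c⟩
    · exact absurd (hEB0 b b') hq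
    · have hpos : (nbrs Hᵀ c).Nonempty := by
        rw [← Finset.card_pos, card_nbrs, Matrix.transpose_transpose, hexp.check_degree]
        exact hC
      obtain ⟨b₀, hb₀⟩ := hpos
      refine ⟨b₀, ∅, by simpa using hB, fun c _ b b' _ h => absurd (hEB0 b b') h,
        Or.inr ⟨c, ?_, c₁, hq⟩⟩
      rw [Finset.sdiff_empty, mem_nbrs]
      exact (mem_nbrs (H := Hᵀ)).1 hb₀
  · have hcard : U.card ≤ hammingNorm E := by
      have : U ⊆ (vsupp E).image fun q => Sum.elim (fun p => p.2) (fun _ => hne.choose) q := by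
        intro b' hb'
        obtain ⟨b, hb⟩ := (hmem b').1 hb'
        exact Finset.mem_image.2 ⟨Sum.inl (b, b'), mem_vsupp.2 hb, rfl⟩
      exact (Finset.card_le_card this).trans Finset.card_image_le
    obtain ⟨b₀, hb₀, hlt⟩ := exists_few_shared hB hexp.bit_degree hexp.left hδ hne
      ((Nat.cast_le.2 hcard).trans hEB)
    refine ⟨b₀, _, hlt, ?_, Or.inl ((hmem b₀).1 hb₀)⟩
    intro c hc b b' hcb' hbb'
    obtain ⟨hc1, hc2⟩ := Finset.mem_sdiff.1 hc
    by_contra hne'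
    exact hc2 (Finset.mem_filter.2 ⟨Finset.mem_univ _, mem_nbrs.1 hc1, b', (hmem b').2 ⟨b, hbb'⟩,
      hne', hcb'⟩)

/-- Existence of a critical generator: outside of small sets `χ` and `χ'`, the checks of the
generator `(c₀, b₀)` see no other qubits of the error than those of the generator, of which there is
at least one. -/
theorem exists_critical_generator (hB : 0 < ΔB) (hC : 0 < ΔC) (hexp : IsExpander H ΔB ΔC γ δ)
    (hδ : δ < 1 / 6) {E : B × B ⊕ C × C → ZMod 2} (hE : E ≠ 0)
    (hEB : (hammingNorm E : ℝ) ≤ γ * Fintype.card B)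
    (hEC : (hammingNorm E : ℝ) ≤ γ * Fintype.card C) :
    ∃ (c₀ : C) (b₀ : B) (χ : Finset B) (χ' : Finset C), 3 * χ.card < ΔC ∧ 3 * χ'.card < ΔB ∧
      (∀ b ∈ nbrs Hᵀ c₀ \ χ, ∀ c ∈ nbrs H b₀ \ χ',
        (hgpZ H H *ᵥ E) (b, c) = E (Sum.inl (b, b₀)) + E (Sum.inr (c₀, c))) ∧
      ((∃ b ∈ nbrs Hᵀ c₀ \ χ, E (Sum.inl (b, b₀)) ≠ 0) ∨
        ∃ c ∈ nbrs H b₀ \ χ', E (Sum.inr (c₀, c)) ≠ 0) := by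
  classical
  obtain ⟨b₀, χ', hχ', hcol, hor⟩ := exists_critical_column hB hC hexp hδ hE hEB
  have hfirst : ∀ b, ∀ c ∈ nbrs H b₀ \ χ', ∑ b', H c b' * E (Sum.inl (b, b')) =
      E (Sum.inl (b, b₀)) := by
    intro b c hc
    rw [Finset.sum_eq_single b₀]
    · rw [eq_one_of_ne_zero_zmod_two (mem_nbrs.1 (Finset.mem_sdiff.1 hc).1), one_mul]
    · intro b' _ hne
      by_contra h
      exact hne (hcol c hc b b' (left_ne_zero_of_mul h) (right_ne_zero_of_mul h))
    · simp
  set V : Finset C := Finset.univ.filter fun c₁ => ∃ c ∈ nbrs H b₀ \ χ', E (Sum.inr (c₁, c)) ≠ 0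
    with hV
  have hmem : ∀ c₁, c₁ ∈ V ↔ ∃ c ∈ nbrs H b₀ \ χ', E (Sum.inr (c₁, c)) ≠ 0 := by simp [hV]
  rcases V.eq_empty_or_nonempty with h0 | hne
  · have hE0 : ∀ c ∈ nbrs H b₀ \ χ', ∀ c₁, E (Sum.inr (c₁, c)) = 0 := by
      intro c hc c₁
      by_contra h
      have := (hmem c₁).2 ⟨c, hc, h⟩
      simp [h0] at this
    have hb₁ : ∃ b, E (Sum.inl (b, b₀)) ≠ 0 := by
      rcases hor with h | ⟨c, hc, c₁, h⟩
      · exact h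
      · exact absurd (hE0 c hc c₁) h
    obtain ⟨b₁, hb₁⟩ := hb₁
    have hpos : (nbrs H b₁).Nonempty := by
      rw [← Finset.card_pos, card_nbrs, hexp.bit_degree]
      exact hB
    obtain ⟨c₀, hc₀⟩ := hpos
    refine ⟨c₀, b₀, ∅, χ', by simpa using hC, hχ', ?_, Or.inl ⟨b₁, ?_, hb₁⟩⟩
    · intro b _ c hc
      rw [syndrome_hgpZ, hfirst b c hc, hE0 c hc c₀]
      congr 1
      exact Finset.sum_eq_zero fun c' _ => by rw [hE0 c hc c', mul_zero]
    · rw [Finset.sdiff_empty]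
      exact (mem_nbrs (H := Hᵀ)).2 ((mem_nbrs (H := H)).1 hc₀)
  · have hcard : V.card ≤ hammingNorm E := by
      have : V ⊆ (vsupp E).image fun q => Sum.elim (fun _ => hne.choose) (fun p => p.1) q := by
        intro c₁ hc₁
        obtain ⟨c, _, hc⟩ := (hmem c₁).1 hc₁
        exact Finset.mem_image.2 ⟨Sum.inr (c₁, c), mem_vsupp.2 hc, rfl⟩
      exact (Finset.card_le_card this).trans Finset.card_image_le
    obtain ⟨c₀, hc₀, hlt⟩ := exists_few_shared (H := Hᵀ) hC
      (fun c => by rw [Matrix.transpose_transpose]; exact hexp.check_degree c) hexp.right hδ hne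
      ((Nat.cast_le.2 hcard).trans hEC)
    refine ⟨c₀, b₀, _, χ', hlt, hχ', ?_, Or.inr ((hmem c₀).1 hc₀)⟩
    intro b hb c hc
    obtain ⟨hb1, hb2⟩ := Finset.mem_sdiff.1 hb
    have hb1' : H c₀ b ≠ 0 := (mem_nbrs (H := Hᵀ)).1 hb1
    rw [syndrome_hgpZ, hfirst b c hc]
    congr 1
    rw [Finset.sum_eq_single c₀]
    · rw [eq_one_of_ne_zero_zmod_two hb1', one_mul]
    · intro c₁ _ hne'
      by_contra h
      exact hb2 (Finset.mem_filter.2 ⟨Finset.mem_univ _, hb1', c₁,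
        (hmem c₁).2 ⟨c, hc, right_ne_zero_of_mul h⟩, hne', left_ne_zero_of_mul h⟩)
    · simp

/-- A small error that occupies at most half of every generator can be modified within one generator
such that the syndrome weight drops by at least half the number of flipped qubits. -/
theorem exists_good_flip (hB : 0 < ΔB) (hC : 0 < ΔC) (hexp : IsExpander H ΔB ΔC γ δ)
    (hδ : δ < 1 / 6) {E : B × B ⊕ C × C → ZMod 2} (hE : E ≠ 0)
    (hEB : (hammingNorm E : ℝ) ≤ γ * Fintype.card B)
    (hEC : (hammingNorm E : ℝ) ≤ γ * Fintype.card C)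
    (hred : ∀ c₀ b₀, 2 * (((nbrs Hᵀ c₀).filter fun b => E (Sum.inl (b, b₀)) ≠ 0).card +
      ((nbrs H b₀).filter fun c => E (Sum.inr (c₀, c)) ≠ 0).card) ≤ ΔB + ΔC) :
    ∃ F : B × B ⊕ C × C → ZMod 2, 1 ≤ hammingNorm F ∧ hammingNorm F ≤ ΔB + ΔC ∧
      2 * hammingNorm (hgpZ H H *ᵥ (E + F)) + hammingNorm F ≤
        2 * hammingNorm (hgpZ H H *ᵥ E) := by
  classical
  obtain ⟨c₀, b₀, χ, χ', hχ, hχ', hcrit, hor⟩ :=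
    exists_critical_generator hB hC hexp hδ hE hEB hEC
  have hI : (nbrs Hᵀ c₀).card = ΔC := by
    rw [card_nbrs, Matrix.transpose_transpose, hexp.check_degree]
  have hJ : (nbrs H b₀).card = ΔB := by rw [card_nbrs, hexp.bit_degree]
  set x := (nbrs Hᵀ c₀ \ χ).filter fun b => E (Sum.inl (b, b₀)) ≠ 0 with hx
  set x' := (nbrs Hᵀ c₀ \ χ).filter fun b => ¬ E (Sum.inl (b, b₀)) ≠ 0 with hx'
  set y := (nbrs H b₀ \ χ').filter fun c => E (Sum.inr (c₀, c)) ≠ 0 with hy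
  set y' := (nbrs H b₀ \ χ').filter fun c => ¬ E (Sum.inr (c₀, c)) ≠ 0 with hy'
  have hxx : x.card + x'.card = (nbrs Hᵀ c₀ \ χ).card :=
    Finset.card_filter_add_card_filter_not _
  have hyy : y.card + y'.card = (nbrs H b₀ \ χ').card :=
    Finset.card_filter_add_card_filter_not _
  have hIχ : (nbrs Hᵀ c₀).card ≤ (nbrs Hᵀ c₀ \ χ).card + χ.card := by
    have := Finset.le_card_sdiff χ (nbrs Hᵀ c₀)
    omega
  have hJχ : (nbrs H b₀).card ≤ (nbrs H b₀ \ χ').card + χ'.card := by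
    have := Finset.le_card_sdiff χ' (nbrs H b₀)
    omega
  have hxy : 1 ≤ x.card + y.card := by
    rcases hor with ⟨b, hb, hbE⟩ | ⟨c, hc, hcE⟩
    · have : 0 < x.card := Finset.card_pos.2 ⟨b, Finset.mem_filter.2 ⟨hb, hbE⟩⟩
      omega
    · have : 0 < y.card := Finset.card_pos.2 ⟨c, Finset.mem_filter.2 ⟨hc, hcE⟩⟩
      omega
  have hxy' : 1 ≤ x'.card + y'.card := by
    have h1 : x.card ≤ ((nbrs Hᵀ c₀).filter fun b => E (Sum.inl (b, b₀)) ≠ 0).card :=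
      Finset.card_le_card (Finset.filter_subset_filter _ Finset.sdiff_subset)
    have h2 : y.card ≤ ((nbrs H b₀).filter fun c => E (Sum.inr (c₀, c)) ≠ 0).card :=
      Finset.card_le_card (Finset.filter_subset_filter _ Finset.sdiff_subset)
    have h3 := hred c₀ b₀
    omega
  have hxI : x ⊆ nbrs Hᵀ c₀ := (Finset.filter_subset _ _).trans Finset.sdiff_subset
  have hxI' : x' ⊆ nbrs Hᵀ c₀ := (Finset.filter_subset _ _).trans Finset.sdiff_subset
  have hyJ : y ⊆ nbrs H b₀ := (Finset.filter_subset _ _).trans Finset.sdiff_subset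
  have hyJ' : y' ⊆ nbrs H b₀ := (Finset.filter_subset _ _).trans Finset.sdiff_subset
  have hIcov : nbrs Hᵀ c₀ ⊆ x ∪ x' ∪ χ := by
    rw [hx, hx', Finset.filter_union_filter_not_eq]
    intro b hb
    by_cases h : b ∈ χ <;> simp [h, hb]
  have hJcov : nbrs H b₀ ⊆ y ∪ y' ∪ χ' := by
    rw [hy, hy', Finset.filter_union_filter_not_eq]
    intro c hc
    by_cases h : c ∈ χ' <;> simp [h, hc]
  have hdx : Disjoint x x' := Finset.disjoint_filter_filter_not _ _ _
  have hdy : Disjoint y y' := Finset.disjoint_filter_filter_not _ _ _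
  have hv1 : ∀ b ∈ x, ∀ c ∈ y', (hgpZ H H *ᵥ E) (b, c) ≠ 0 := by
    intro b hb c hc
    obtain ⟨hb1, hb2⟩ := Finset.mem_filter.1 hb
    obtain ⟨hc1, hc2⟩ := Finset.mem_filter.1 hc
    rw [not_not] at hc2
    rwa [hcrit b hb1 c hc1, hc2, add_zero]
  have hv2 : ∀ b ∈ x', ∀ c ∈ y, (hgpZ H H *ᵥ E) (b, c) ≠ 0 := by
    intro b hb c hc
    obtain ⟨hb1, hb2⟩ := Finset.mem_filter.1 hb
    obtain ⟨hc1, hc2⟩ := Finset.mem_filter.1 hc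
    rw [not_not] at hb2
    rwa [hcrit b hb1 c hc1, hb2, zero_add]
  have hxle := Finset.card_le_card hxI
  have hxle' := Finset.card_le_card hxI'
  have hyle := Finset.card_le_card hyJ
  have hyle' := Finset.card_le_card hyJ'
  rcases gain_arith (A := x.card) (a := x'.card) (P := χ.card) (B := y.card) (b := y'.card)
    (Q := χ'.card) (by positivity) (by positivity) (by positivity) (by positivity) (by positivity)
    (by positivity) (by omega) (by omega) with h | h
  · refine ⟨crossVec c₀ b₀ x y, ?_, ?_, ?_⟩
    · rw [hammingNorm_crossVec]; exact hxy
    · rw [hammingNorm_crossVec]; omega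
    · have h1 := hammingNorm_syndrome_add_crossVec_le hxI hxI' hIcov hdx hyJ hyJ' hJcov hdy hv1 hv2
      rw [hammingNorm_crossVec]
      norm_cast at h
      linarith
  · refine ⟨crossVec c₀ b₀ x' y', ?_, ?_, ?_⟩
    · rw [hammingNorm_crossVec]; exact hxy'
    · rw [hammingNorm_crossVec]; omega
    · have h1 := hammingNorm_syndrome_add_crossVec_le hxI' hxI
        (by rwa [Finset.union_comm x' x]) hdx.symm hyJ' hyJ (by rwa [Finset.union_comm y' y])
        hdy.symm hv2 hv1
      rw [hammingNorm_crossVec]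
      norm_cast at h
      linarith

/-! ### Confinement in the hypergraph product -/

/-- The stabilizer group: the additive group generated by the rows of a parity-check matrix, which
over `ZMod 2` is their linear span. -/
def rowGroup {Q S : Type*} (A : Matrix S Q (ZMod 2)) : AddSubgroup (Q → ZMod 2) :=
  AddSubgroup.closure (Set.range A)

theorem row_mem_rowGroup {Q S : Type*} (A : Matrix S Q (ZMod 2)) (s : S) : A s ∈ rowGroup A :=
  AddSubgroup.subset_closure ⟨s, rfl⟩

theorem syndrome_eq_zero_of_mem_rowGroup {g : B × B ⊕ C × C → ZMod 2}
    (hg : g ∈ rowGroup (hgpX H H)) : hgpZ H H *ᵥ g = 0 := by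
  induction hg using AddSubgroup.closure_induction with
  | mem x hx =>
    obtain ⟨s, rfl⟩ := hx
    exact syndrome_hgpX_row H s
  | zero => simp
  | add x y _ _ hx hy => rw [Matrix.mulVec_add, hx, hy, add_zero]
  | neg x _ hx => rw [Matrix.mulVec_neg, hx, neg_zero]

theorem hammingNorm_add_inter {Q : Type*} [Fintype Q] [DecidableEq Q] (u v : Q → ZMod 2) :
    hammingNorm (u + v) + 2 * (vsupp u ∩ vsupp v).card = hammingNorm u + hammingNorm v := by
  have h : vsupp (u + v) = (vsupp u ∪ vsupp v) \ (vsupp u ∩ vsupp v) := by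
    ext i
    simp only [mem_vsupp, Finset.mem_sdiff, Finset.mem_union, Finset.mem_inter, Pi.add_apply]
    generalize u i = a
    generalize v i = b
    revert a b
    decide
  have h1 := Finset.card_union_add_card_inter (vsupp u) (vsupp v)
  have h2 := Finset.card_sdiff_add_card_eq_card
    (show vsupp u ∩ vsupp v ⊆ vsupp u ∪ vsupp v from
      Finset.inter_subset_left.trans Finset.subset_union_left)
  rw [← h] at h2
  simp only [hammingNorm_eq_card]
  omega

/-- Confinement for the hypergraph product, by induction on the weight of the syndrome: the weight
of an error modulo stabilizers is at most twice the weight of its syndrome. The second term of the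
hypothesis makes room for the intermediate errors. -/
theorem hgp_confinement (hB : 0 < ΔB) (hC : 0 < ΔC) (hexp : IsExpander H ΔB ΔC γ δ)
    (hδ : δ < 1 / 6) {Γ : ℝ} (hΓB : Γ ≤ γ * Fintype.card B) (hΓC : Γ ≤ γ * Fintype.card C) (k : ℕ) :
    ∀ E : B × B ⊕ C × C → ZMod 2, hammingNorm (hgpZ H H *ᵥ E) = k →
      ((hammingNorm E + (ΔB + ΔC) * k : ℕ) : ℝ) ≤ Γ →
      ∃ g ∈ rowGroup (hgpX H H), hammingNorm (E + g) ≤ 2 * k := by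
  induction k using Nat.strong_induction_on with
  | _ k ih =>
    intro E hEk hEΓ
    obtain ⟨g, hg, hmin⟩ := exists_minimal_representative (rowGroup (hgpX H H)) E
    set E' := E + g with hE'
    have hsyn : hgpZ H H *ᵥ E' = hgpZ H H *ᵥ E := by
      rw [hE', Matrix.mulVec_add, syndrome_eq_zero_of_mem_rowGroup hg, add_zero]
    have hle : hammingNorm E' ≤ hammingNorm E := by
      have h := hmin g hg
      rwa [hE', add_assoc, add_self_zmod_two, add_zero] at h
    by_cases h0 : E' = 0
    · exact ⟨g, hg, by rw [← hE', h0]; simp⟩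
    have hE'Γ : (hammingNorm E' : ℝ) ≤ Γ := by
      refine le_trans ?_ hEΓ
      exact_mod_cast hle.trans (Nat.le_add_right _ _)
    have hred : ∀ c₀ b₀, 2 * (((nbrs Hᵀ c₀).filter fun b => E' (Sum.inl (b, b₀)) ≠ 0).card +
        ((nbrs H b₀).filter fun c => E' (Sum.inr (c₀, c)) ≠ 0).card) ≤ ΔB + ΔC := by
      intro c₀ b₀
      have h1 := hmin _ (row_mem_rowGroup (hgpX H H) (c₀, b₀))
      have h2 := hammingNorm_add_inter E' (hgpX H H (c₀, b₀))
      have h3 : hammingNorm (hgpX H H (c₀, b₀)) = ΔC + ΔB := by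
        rw [hgpX_row, hammingNorm_crossVec, card_nbrs, card_nbrs, Matrix.transpose_transpose,
          hexp.check_degree, hexp.bit_degree]
      have h4 : vsupp (crossVec c₀ b₀ ((nbrs Hᵀ c₀).filter fun b => E' (Sum.inl (b, b₀)) ≠ 0)
          ((nbrs H b₀).filter fun c => E' (Sum.inr (c₀, c)) ≠ 0)) ⊆
          vsupp E' ∩ vsupp (hgpX H H (c₀, b₀)) := by
        rw [hgpX_row, vsupp_crossVec, vsupp_crossVec]
        intro q hq
        simp only [Finset.mem_union, Finset.mem_image, Finset.mem_filter] at hq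
        rw [Finset.mem_inter, mem_vsupp, Finset.mem_union, Finset.mem_image, Finset.mem_image]
        rcases hq with ⟨b, ⟨hb, hbE⟩, rfl⟩ | ⟨c, ⟨hc, hcE⟩, rfl⟩
        · exact ⟨hbE, Or.inl ⟨b, hb, rfl⟩⟩
        · exact ⟨hcE, Or.inr ⟨c, hc, rfl⟩⟩
      have h5 := Finset.card_le_card h4
      rw [← hammingNorm_eq_card, hammingNorm_crossVec] at h5
      omega
    obtain ⟨F, hF1, hF2, hF3⟩ := exists_good_flip hB hC hexp hδ h0 (hE'Γ.trans hΓB)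
      (hE'Γ.trans hΓC) hred
    rw [hsyn, hEk] at hF3
    obtain ⟨g', hg', hg'le⟩ := ih _ (by omega : hammingNorm (hgpZ H H *ᵥ (E' + F)) < k) (E' + F) rfl
      (by
        refine le_trans ?_ hEΓ
        rw [Nat.cast_le]
        have h1 := hammingNorm_add_le E' F
        have h2 : hammingNorm (hgpZ H H *ᵥ (E' + F)) + 1 ≤ k := by omega
        have h3 := Nat.mul_le_mul_left (ΔB + ΔC) h2
        rw [mul_add, mul_one] at h3
        omega)
    refine ⟨g + g', (rowGroup (hgpX H H)).add_mem hg hg', ?_⟩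
    have h1 : E + (g + g') = (E' + F + g') + F := by
      rw [hE']
      calc E + (g + g') = E + g + g' + (F + F) := by rw [add_self_zmod_two]; abel
        _ = _ := by abel
    have h2 := hammingNorm_add_le (E' + F + g') F
    rw [← h1] at h2
    omega

end CriticalGenerator

/-! ### The hypergraph product is confined -/

section Degrees

variable {Q S : Type*} [Fintype Q] [Fintype S] [DecidableEq Q] [DecidableEq S]

/-- In terms of the Tanner graph: a qubit has at most `D (W - 1)` neighbours if every qubit is in at
most `D` checks and every check has weight at most `W`. -/
theorem card_neighbours_le {A : Matrix S Q (ZMod 2)} {D W : ℕ} (hD : ∀ i, hammingNorm (Aᵀ i) ≤ D)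
    (hW : ∀ s, hammingNorm (A s) ≤ W) (a : Q) (U : Finset Q)
    (hU : ∀ b ∈ U, b ≠ a ∧ sharesCheck A a b) : U.card ≤ D * (W - 1) := by
  have hsub : U ⊆ (vsupp (Aᵀ a)).biUnion fun s => (vsupp (A s)).erase a := by
    intro b hb
    obtain ⟨hba, s, hsa, hsb⟩ := hU b hb
    exact Finset.mem_biUnion.2 ⟨s, mem_vsupp.2 hsa, Finset.mem_erase.2 ⟨hba, mem_vsupp.2 hsb⟩⟩
  refine (Finset.card_le_card hsub).trans
    ((Finset.card_biUnion_le_card_mul _ _ (W - 1) ?_).trans ?_)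
  · intro s hs
    have hsa : Aᵀ a s ≠ 0 := mem_vsupp.1 hs
    have has : a ∈ vsupp (A s) := mem_vsupp.2 hsa
    rw [Finset.card_erase_of_mem has, ← hammingNorm_eq_card]
    exact Nat.sub_le_sub_right (hW s) 1
  · rw [← hammingNorm_eq_card]
    exact Nat.mul_le_mul_right _ (hD a)

theorem hammingNorm_mulVec_le {A : Matrix S Q (ZMod 2)} {D : ℕ} (hD : ∀ i, hammingNorm (Aᵀ i) ≤ D)
    (E : Q → ZMod 2) : hammingNorm (A *ᵥ E) ≤ D * hammingNorm E := by
  have hsub : vsupp (A *ᵥ E) ⊆ (vsupp E).biUnion fun i => vsupp (Aᵀ i) := by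
    intro s hs
    have hsum : (A *ᵥ E) s ≠ 0 := mem_vsupp.1 hs
    obtain ⟨i, hi, hsi⟩ := Finset.exists_ne_zero_of_sum_ne_zero hsum
    exact Finset.mem_biUnion.2 ⟨i, mem_vsupp.2 (right_ne_zero_of_mul hsi),
      mem_vsupp.2 (left_ne_zero_of_mul hsi)⟩
  rw [hammingNorm_eq_card, hammingNorm_eq_card, mul_comm]
  refine (Finset.card_le_card hsub).trans (Finset.card_biUnion_le_card_mul _ _ D fun i _ => ?_)
  rw [← hammingNorm_eq_card]
  exact hD i

theorem hammingNorm_comp_equiv {Q' : Type*} [Fintype Q'] [DecidableEq Q'] (e : Q' ≃ Q)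
    (x : Q → ZMod 2) : hammingNorm (fun q => x (e q)) = hammingNorm x := by
  rw [hammingNorm_eq_card, hammingNorm_eq_card]
  exact Finset.card_bij (fun q _ => e q)
    (fun q hq => (mem_vsupp (v := x)).2 ((mem_vsupp (v := fun q => x (e q))).1 hq))
    (fun _ _ _ _ h => e.injective h)
    (fun q hq => ⟨e.symm q, by rw [mem_vsupp, e.apply_symm_apply]; exact mem_vsupp.1 hq,
      e.apply_symm_apply q⟩)

/-- Confinement does not depend on the names of the qubits and checks. -/
theorem Confined.submatrix {Q' S' : Type*} [Fintype Q'] [Fintype S'] [DecidableEq Q']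
    [DecidableEq S'] {A : Matrix S Q (ZMod 2)} {G : AddSubgroup (Q → ZMod 2)} {z D M : ℕ}
    (hA : Confined A G z D M) (eS : S' ≃ S) (eQ : Q' ≃ Q) :
    Confined (A.submatrix eS eQ)
      (G.comap (LinearMap.funLeft (ZMod 2) (ZMod 2) eQ.symm).toAddMonoidHom) z D M := by
  have hsyn : ∀ E : Q' → ZMod 2, A.submatrix eS eQ *ᵥ E =
      fun s => (A *ᵥ fun q => E (eQ.symm q)) (eS s) := fun E =>
    Matrix.submatrix_mulVec_equiv A E eS eQ
  have hback : ∀ E : Q → ZMod 2, (fun q => (fun q' => E (eQ q')) (eQ.symm q)) = E := fun E => by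
    simp
  refine ⟨?_, ?_, ?_, ?_, ?_⟩
  · intro g hg
    have h := hA.ker _ hg
    rw [hsyn]
    ext s
    exact congrFun h (eS s)
  · intro a U hU
    rw [← Finset.card_map eQ.toEmbedding]
    refine hA.neighbours (eQ a) _ fun b hb => ?_
    obtain ⟨b', hb', rfl⟩ := Finset.mem_map.1 hb
    obtain ⟨hne, s, hs⟩ := hU b' hb'
    exact ⟨fun h => hne (eQ.injective h), eS s, hs⟩
  · intro i
    exact (hammingNorm_comp_equiv eS (Aᵀ (eQ i))).trans_le (hA.column _)
  · intro E hE
    obtain ⟨g, hg, hle⟩ := hA.confinement (fun q => E (eQ.symm q)) (by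
      rwa [hammingNorm_comp_equiv eQ.symm])
    refine ⟨fun q => g (eQ q), ?_, ?_⟩
    · change (fun q => (fun q' => g (eQ q')) (eQ.symm q)) ∈ G
      rwa [hback]
    · rw [hsyn, hammingNorm_comp_equiv eS]
      refine le_trans (le_of_eq ?_) hle
      rw [← hammingNorm_comp_equiv eQ]
      congr 1
      ext q
      simp
  · obtain ⟨L, hL, hLG⟩ := hA.logical
    refine ⟨fun q => L (eQ q), ?_, fun h => hLG ?_⟩
    · rw [hsyn, hback, hL]
      rfl
    · rw [← hback L]
      exact h

end Degrees

section Product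

variable {B C : Type*} [Fintype B] [Fintype C] [DecidableEq B] [DecidableEq C]
  {H : Matrix C B (ZMod 2)} {ΔB ΔC : ℕ} {γ δ : ℝ}

theorem hammingNorm_hgpZ_row (H : Matrix C B (ZMod 2)) (b : B) (c : C) :
    hammingNorm (hgpZ H H (b, c)) ≤ hammingNorm (H c) + hammingNorm (Hᵀ b) := by
  have hsub : vsupp (hgpZ H H (b, c)) ⊆
      (vsupp (H c)).image (fun b' => (Sum.inl (b, b') : B × B ⊕ C × C)) ∪
        (vsupp (Hᵀ b)).image fun c' => Sum.inr (c', c) := by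
    rintro (⟨b₁, b₂⟩ | ⟨c₁, c₂⟩) hq
    · rw [mem_vsupp] at hq
      have hq : (1 : Matrix B B (ZMod 2)) b b₁ * H c b₂ ≠ 0 := hq
      have h1 : b = b₁ := by
        by_contra h
        exact hq (by rw [Matrix.one_apply_ne h, zero_mul])
      subst h1
      exact Finset.mem_union_left _ (Finset.mem_image.2
        ⟨b₂, mem_vsupp.2 (right_ne_zero_of_mul hq), rfl⟩)
    · rw [mem_vsupp] at hq
      have hq : Hᵀ b c₁ * (1 : Matrix C C (ZMod 2)) c c₂ ≠ 0 := hq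
      have h1 : c = c₂ := by
        by_contra h
        exact hq (by rw [Matrix.one_apply_ne h, mul_zero])
      subst h1
      exact Finset.mem_union_right _ (Finset.mem_image.2
        ⟨c₁, mem_vsupp.2 (left_ne_zero_of_mul hq), rfl⟩)
  rw [hammingNorm_eq_card, hammingNorm_eq_card, hammingNorm_eq_card]
  exact (Finset.card_le_card hsub).trans ((Finset.card_union_le _ _).trans
    (Nat.add_le_add Finset.card_image_le Finset.card_image_le))

theorem hammingNorm_hgpZ_column (H : Matrix C B (ZMod 2)) {D : ℕ} (hB : ∀ b, hammingNorm (Hᵀ b) ≤ D)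
    (hC : ∀ c, hammingNorm (H c) ≤ D) (q : B × B ⊕ C × C) : hammingNorm ((hgpZ H H)ᵀ q) ≤ D := by
  rcases q with ⟨b₁, b₂⟩ | ⟨c₁, c₂⟩
  · have hsub : vsupp ((hgpZ H H)ᵀ (Sum.inl (b₁, b₂))) ⊆
        (vsupp (Hᵀ b₂)).image fun c => (b₁, c) := by
      rintro ⟨b, c⟩ hq
      rw [mem_vsupp] at hq
      have hq : (1 : Matrix B B (ZMod 2)) b b₁ * H c b₂ ≠ 0 := hq
      have h1 : b = b₁ := by
        by_contra h
        exact hq (by rw [Matrix.one_apply_ne h, zero_mul])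
      subst h1
      exact Finset.mem_image.2 ⟨c, mem_vsupp.2 (right_ne_zero_of_mul hq), rfl⟩
    refine le_trans ?_ (hB b₂)
    rw [hammingNorm_eq_card, hammingNorm_eq_card]
    exact (Finset.card_le_card hsub).trans Finset.card_image_le
  · have hsub : vsupp ((hgpZ H H)ᵀ (Sum.inr (c₁, c₂))) ⊆
        (vsupp (H c₁)).image fun b => (b, c₂) := by
      rintro ⟨b, c⟩ hq
      rw [mem_vsupp] at hq
      have hq : Hᵀ b c₁ * (1 : Matrix C C (ZMod 2)) c c₂ ≠ 0 := hq
      have h1 : c = c₂ := by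
        by_contra h
        exact hq (by rw [Matrix.one_apply_ne h, mul_zero])
      subst h1
      exact Finset.mem_image.2 ⟨b, mem_vsupp.2 (left_ne_zero_of_mul hq), rfl⟩
    refine le_trans ?_ (hC c₁)
    rw [hammingNorm_eq_card, hammingNorm_eq_card]
    exact (Finset.card_le_card hsub).trans Finset.card_image_le

/-- A logical operator: a codeword `u` of the classical code, placed in a row `b` with `u b ≠ 0`. It
is not in the span of the rows of `H_X` because these are orthogonal to `u` placed in the column
`b`. -/
theorem exists_logical (H : Matrix C B (ZMod 2)) (hCB : Fintype.card C < Fintype.card B) :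
    ∃ L, hgpZ H H *ᵥ L = 0 ∧ L ∉ rowGroup (hgpX H H) := by
  obtain ⟨u, hu, hu0⟩ : ∃ u : B → ZMod 2, H *ᵥ u = 0 ∧ u ≠ 0 := by
    have h : LinearMap.ker H.mulVecLin ≠ ⊥ :=
      LinearMap.ker_ne_bot_of_finrank_lt (by simpa using hCB)
    obtain ⟨u, hu, hu0⟩ := (Submodule.ne_bot_iff _).1 h
    exact ⟨u, hu, hu0⟩
  obtain ⟨b, hb⟩ := Function.ne_iff.1 hu0
  refine ⟨Sum.elim (fun q => if q.1 = b then u q.2 else 0) fun _ => 0, ?_, fun hL => ?_⟩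
  · ext ⟨b₁, c⟩
    rw [syndrome_hgpZ]
    by_cases h : b₁ = b
    · have := congrFun hu c
      simpa [h, Matrix.mulVec, dotProduct] using this
    · simp [h]
  · have hvan : ∀ g ∈ rowGroup (hgpX H H), ∑ b₁, u b₁ * g (Sum.inl (b₁, b)) = 0 := by
      intro g hg
      induction hg using AddSubgroup.closure_induction with
      | mem x hx =>
        obtain ⟨⟨c, b'⟩, rfl⟩ := hx
        have h1 : ∀ b₁, u b₁ * hgpX H H (c, b') (Sum.inl (b₁, b)) =
            H c b₁ * u b₁ * (1 : Matrix B B (ZMod 2)) b' b := fun b₁ => by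
          change u b₁ * (H c b₁ * (1 : Matrix B B (ZMod 2)) b' b) = _
          ring
        rw [Finset.sum_congr rfl fun b₁ _ => h1 b₁, ← Finset.sum_mul]
        have h2 : ∑ b₁, H c b₁ * u b₁ = 0 := congrFun hu c
        rw [h2, zero_mul]
      | zero => simp
      | add x y _ _ hx hy =>
        simp only [Pi.add_apply, mul_add, Finset.sum_add_distrib, hx, hy, add_zero]
      | neg x _ hx => simp only [Pi.neg_apply, mul_neg, Finset.sum_neg_distrib, hx, neg_zero]
    have h := hvan _ hL
    simp only [Sum.elim_inl, mul_ite, mul_zero, Finset.sum_ite_eq', Finset.mem_univ, if_true] at h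
    exact hb (mul_self_eq_zero.1 h)

/-- Errors whose weight, with the room needed by `hgp_confinement`, is within the expansion radius
are confined. -/
theorem confined_hgpZ (hB : 0 < ΔB) (hBC : ΔB < ΔC) (hexp : IsExpander H ΔB ΔC γ δ) (hδ : δ < 1 / 6)
    (hγ : 0 < γ) (hCB : Fintype.card C < Fintype.card B) {M : ℕ}
    (hM : ((M + (ΔB + ΔC) * (ΔC * M) : ℕ) : ℝ) ≤ γ * Fintype.card C) :
    Confined (hgpZ H H) (rowGroup (hgpX H H)) (ΔC * (ΔB + ΔC - 1)) ΔC M where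
  ker g hg := syndrome_eq_zero_of_mem_rowGroup hg
  column := hammingNorm_hgpZ_column H (fun b => (hexp.bit_degree b).trans_le hBC.le)
    fun c => (hexp.check_degree c).le
  neighbours a U hU := by
    refine card_neighbours_le (W := ΔB + ΔC) (hammingNorm_hgpZ_column H
      (fun b => (hexp.bit_degree b).trans_le hBC.le) fun c => (hexp.check_degree c).le) ?_ a U hU
    rintro ⟨b, c⟩
    refine (hammingNorm_hgpZ_row H b c).trans ?_
    rw [hexp.bit_degree, hexp.check_degree, add_comm]
  confinement E hE := by
    have hcol := hammingNorm_mulVec_le (hammingNorm_hgpZ_column H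
      (fun b => (hexp.bit_degree b).trans_le hBC.le) fun c => (hexp.check_degree c).le) E
    have hle : γ * (Fintype.card C : ℝ) ≤ γ * Fintype.card B := by
      have : (Fintype.card C : ℝ) ≤ Fintype.card B := by exact_mod_cast hCB.le
      exact mul_le_mul_of_nonneg_left this hγ.le
    refine hgp_confinement hB (hB.trans hBC) hexp hδ hle le_rfl _ E rfl (le_trans ?_ hM)
    rw [Nat.cast_le]
    exact Nat.add_le_add hE (Nat.mul_le_mul_left _ (hcol.trans (Nat.mul_le_mul_left _ hE)))
  logical := exists_logical H hCB

/-- The two parity-check matrices differ by the exchange of the two factors of the product. -/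
theorem hgpX_eq_submatrix (H : Matrix C B (ZMod 2)) :
    hgpX H H = (hgpZ H H).submatrix (Equiv.prodComm C B)
      (Equiv.sumCongr (Equiv.prodComm B B) (Equiv.prodComm C C)) := by
  ext ⟨c, b⟩ q
  rcases q with ⟨b₁, b₂⟩ | ⟨c₁, c₂⟩
  · exact mul_comm (H c b₁) ((1 : Matrix B B (ZMod 2)) b b₂)
  · exact mul_comm ((1 : Matrix C C (ZMod 2)) c c₁) (H c₂ b)

end Product

/-! ### Parameters -/

section Parameters

variable {B C : Type*} [Fintype B] [Fintype C] [DecidableEq B] [DecidableEq C]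
  {H : Matrix C B (ZMod 2)} {ΔB ΔC : ℕ} {γ δ : ℝ}

theorem IsExpander.card_mul_eq (hexp : IsExpander H ΔB ΔC γ δ) :
    Fintype.card B * ΔB = Fintype.card C * ΔC := by
  have h := Finset.sum_card_bipartiteAbove_eq_sum_card_bipartiteBelow
    (s := (Finset.univ : Finset B)) (t := (Finset.univ : Finset C)) fun b c => H c b ≠ 0
  have h1 : ∀ b, (Finset.univ.bipartiteAbove (fun b c => H c b ≠ 0) b).card = ΔB := fun b =>
    hexp.bit_degree b
  have h2 : ∀ c, (Finset.univ.bipartiteBelow (fun b c => H c b ≠ 0) c).card = ΔC := fun c =>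
    hexp.check_degree c
  simpa [h1, h2] using h

/-- Bits of degree one do not expand: two bits of the same check have only one neighbour. -/
theorem IsExpander.two_le_bit_degree (hexp : IsExpander H ΔB ΔC γ δ) (hδ : δ < 1 / 6) (hB : 0 < ΔB)
    (hC : 1 < ΔC) [Nonempty C] (hγ : 2 ≤ γ * Fintype.card B) : 2 ≤ ΔB := by
  by_contra hlt
  have hB1 : ΔB = 1 := by omega
  obtain ⟨c⟩ := ‹Nonempty C›
  have hc := hexp.check_degree c
  rw [hammingNorm_eq_card] at hc
  obtain ⟨b, hb, b', hb', hne⟩ := Finset.one_lt_card.1 (hc.symm ▸ hC : 1 < (vsupp (H c)).card)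
  have hone : ∀ b ∈ vsupp (H c), ∀ c', H c' b ≠ 0 → c' = c := by
    intro b hb c' hc'
    have h1 := hexp.bit_degree b
    rw [hB1, hammingNorm_eq_card] at h1
    exact Finset.card_le_one.1 h1.le c' ((mem_vsupp (v := Hᵀ b)).2 hc') c
      ((mem_vsupp (v := Hᵀ b)).2 ((mem_vsupp (v := H c)).1 hb))
  have hbd : boundary H {b, b'} ⊆ {c} := by
    intro c' hc'
    simp only [boundary, Finset.mem_biUnion, Finset.mem_filter, Finset.mem_insert,
      Finset.mem_singleton] at hc' ⊢
    obtain ⟨b₁, rfl | rfl, -, h⟩ := hc'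
    · exact hone _ hb _ h
    · exact hone _ hb' _ h
  have hcard : ((({b, b'} : Finset B).card : ℕ) : ℝ) = 2 := by
    rw [Finset.card_pair hne]
    norm_num
  have h1 := hexp.left {b, b'} (by rw [hcard]; exact hγ)
  have h2 : ((boundary H {b, b'}).card : ℝ) ≤ 1 := by
    exact_mod_cast Finset.card_le_card hbd
  rw [hcard, hB1] at h1
  push_cast at h1
  linarith

/-- The Peierls condition holds above the threshold `3 log (2 z)`. -/
theorem exp_neg_half_le {β : ℝ} {z : ℕ} (hz : 12 ≤ z) (hβ : 3 * Real.log (2 * z) < β) :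
    Real.exp (-β / 2) ≤ 1 / (9 * z) := by
  have hz' : (12 : ℝ) ≤ z := by exact_mod_cast hz
  have hlog : Real.exp (3 * Real.log (2 * z)) = (2 * z : ℝ) ^ 3 := by
    rw [← Real.exp_log (show (0 : ℝ) < (2 * z) ^ 3 by positivity), Real.log_pow]
    norm_num
  have hsq : Real.exp (-β / 2) ^ 2 = Real.exp (-β) := by
    rw [← Real.exp_nat_mul]
    congr 1
    push_cast
    ring
  refine (sq_le_sq₀ (Real.exp_pos _).le (by positivity)).1 ?_
  calc Real.exp (-β / 2) ^ 2 = (Real.exp β)⁻¹ := by rw [hsq, Real.exp_neg]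
    _ ≤ ((2 * z : ℝ) ^ 3)⁻¹ := by
      rw [← hlog]
      gcongr
    -- `81 z ^ 2 ≤ 8 z ^ 3` because `z ≥ 12`
    _ ≤ ((9 * z : ℝ) ^ 2)⁻¹ := by
      gcongr
      nlinarith [mul_nonneg (sq_nonneg (z : ℝ)) (sub_nonneg.2 hz')]
    _ = (1 / (9 * z : ℝ)) ^ 2 := by rw [one_div, inv_pow]

/-- The choice of the parameters of the Peierls argument: an error weight `M` within the confinement
radius and a polymer size `r`, both proportional to `√N`. -/
theorem exists_parameters (hB : 0 < ΔB) (hC : 0 < ΔC) (hγ : 0 < γ) :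
    ∃ α : ℝ, 0 < α ∧ ∃ N₀ : ℕ, ∀ n m N : ℕ, m < n → n * ΔB = m * ΔC → N = n ^ 2 + m ^ 2 → N₀ ≤ N →
      2 ≤ γ * n ∧ ∃ M r : ℕ, ((M + (ΔB + ΔC) * (ΔC * M) : ℕ) : ℝ) ≤ γ * m ∧ ΔC * r + 1 ≤ M ∧ r ≤ M ∧
        N * (2 / 3 : ℝ) ^ (r + 1) ≤ 1 / 2 ∧
        Real.exp (α * √(N : ℝ)) * (24 * (N * (2 / 3 : ℝ) ^ (r + 1))) ≤ 1 := by
  have hCR : (1 : ℝ) ≤ ΔC := by exact_mod_cast hC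
  have hBR : (1 : ℝ) ≤ ΔB := by exact_mod_cast hB
  set K : ℝ := 1 + (ΔB + ΔC) * ΔC with hK
  have hKpos : 0 < K := by positivity
  -- `γ m / K ≥ c √N`, because `N ≤ 2 n ^ 2` and `n ≤ m ΔC`
  set c : ℝ := γ / (2 * K * ΔC) with hc
  have hcpos : 0 < c := by positivity
  set α : ℝ := c / (12 * ΔC) with hα
  have hαpos : 0 < α := by positivity
  refine ⟨α, hαpos, ⌈(2 / c + 144 / α ^ 3 + 4 / γ) ^ 2⌉₊, fun n m N hmn hedge hN hN₀ => ?_⟩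
  set x : ℝ := √(N : ℝ) with hx
  have hxX : 2 / c + 144 / α ^ 3 + 4 / γ ≤ x := Real.le_sqrt_of_sq_le (Nat.ceil_le.1 hN₀)
  have hp1 : 0 < 2 / c := by positivity
  have hp2 : 0 < 144 / α ^ 3 := by positivity
  have hp3 : 0 < 4 / γ := by positivity
  have hx0 : 0 < x := by linarith
  have hx1 : 2 ≤ c * x := by
    have : 2 / c ≤ x := by linarith
    rwa [div_le_iff₀ hcpos, mul_comm] at this
  have hx2 : 144 ≤ α ^ 3 * x := by
    have : 144 / α ^ 3 ≤ x := by linarith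
    rwa [div_le_iff₀ (by positivity), mul_comm] at this
  have hx3 : 4 ≤ γ * x := by
    have : 4 / γ ≤ x := by linarith
    rwa [div_le_iff₀ hγ, mul_comm] at this
  have hxN : x ^ 2 = N := Real.sq_sqrt (Nat.cast_nonneg N)
  have hmnR : (m : ℝ) ≤ n := by exact_mod_cast hmn.le
  have hm0 : (0 : ℝ) ≤ m := Nat.cast_nonneg m
  have hNR : (N : ℝ) = n ^ 2 + m ^ 2 := by exact_mod_cast hN
  have hxn : x ≤ 2 * n := by
    refine Real.sqrt_le_iff.2 ⟨by positivity, ?_⟩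
    rw [hNR]
    nlinarith
  have hnm : (n : ℝ) ≤ m * ΔC := by
    have : (n : ℝ) * ΔB = m * ΔC := by exact_mod_cast hedge
    rw [← this]
    exact le_mul_of_one_le_right (Nat.cast_nonneg n) hBR
  refine ⟨by nlinarith, ⌊γ * m / K⌋₊, (⌊γ * m / K⌋₊ - 1) / ΔC, ?_⟩
  set M := ⌊γ * m / K⌋₊ with hM
  have hMle : (M : ℝ) ≤ γ * m / K := Nat.floor_le (by positivity)
  have hMlt : γ * m / K < M + 1 := Nat.lt_floor_add_one _
  have hcx : c * x ≤ γ * m / K := by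
    calc c * x ≤ c * (2 * (m * ΔC)) := by gcongr; linarith
      _ = γ * m / K := by rw [hc]; field_simp
  have hM1 : 1 ≤ M := by
    have : (1 : ℝ) < M + 1 := by linarith
    have : (0 : ℝ) < M := by linarith
    exact_mod_cast this
  have hr := Nat.div_mul_le_self (M - 1) ΔC
  have hr' := Nat.lt_mul_div_succ (M - 1) hC
  set r := (M - 1) / ΔC
  have hMr : (M : ℝ) ≤ ΔC * (r + 1) := by
    have : M ≤ ΔC * (r + 1) := by omega
    exact_mod_cast this
  -- The polymer size `r` is proportional to `√N`, with room for the polynomial factor `24 N`.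
  have hrx : 6 * (α * x) ≤ r + 1 := by
    have h1 : 6 * (α * x) * ΔC = c * x / 2 := by rw [hα]; field_simp; norm_num
    have h2 : 6 * (α * x) * ΔC ≤ (r + 1) * ΔC := by rw [h1]; linarith
    exact le_of_mul_le_mul_right h2 (by linarith)
  have hpow : (2 / 3 : ℝ) ^ (r + 1) ≤ Real.exp (-(2 * (α * x))) := by
    have h1 : (2 / 3 : ℝ) ≤ Real.exp (-(1 / 3)) := by
      have := Real.add_one_le_exp (-(1 / 3) : ℝ)
      linarith
    calc (2 / 3 : ℝ) ^ (r + 1) ≤ Real.exp (-(1 / 3)) ^ (r + 1) := by gcongr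
      _ = Real.exp (-((r + 1) / 3)) := by
        rw [← Real.exp_nat_mul]
        congr 1
        push_cast
        ring
      _ ≤ Real.exp (-(2 * (α * x))) := Real.exp_le_exp.2 (by linarith)
  have hexp24 : 24 * (N : ℝ) ≤ Real.exp (α * x) := by
    have h1 := Real.pow_div_factorial_le_exp (α * x) (by positivity) 3
    have h2 : (24 : ℝ) * N ≤ (α * x) ^ 3 / (Nat.factorial 3 : ℕ) := by
      rw [← hxN, show ((Nat.factorial 3 : ℕ) : ℝ) = 6 by norm_num [Nat.factorial],
        le_div_iff₀ (by norm_num)]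
      calc 24 * x ^ 2 * 6 = 144 * x ^ 2 := by ring
        _ ≤ α ^ 3 * x * x ^ 2 := by gcongr
        _ = (α * x) ^ 3 := by ring
    exact h2.trans h1
  have hmain : 24 * (N * (2 / 3 : ℝ) ^ (r + 1)) ≤ Real.exp (-(α * x)) := by
    calc 24 * (N * (2 / 3 : ℝ) ^ (r + 1)) = 24 * N * (2 / 3 : ℝ) ^ (r + 1) := by ring
      _ ≤ Real.exp (α * x) * Real.exp (-(2 * (α * x))) := by gcongr
      _ = Real.exp (-(α * x)) := by
        rw [← Real.exp_add]
        congr 1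
        ring
  refine ⟨?_, ?_, ?_, ?_, ?_⟩
  · push_cast
    calc (M : ℝ) + (ΔB + ΔC) * (ΔC * M) = M * K := by rw [hK]; ring
      _ ≤ γ * m := (le_div_iff₀ hKpos).1 hMle
  · rw [mul_comm] at hr
    omega
  · exact (Nat.div_le_self _ _).trans (Nat.sub_le _ _)
  · have : Real.exp (-(α * x)) ≤ 1 := Real.exp_le_one_iff.2 (by linarith [mul_pos hαpos hx0])
    linarith
  · calc Real.exp (α * x) * (24 * (N * (2 / 3 : ℝ) ^ (r + 1))) ≤
        Real.exp (α * x) * Real.exp (-(α * x)) := by gcongr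
      _ = 1 := by rw [← Real.exp_add, add_neg_cancel, Real.exp_zero]

end Parameters

end GibbsHGP

end

theorem mainTheorem1 (ΔB ΔC : ℕ) (hB : 0 < ΔB) (hBC : ΔB < ΔC) (γ δ : ℝ) (hγ : 0 < γ)
    (hδ : δ < 1 / 6) :
    ∃ βc : ℝ, 0 ≤ βc ∧ βc ≤ 3 * Real.log (2 * ((ΔC : ℝ) * ((ΔB : ℝ) + (ΔC : ℝ) - 1))) ∧
      ∀ β : ℝ, βc < β → ∃ α : ℝ, 0 < α ∧ ∃ N₀ : ℕ,
        ∀ (n m : ℕ) (H : Matrix (Fin m) (Fin n) (ZMod 2)), m < n →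
          GibbsHGP.IsLDPC H ΔB ΔC → GibbsHGP.IsExpander H ΔB ΔC γ δ →
          ∀ N : ℕ, N = n ^ 2 + m ^ 2 → N₀ ≤ N →
          ∀ a : ℝ → ℝ, GibbsHGP.IsGibbsRule β a →
            ENNReal.ofReal (Real.exp (α * √(N : ℝ))) ≤
                (GibbsHGP.quantumMixingTime β a (GibbsHGP.hgpX H H) (GibbsHGP.hgpZ H H) : ℝ≥0∞) ∧
              ENNReal.ofReal (Real.exp (α * √(N : ℝ))) ≤
                (GibbsHGP.errorMixingTime β a (GibbsHGP.hgpZ H H) : ℝ≥0∞) ∧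
              ENNReal.ofReal (Real.exp (α * √(N : ℝ))) ≤
                (GibbsHGP.errorMixingTime β a (GibbsHGP.hgpX H H) : ℝ≥0∞) := by
  have hC : 0 < ΔC := hB.trans hBC
  have hzcast : ((ΔC * (ΔB + ΔC - 1) : ℕ) : ℝ) = (ΔC : ℝ) * ((ΔB : ℝ) + (ΔC : ℝ) - 1) := by
    rw [Nat.cast_mul, Nat.cast_sub (by omega)]
    push_cast
    ring
  have hz1 : 1 ≤ ΔC * (ΔB + ΔC - 1) := Nat.mul_pos hC (by omega)
  have hlog : 0 ≤ 3 * Real.log (2 * ((ΔC : ℝ) * ((ΔB : ℝ) + (ΔC : ℝ) - 1))) := by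
    have : (1 : ℝ) ≤ (ΔC * (ΔB + ΔC - 1) : ℕ) := by exact_mod_cast hz1
    rw [← hzcast]
    exact mul_nonneg (by norm_num) (Real.log_nonneg (by linarith))
  refine ⟨_, hlog, le_rfl, fun β hβ => ?_⟩
  obtain ⟨α, hα, N₀, hpar⟩ := GibbsHGP.exists_parameters hB hC hγ
  refine ⟨α, hα, N₀, fun n m H hmn _ hexp N hN hN₀ a ha => ?_⟩
  have hedge := hexp.card_mul_eq
  rw [Fintype.card_fin, Fintype.card_fin] at hedge
  obtain ⟨hn, M, r, hM, hr, hrM, hq, hτ⟩ := hpar n m N hmn hedge hN hN₀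
  have hm : 0 < m := by
    refine Nat.pos_of_ne_zero fun h => ?_
    rw [h, zero_mul] at hedge
    have := Nat.mul_pos (show 0 < n by omega) hB
    omega
  have : Nonempty (Fin m) := ⟨⟨0, hm⟩⟩
  have : Nonempty (Fin n) := ⟨⟨0, hm.trans hmn⟩⟩
  have hB2 := hexp.two_le_bit_degree hδ hB (by omega) (by rwa [Fintype.card_fin])
  -- `ΔB ≥ 2` and `ΔC ≥ 3`
  have hz : 12 ≤ ΔC * (ΔB + ΔC - 1) := by
    calc 12 = 3 * 4 := rfl
      _ ≤ ΔC * (ΔB + ΔC - 1) := Nat.mul_le_mul (by omega) (by omega)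
  have hβ0 : 0 ≤ β := hlog.trans hβ.le
  rw [← hzcast] at hβ
  have hβz := GibbsHGP.exp_neg_half_le hz hβ
  have hcard : Fintype.card (Fin n × Fin n ⊕ Fin m × Fin m) = N := by
    rw [hN]
    simp [sq]
  rw [← hcard] at hq hτ ⊢
  have hZ : GibbsHGP.Confined (GibbsHGP.hgpZ H H) _ _ _ M :=
    GibbsHGP.confined_hgpZ hB hBC hexp hδ hγ (by simpa using hmn) (by rwa [Fintype.card_fin])
  -- The two types of errors are exchanged by the symmetry of the product of the code with itself.
  have hX := hZ.submatrix (Equiv.prodComm (Fin m) (Fin n))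
    (Equiv.sumCongr (Equiv.prodComm (Fin n) (Fin n)) (Equiv.prodComm (Fin m) (Fin m)))
  rw [← GibbsHGP.hgpX_eq_submatrix] at hX
  refine ⟨?_, ?_, ?_⟩
  · exact hZ.le_quantumMixingTime (GibbsHGP.row_mem_rowGroup _) hr hrM hz1 hβ0 hβz ha hq hτ
  · exact hZ.le_errorMixingTime hr hrM hz1 hβ0 hβz ha hq hτ
  · exact hX.le_errorMixingTime hr hrM hz1 hβ0 hβz ha hq hτ
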